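/- Let $d\ge 1$, $\mathbb S^d=\{x\in\mathbb R^{d+1}:\|x\|=1\}$ with surface measure $\nu$, and let $\mu$ be the normalized Haar measure on $SO(d+1)$. For $l\in\mathbb N_0=\{0,1,2,\dots\}$ let $\{B^l_q:1\le q\le N(d,l)\}$ be an orthonormal basis, with respect to $\langle f,g\rangle_2=\int f\bar g\,d\nu$, of the $N(d,l)$-dimensional space of spherical harmonics of order $l$ (restrictions to $\mathbb S^d$ of the complex harmonic homogeneous polynomials of degree $l$ in $d+1$ variables). For $f:\mathbb S^d\to\mathbb R$ and $g:SO(d+1)\to\mathbb R$ put $\phi^l_q(f)=\int f\,\overline{B^l_q}\,d\nu$, and let $\tilde\phi^l(g)$ be the $N(d,l)\times N(d,l)$ matrix with entries $\tilde\phi^l_{qr}(g)=\int_{SO(d+1)} g(u)\int_{\mathbb S^d}\overline{B^l_q(ux)}B^l_r(x)\,d\nu(x)\,d\mu(u)$. Let $X$ be a random vector in $\mathbb S^d$ with density $f_X$ with respect to $\nu$, let $U$ be a random element of $SO(d+1)$, independent of $X$, with square integrable density $f_U$ with respect to $\mu$, and let $Z_1,Z_2,\dots$ be i.i.d. copies of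 $Z=UX$. Assume that $\tilde\phi^l(f_U)$ is invertible for every $l\in\mathbb N_0$. For $T_n>0$ put $$K_{T_n}(x,z)=\sum_{0\le l\le T_n}\sum_{q}\Big(\sum_r(\tilde\phi^l(f_U))^{-1}_{qr}\overline{B^l_r(z)}\Big)B^l_q(x),$$ and, for $\theta\in\mathbb R$ and $x\in\mathbb S^d$, $$\mathrm{EL}_{f_X}(\theta;x)=\max\Big\{\prod_{i=1}^n(nw_i):\ w_i>0,\ \sum_{i=1}^n w_i=1,\ \sum_{i=1}^n w_i\big(\mathrm{Re}\,K_{T_n}(x,Z_i)-\theta\big)=0\Big\},$$ with $\max\emptyset=0$ and $-2\log 0=+\infty$. Assume that, for some $\beta\ge0$ and some $k\in\mathbb N$ with $k>d/4$: 1. there is $c_1>0$ with $\|(\tilde\phi^l(f_U))^{-1}\|_{\mathrm{op}}\le c_1 l^\beta$ for all $l\ge1$; 2. $f_X\in C^{2k}(\mathbb S^d)$; 3. $T_n\asymp n^{1/(4k+2\beta+d)}$; 4. $P(\mathrm{EL}_{f_X}(f_X(x);x)>0)\to1$ for each $x\in\mathbb S^d$; 5. for each $x\in\mathbb S^d$ there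 is $c>0$ with $E\big[(\mathrm{Re}\,K_{T_n}(x,Z))^2\big]\ge c\,T_n^{2\beta+d}$ for all $n\ge1$; 6. the Fourier–Laplace series $\sum_l\sum_q\phi^l_q(h)B^l_q(x)$ of $h=\Delta_{\mathbb S^d}^k f_X$, where $\Delta_{\mathbb S^d}$ is the Laplace–Beltrami operator, converges absolutely at every $x\in\mathbb S^d$. Then, for all $x\in\mathbb S^d$, as $n\to\infty$, $$-2\log\mathrm{EL}_{f_X}(f_X(x);x)\ \overset{d}{\longrightarrow}\ \chi^2(1).$$ Hence, for every $\alpha\in(0,1)$, with $\chi^2_\alpha(1)$ the $(1-\alpha)$ quantile of $\chi^2(1)$, the set $$\{\theta\in\mathbb R:-2\log\mathrm{EL}_{f_X}(\theta;x)\le\chi^2_\alpha(1)\}=\{\theta\in\mathbb R:\mathrm{EL}_{f_X}(\theta;x)\ge\exp(-\chi^2_\alpha(1)/2)\}$$ is a (possibly empty) interval and is a $(1-\alpha)\times100\%$ asymptotic confidence region for $f_X(x)$: the probability that it contains $f_X(x)$ tends to $1-\alpha$. -/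

import Mathlib

open MeasureTheory ProbabilityTheory Filter Topology
open scoped Manifold ENNReal

noncomputable section

namespace SphDeconv

/-! ### The sphere, the rotation group and their measures -/

/-- The unit hypersphere of `ℝ^(d+1)`. -/
abbrev Sph (d : ℕ) : Type := Metric.sphere (0 : EuclideanSpace ℝ (Fin (d + 1))) 1

/-- The group of real special orthogonal matrices of size `d+1`, with its Borel σ-algebra. -/
abbrev SO (d : ℕ) : Type := Matrix.specialOrthogonalGroup (Fin (d + 1)) ℝ

instance instMeasurableSpaceSO (d : ℕ) : MeasurableSpace (SO d) := borel (SO d)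

instance instBorelSpaceSO (d : ℕ) : BorelSpace (SO d) := ⟨rfl⟩

lemma SO.transpose_mul_self {d : ℕ} (u : SO d) :
    (u : Matrix (Fin (d + 1)) (Fin (d + 1)) ℝ).transpose * u = 1 :=
  (Matrix.mem_orthogonalGroup_iff' _ _).1 (Matrix.mem_specialOrthogonalGroup_iff.1 u.2).1

instance instIsTopologicalGroupSO (d : ℕ) : IsTopologicalGroup (SO d) where
  continuous_mul := by
    refine Continuous.subtype_mk ?_ _
    exact (continuous_subtype_val.comp continuous_fst).matrix_mul
      (continuous_subtype_val.comp continuous_snd)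
  continuous_inv := by
    refine Continuous.subtype_mk ?_ _
    exact continuous_subtype_val.matrix_transpose

instance instCompactSpaceSO (d : ℕ) : CompactSpace (SO d) := by
  have hcl : IsClosed {A : Matrix (Fin (d + 1)) (Fin (d + 1)) ℝ |
      A ∈ Matrix.specialOrthogonalGroup (Fin (d + 1)) ℝ} := by
    have : {A : Matrix (Fin (d + 1)) (Fin (d + 1)) ℝ |
        A ∈ Matrix.specialOrthogonalGroup (Fin (d + 1)) ℝ} =
        {A | A.transpose * A = 1} ∩ {A | A.det = 1} := by
      ext A
      simp only [Set.mem_ofPred_eq, Set.mem_inter_iff]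
      rw [Matrix.mem_specialOrthogonalGroup_iff]
      exact and_congr (Matrix.mem_orthogonalGroup_iff' _ _) Iff.rfl
    rw [this]
    exact (isClosed_eq (continuous_id.matrix_transpose.matrix_mul continuous_id)
      continuous_const).inter (isClosed_eq continuous_id.matrix_det continuous_const)
  have hK : IsCompact (Set.univ.pi fun _ : Fin (d + 1) =>
      Set.univ.pi fun _ : Fin (d + 1) => Set.Icc (-1 : ℝ) 1) :=
    isCompact_univ_pi fun _ => isCompact_univ_pi fun _ => isCompact_Icc
  refine isCompact_iff_compactSpace.1 (hK.of_isClosed_subset hcl ?_)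
  intro A hA i _ j _
  have h : ∑ x, A x j * A x j = 1 := by
    have h' := congrFun (congrFun (SO.transpose_mul_self ⟨A, hA⟩) j) j
    rw [Matrix.one_apply_eq] at h'
    exact h'
  have h2 : A i j * A i j ≤ ∑ x, A x j * A x j :=
    Finset.single_le_sum (f := fun x => A x j * A x j) (fun x _ => mul_self_nonneg _)
      (Finset.mem_univ i)
  rw [h] at h2
  constructor <;> nlinarith

/-- The normalized Haar measure on the rotation group: the left-invariant Borel measure of
total mass one. -/
def haarSO (d : ℕ) : Measure (SO d) := Measure.haarMeasure ⊤

/-- The surface measure on the sphere: the measure of `A` is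
`(d+1) * volume {t • a | 0 < t < 1, a ∈ A}`. -/
def surf (d : ℕ) : Measure (Sph d) := (volume : Measure (EuclideanSpace ℝ (Fin (d + 1)))).toSphere

/-- The action of a rotation on a point of the sphere (matrix times vector). -/
def rot {d : ℕ} (u : SO d) (x : Sph d) : Sph d :=
  ⟨WithLp.toLp 2 ((u : Matrix (Fin (d + 1)) (Fin (d + 1)) ℝ).mulVec
      (x : EuclideanSpace ℝ (Fin (d + 1))).ofLp), by
    have hx : ‖(x : EuclideanSpace ℝ (Fin (d + 1)))‖ = 1 := by simp
    rw [mem_sphere_zero_iff_norm]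
    refine Eq.trans ?_ hx
    rw [EuclideanSpace.norm_eq, EuclideanSpace.norm_eq]
    congr 1
    simp only [Real.norm_eq_abs, sq_abs]
    have key : ∀ v : Fin (d + 1) → ℝ,
        ∑ i, ((u : Matrix (Fin (d + 1)) (Fin (d + 1)) ℝ).mulVec v i) ^ 2 = ∑ i, v i ^ 2 := by
      intro v
      have h : ((u : Matrix (Fin (d + 1)) (Fin (d + 1)) ℝ).mulVec v) ⬝ᵥ
          ((u : Matrix (Fin (d + 1)) (Fin (d + 1)) ℝ).mulVec v) = v ⬝ᵥ v := by
        rw [Matrix.dotProduct_mulVec, Matrix.vecMul_mulVec, SO.transpose_mul_self,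
          Matrix.vecMul_one]
      simpa [dotProduct, sq] using h
    exact key _⟩

/-! ### Spherical harmonics -/

/-- The Laplacian `∑ i, ∂²/∂t_i²` on complex polynomials in `d+1` variables. -/
def polyLaplacian (d : ℕ) : MvPolynomial (Fin (d + 1)) ℂ →ₗ[ℂ] MvPolynomial (Fin (d + 1)) ℂ :=
  ∑ i, (MvPolynomial.pderiv i).toLinearMap ∘ₗ (MvPolynomial.pderiv i).toLinearMap

/-- Restriction of a complex polynomial to the sphere. -/
def restrictSph (d : ℕ) : MvPolynomial (Fin (d + 1)) ℂ →ₗ[ℂ] (Sph d → ℂ) :=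
  LinearMap.pi fun x =>
    (MvPolynomial.aeval fun i => (((x : EuclideanSpace ℝ (Fin (d + 1))) i : ℝ) : ℂ)).toLinearMap

/-- The space of spherical harmonics of order `l` in `d+1` variables: restrictions to the sphere
of the homogeneous harmonic polynomials of degree `l`. -/
def sphHarm (d l : ℕ) : Submodule ℂ (Sph d → ℂ) :=
  (MvPolynomial.homogeneousSubmodule (Fin (d + 1)) ℂ l ⊓ (polyLaplacian d).ker).map (restrictSph d)

/-- The dimension `N(d,l)` of the space of spherical harmonics of order `l`. -/
def harmDim (d l : ℕ) : ℕ := Module.finrank ℂ (sphHarm d l)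

/-- For every order `l`, the functions `B l q` form an orthonormal basis of the space of spherical
harmonics of order `l`, for the inner product `∫ f * conj g` with respect to surface measure. -/
structure IsHarmonicBasis (d : ℕ) (B : (l : ℕ) → Fin (harmDim d l) → Sph d → ℂ) : Prop where
  span_eq : ∀ l, Submodule.span ℂ (Set.range (B l)) = sphHarm d l
  orthonormal : ∀ l q r,
    ∫ x, B l q x * (starRingEnd ℂ) (B l r x) ∂(surf d) = if q = r then 1 else 0

/-! ### Fourier transforms and the deconvolution kernel -/

/-- The hyperspherical Fourier transform of `f` at degree `l` and order `q`. -/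
def fourierCoeff {d : ℕ} (B : (l : ℕ) → Fin (harmDim d l) → Sph d → ℂ) (f : Sph d → ℂ)
    (l : ℕ) (q : Fin (harmDim d l)) : ℂ :=
  ∫ x, f x * (starRingEnd ℂ) (B l q x) ∂(surf d)

/-- The rotational Fourier transform of `g` at degree `l`, a square matrix of size `N(d,l)`. -/
def rotFourier {d : ℕ} (B : (l : ℕ) → Fin (harmDim d l) → Sph d → ℂ) (g : SO d → ℝ) (l : ℕ) :
    Matrix (Fin (harmDim d l)) (Fin (harmDim d l)) ℂ :=
  Matrix.of fun q r =>
    ∫ u, (g u : ℂ) * (∫ x, (starRingEnd ℂ) (B l q (rot u x)) * B l r x ∂(surf d)) ∂(haarSO d)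

/-- The deconvolution kernel `K_T(x,z)` with truncation level `T`. -/
def kern {d : ℕ} (B : (l : ℕ) → Fin (harmDim d l) → Sph d → ℂ) (fU : SO d → ℝ) (T : ℝ)
    (x z : Sph d) : ℂ :=
  ∑ l ∈ Finset.range (⌊T⌋₊ + 1), ∑ q, (∑ r, (rotFourier B fU l)⁻¹ q r *
    (starRingEnd ℂ) (B l r z)) * B l q x

/-- The `ℓ²` operator norm of a complex square matrix. -/
def opNorm {m : ℕ} (A : Matrix (Fin m) (Fin m) ℂ) : ℝ := ‖Matrix.toEuclideanCLM (𝕜 := ℂ) A‖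

/-! ### The Laplace-Beltrami operator -/

/-- The Laplace-Beltrami operator on the sphere: the Euclidean Laplacian of the extension
`y ↦ f (y / |y|)` that is constant along rays, evaluated on the sphere. -/
def laplaceBeltrami {d : ℕ} (f : Sph d → ℝ) : Sph d → ℝ := fun x =>
  Laplacian.laplacian (fun y : EuclideanSpace ℝ (Fin (d + 1)) =>
    if h : y = 0 then (0 : ℝ) else f ⟨‖y‖⁻¹ • y, by
      rw [mem_sphere_zero_iff_norm, norm_smul, norm_inv, norm_norm,
        inv_mul_cancel₀ (norm_ne_zero_iff.2 h)]⟩) (x : EuclideanSpace ℝ (Fin (d + 1)))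

/-- Absolute convergence on the whole sphere of the Fourier-Laplace series
`∑ l, ∑ q, fourierCoeff B f l q * B l q x` of a real function `f`. -/
def AbsConvFourierLaplace {d : ℕ} (B : (l : ℕ) → Fin (harmDim d l) → Sph d → ℂ)
    (f : Sph d → ℝ) : Prop :=
  ∀ x, Summable fun p : (l : ℕ) × Fin (harmDim d l) =>
    ‖fourierCoeff B (fun y => (f y : ℂ)) p.1 p.2 * B p.1 p.2 x‖

/-! ### Empirical likelihood -/

/-- The empirical likelihood ratio of the numbers `a 0, …, a (n-1)`: the maximum of
`∏ i, n * w i` over positive weights `w` with `∑ i, w i = 1` and `∑ i, w i * a i = 0`.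
The products are bounded by one and the maximum is attained when there are such weights; when
there are none, `sSup ∅ = 0`. -/
def elRatio (n : ℕ) (a : Fin n → ℝ) : ℝ :=
  sSup {p : ℝ | ∃ w : Fin n → ℝ, (∀ i, 0 < w i) ∧ ∑ i, w i = 1 ∧ ∑ i, w i * a i = 0 ∧
    p = ∏ i, (n * w i)}

/-- The empirical likelihood ratio function for the density at `x`, from the first `n` terms of
the sequence of observations `z`, with truncation level `T`. -/
def elDensity {d : ℕ} (B : (l : ℕ) → Fin (harmDim d l) → Sph d → ℂ) (fU : SO d → ℝ) (T : ℝ)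
    (n : ℕ) (z : ℕ → Sph d) (θ : ℝ) (x : Sph d) : ℝ :=
  elRatio n fun i => (kern B fU T x (z i)).re - θ

/-- `-2 log e` for `e ≥ 0`, as an extended real number: it is `+∞` for `e = 0`. -/
def negTwoLog (e : ℝ) : EReal := -2 * ENNReal.log (ENNReal.ofReal e)

/-- The chi-square distribution with one degree of freedom, the law of the square of a standard
normal variable. -/
def chiSqOne : Measure ℝ := (gaussianReal 0 1).map fun t => t ^ 2

instance instIsProbabilityMeasureChiSqOne : IsProbabilityMeasure chiSqOne :=
  Measure.isProbabilityMeasure_map (by fun_prop)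

/-- The `(1 - α)` quantile of the chi-square distribution with one degree of freedom. -/
def chiSqQuantile (α : ℝ) : ℝ := sInf {t : ℝ | 1 - α ≤ cdf chiSqOne t}

end SphDeconv

end

open SphDeconv

/-!
The statement is Wilks' theorem for a triangular array. Fix `x` and put `θ = fX x`. The numbers
entering the empirical likelihood ratio are `h n (Z i)`, where `h n z = Re K_{T n}(x, z) - θ`, and
the ratio does not change when they are divided by `√(n E[(h n)²])`. The normalized numbers are
uniformly small, with row-wise vanishing means and unit total variance, under three conditions,
each of which comes from harmonic analysis on the sphere.

* Size. By the addition theorem the Christoffel function `∑ q, |B l q x|²` is constant, equal to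
  `N(d,l)` over the area, hence `O(l^(d-1))`. With the bound on the inverse rotational Fourier
  transform this gives `|K_T| = O(T^(β+d))` (`exists_norm_kern_le`). As `E[(h n)²]` is at least of
  order `T^(2β+d)`, the normalized numbers are `O(√(T^d / n))`, which tends to zero as `k > 0`.
* Mean. The rotational Fourier transform is multiplicative for the action of rotations on spherical
  harmonics, so `E[K_T(x, UX)]` is the truncated Fourier-Laplace series of `fX` at `x`
  (`integral_kern_rot`).
* Bias. The `l`-th Fourier coefficients of `Δ^k fX` are those of `fX` times `(-l(l+d-1))^k`
  (`fourierCoeff_iterate_laplaceBeltrami`). Since `4k > d`, Bessel's inequality makes the series of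
  `fX` uniformly convergent, and it converges to `fX` by completeness; the absolute convergence of
  the series of `Δ^k fX` makes the truncation error `o(T^(-2k))`
  (`exists_norm_sum_harmProj_sub_le`). As `n` is of order `T^(4k+2β+d)`, the bias is negligible
  against the standard deviation of the mean.

All facts on spherical harmonics rest on Green's formula `integral_laplacian_sub_mul` for functions
homogeneous on the ambient space. It is obtained without integration by parts: the spherical part of
the Laplacian is the sum over the coordinate planes of second derivatives along rotations, and each
of these is symmetric because surface measure is invariant under rotations. It yields the
orthogonality of different orders, thereby the decomposition of polynomials into spherical harmonics
and, with the Stone-Weierstrass theorem, completeness.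

Given the three conditions, Lagrange duality and a second order expansion show that `-2 log` of the
ratio differs from the square of the normalized sum by `o_P(1)` on the event that the ratio is
positive (`abs_neg_two_log_elRatio_sub_le`), and the sum is asymptotically standard normal by a
characteristic function computation (`tendstoInDistribution_sum_array`). The event has probability
tending to one by assumption.

The confidence region is an interval because the product of the weights is log-concave
(`ordConnected_elRatio_sub`), and its coverage converges because the chi-square law has no atoms.
-/


open scoped Pointwise

noncomputable section

namespace SphDeconv

/-! ### The empirical likelihood ratio of a finite family of numbers -/

/-- Weak duality: feasible weights are bounded by the dual product at every admissible
multiplier `t`. This is `x ≤ exp (x - 1)` for `x = n w i (1 + t a i)`, as these exponents sum to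
zero. -/
lemma prod_weights_le_dual {n : ℕ} {a w : Fin n → ℝ} {t : ℝ} (hw : ∀ i, 0 < w i)
    (hsum : ∑ i, w i = 1) (hmean : ∑ i, w i * a i = 0) (ht : ∀ i, 0 < 1 + t * a i) :
    ∏ i, (n * w i) ≤ ∏ i, (1 + t * a i)⁻¹ := by
  have hpos : 0 < ∏ i, (1 + t * a i) := Finset.prod_pos fun i _ => ht i
  rw [Finset.prod_inv_distrib, ← one_div, le_div_iff₀ hpos, ← Finset.prod_mul_distrib]
  calc ∏ i, (n * w i * (1 + t * a i))
      ≤ ∏ i, Real.exp (n * w i * (1 + t * a i) - 1) := by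
        refine Finset.prod_le_prod (fun i _ => ?_) fun i _ => ?_
        · have := hw i; have := ht i; positivity
        · simpa using Real.add_one_le_exp (n * w i * (1 + t * a i) - 1)
    _ = 1 := by
        rw [← Real.exp_sum, Real.exp_eq_one_iff, Finset.sum_sub_distrib]
        have : ∑ i, n * w i * (1 + t * a i) = n * ∑ i, w i + n * t * ∑ i, w i * a i := by
          rw [Finset.mul_sum, Finset.mul_sum, ← Finset.sum_add_distrib]
          exact Finset.sum_congr rfl fun i _ => by ring
        rw [this, hsum, hmean]
        simp

lemma elRatio_nonneg (n : ℕ) (a : Fin n → ℝ) : 0 ≤ elRatio n a := by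
  refine Real.sSup_nonneg ?_
  rintro p ⟨w, hw, -, -, rfl⟩
  exact Finset.prod_nonneg fun i _ => mul_nonneg n.cast_nonneg (hw i).le

lemma elRatio_le_dual {n : ℕ} {a : Fin n → ℝ} {t : ℝ} (ht : ∀ i, 0 < 1 + t * a i) :
    elRatio n a ≤ ∏ i, (1 + t * a i)⁻¹ := by
  refine Real.sSup_le ?_ (Finset.prod_nonneg fun i _ => (inv_pos.2 (ht i)).le)
  rintro p ⟨w, hw, h1, h2, rfl⟩
  exact prod_weights_le_dual hw h1 h2 ht

lemma le_elRatio {n : ℕ} {a w : Fin n → ℝ} (hw : ∀ i, 0 < w i)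
    (hsum : ∑ i, w i = 1) (hmean : ∑ i, w i * a i = 0) :
    ∏ i, (n * w i) ≤ elRatio n a := by
  refine le_csSup ⟨1, ?_⟩ ⟨w, hw, hsum, hmean, rfl⟩
  rintro p ⟨w, hw, h1, h2, rfl⟩
  simpa using prod_weights_le_dual (t := 0) hw h1 h2 (by simp)

/-- Strong duality: a multiplier solving the estimating equation gives the optimal weights. -/
lemma elRatio_eq_dual {n : ℕ} (hn : n ≠ 0) {a : Fin n → ℝ} {t : ℝ}
    (ht : ∀ i, 0 < 1 + t * a i) (hroot : ∑ i, a i / (1 + t * a i) = 0) :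
    elRatio n a = ∏ i, (1 + t * a i)⁻¹ := by
  have hn' : (n : ℝ) ≠ 0 := Nat.cast_ne_zero.2 hn
  refine le_antisymm (elRatio_le_dual ht) ?_
  have key := le_elRatio (n := n) (a := a) (w := fun i => (n : ℝ)⁻¹ * (1 + t * a i)⁻¹)
    (fun i => mul_pos (inv_pos.2 (by positivity)) (inv_pos.2 (ht i))) ?_ ?_
  · refine le_trans (le_of_eq (Finset.prod_congr rfl fun i _ => ?_)) key
    rw [mul_inv_cancel_left₀ hn']
  · have : ∀ i, (1 + t * a i)⁻¹ = 1 - t * (a i / (1 + t * a i)) := fun i => by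
      have := (ht i).ne'
      field_simp
      ring
    simp_rw [this]
    rw [← Finset.mul_sum, Finset.sum_sub_distrib, ← Finset.mul_sum, hroot]
    simp [hn']
  · simp_rw [mul_assoc]
    rw [← Finset.mul_sum]
    rw [← mul_zero (n : ℝ)⁻¹, ← hroot]
    exact congrArg _ (Finset.sum_congr rfl fun i _ => inv_mul_eq_div _ _)

lemma abs_log_one_add_sub_le {t : ℝ} (ht : |t| ≤ 1 / 2) :
    |Real.log (1 + t) - (t - t ^ 2 / 2)| ≤ 2 * |t| ^ 3 := by
  have h := Real.abs_log_sub_add_sum_range_le (x := -t) (by rw [abs_neg]; linarith) 2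
  rw [abs_neg] at h
  simp only [Finset.sum_range_succ, Finset.sum_range_zero] at h
  have h2 : |t| ^ 3 / (1 - |t|) ≤ 2 * |t| ^ 3 := by
    rw [div_le_iff₀ (by linarith)]
    have : 0 ≤ |t| ^ 3 := by positivity
    nlinarith
  refine le_trans (le_of_eq ?_) (h.trans h2)
  congr 1
  norm_num
  ring

/-- Second order expansion of the dual objective. -/
lemma abs_sum_log_sub_le {n : ℕ} {a : Fin n → ℝ} {ε L t : ℝ} (ha : ∀ i, |a i| ≤ ε)
    (ht : |t| ≤ L) (hL : L * ε ≤ 1 / 2) :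
    |∑ i, Real.log (1 + t * a i) - (t * ∑ i, a i - t ^ 2 / 2 * ∑ i, a i ^ 2)| ≤
      2 * L ^ 3 * ε * ∑ i, a i ^ 2 := by
  have h : ∑ i, Real.log (1 + t * a i) - (t * ∑ i, a i - t ^ 2 / 2 * ∑ i, a i ^ 2) =
      ∑ i, (Real.log (1 + t * a i) - (t * a i - (t * a i) ^ 2 / 2)) := by
    rw [Finset.mul_sum, Finset.mul_sum, ← Finset.sum_sub_distrib, ← Finset.sum_sub_distrib]
    exact Finset.sum_congr rfl fun i _ => by ring
  rw [h, Finset.mul_sum]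
  refine (Finset.abs_sum_le_sum_abs _ _).trans (Finset.sum_le_sum fun i _ => ?_)
  have hε : 0 ≤ ε := (abs_nonneg _).trans (ha i)
  have hL0 : 0 ≤ L := (abs_nonneg _).trans ht
  have hb : |t * a i| ≤ 1 / 2 := by
    rw [abs_mul]
    exact (mul_le_mul ht (ha i) (abs_nonneg _) hL0).trans hL
  refine (abs_log_one_add_sub_le hb).trans ?_
  rw [abs_mul, mul_pow]
  have h3 : |t| ^ 3 ≤ L ^ 3 := pow_le_pow_left₀ (abs_nonneg _) ht 3
  have h4 : |a i| ^ 3 ≤ ε * a i ^ 2 := by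
    rw [pow_succ', sq_abs]
    exact mul_le_mul_of_nonneg_right (ha i) (sq_nonneg _)
  calc 2 * (|t| ^ 3 * |a i| ^ 3) ≤ 2 * (L ^ 3 * (ε * a i ^ 2)) := by gcongr
    _ = _ := by ring

lemma one_add_mul_mem {n : ℕ} {a : Fin n → ℝ} {ε L t : ℝ} (ha : ∀ i, |a i| ≤ ε)
    (ht : |t| ≤ L) (hL : L * ε ≤ 1 / 2) (i : Fin n) :
    1 / 2 ≤ 1 + t * a i ∧ 1 + t * a i ≤ 2 := by
  have hL0 : 0 ≤ L := (abs_nonneg _).trans ht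
  have hb : |t * a i| ≤ 1 / 2 := by
    rw [abs_mul]
    exact (mul_le_mul ht (ha i) (abs_nonneg _) hL0).trans hL
  have := abs_le.1 hb
  constructor <;> linarith [this.1, this.2]

/-- The multiplier equation is solvable in `[-4s, 4s]` by the intermediate value theorem: its left
side is `∑ a i - t * ∑ a i ^ 2 / (1 + t * a i)`, where the second sum is at least `1 / 4`. -/
lemma exists_multiplier {n : ℕ} {a : Fin n → ℝ} {ε s : ℝ} (ha : ∀ i, |a i| ≤ ε)
    (hs : |∑ i, a i| ≤ s) (hQ : 1 / 2 ≤ ∑ i, a i ^ 2) (hsε : 4 * s * ε ≤ 1 / 2) :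
    ∃ t, |t| ≤ 4 * s ∧ ∑ i, a i / (1 + t * a i) = 0 := by
  have hs0 : 0 ≤ s := (abs_nonneg _).trans hs
  have hmem : ∀ t ∈ Set.Icc (-(4 * s)) (4 * s), ∀ i, 1 / 2 ≤ 1 + t * a i ∧ 1 + t * a i ≤ 2 :=
    fun t ht i => one_add_mul_mem ha (abs_le.2 ht) hsε i
  have hcont : ContinuousOn (fun t : ℝ => ∑ i, a i / (1 + t * a i))
      (Set.Icc (-(4 * s)) (4 * s)) := by
    refine continuousOn_finsetSum _ fun i _ => ?_
    refine ContinuousOn.div (by fun_prop) (by fun_prop) fun t ht => ?_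
    have := (hmem t ht i).1
    intro h
    rw [h] at this
    norm_num at this
  have hexp : ∀ t ∈ Set.Icc (-(4 * s)) (4 * s), ∀ i,
      a i / (1 + t * a i) = a i - t * (a i ^ 2 / (1 + t * a i)) := fun t ht i => by
    have := (hmem t ht i).1
    have : 1 + t * a i ≠ 0 := by intro h; rw [h] at this; norm_num at this
    rw [eq_sub_iff_add_eq, mul_div_assoc', ← add_div, div_eq_iff this]
    ring
  have hlow : ∀ t ∈ Set.Icc (-(4 * s)) (4 * s),
      1 / 4 ≤ ∑ i, a i ^ 2 / (1 + t * a i) := fun t ht => by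
    calc (1 : ℝ) / 4 ≤ ∑ i, a i ^ 2 / 2 := by rw [← Finset.sum_div]; linarith
      _ ≤ _ := Finset.sum_le_sum fun i _ => by
        obtain ⟨h1, h2⟩ := hmem t ht i
        exact div_le_div_of_nonneg_left (sq_nonneg _) (by linarith) h2
  have hr : (4 * s) ∈ Set.Icc (-(4 * s)) (4 * s) := ⟨by linarith, le_rfl⟩
  have hl : (-(4 * s)) ∈ Set.Icc (-(4 * s)) (4 * s) := ⟨le_rfl, by linarith⟩
  have hsum : ∀ t ∈ Set.Icc (-(4 * s)) (4 * s), ∑ i, a i / (1 + t * a i) =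
      ∑ i, a i - t * ∑ i, a i ^ 2 / (1 + t * a i) := fun t ht => by
    rw [Finset.mul_sum, ← Finset.sum_sub_distrib]
    exact Finset.sum_congr rfl fun i _ => hexp t ht i
  have hS := abs_le.1 hs
  obtain ⟨t, ht, h0⟩ := intermediate_value_Icc' (by linarith : -(4 * s) ≤ 4 * s) hcont
    (show (0 : ℝ) ∈ Set.Icc _ _ from ⟨by
      have := hlow _ hr
      simp only [hsum _ hr]
      nlinarith [hS.2], by
      have := hlow _ hl
      simp only [hsum _ hl]
      nlinarith [hS.1]⟩)
  exact ⟨t, abs_le.2 ht, h0⟩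

/-- Quadratic approximation of the log empirical likelihood ratio: the lower bound evaluates the
dual objective at `S / Q`, the upper bound at the exact multiplier. -/
lemma abs_neg_two_log_elRatio_sub_le {n : ℕ} {a : Fin n → ℝ} {ε s : ℝ} (ha : ∀ i, |a i| ≤ ε)
    (hs : |∑ i, a i| ≤ s) (hQ : 1 / 2 ≤ ∑ i, a i ^ 2) (hQ2 : ∑ i, a i ^ 2 ≤ 2)
    (hsε : 4 * s * ε ≤ 1 / 2) :
    0 < elRatio n a ∧
      |-2 * Real.log (elRatio n a) - (∑ i, a i) ^ 2 / ∑ i, a i ^ 2| ≤ 512 * s ^ 3 * ε := by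
  have hs0 : 0 ≤ s := (abs_nonneg _).trans hs
  have hn : n ≠ 0 := by
    rintro rfl
    norm_num at hQ
  have hε : 0 ≤ ε := (abs_nonneg _).trans (ha ⟨0, Nat.pos_of_ne_zero hn⟩)
  obtain ⟨t, ht, hroot⟩ := exists_multiplier ha hs hQ hsε
  have hpos : ∀ {t : ℝ}, |t| ≤ 4 * s → ∀ i, 0 < 1 + t * a i := fun ht i => by
    linarith [(one_add_mul_mem ha ht hsε i).1]
  have heq := elRatio_eq_dual hn (hpos ht) hroot
  have hel : 0 < elRatio n a := by
    rw [heq]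
    exact Finset.prod_pos fun i _ => inv_pos.2 (hpos ht i)
  refine ⟨hel, ?_⟩
  have hlog : ∀ {t : ℝ}, |t| ≤ 4 * s →
      Real.log (∏ i, (1 + t * a i)⁻¹) = -∑ i, Real.log (1 + t * a i) := fun ht => by
    rw [Real.log_prod fun i _ => (inv_pos.2 (hpos ht i)).ne']
    simp [Real.log_inv]
  set S := ∑ i, a i with hSdef
  set Q := ∑ i, a i ^ 2 with hQdef
  have hQ0 : 0 < Q := by linarith
  have hlam : |S / Q| ≤ 4 * s := by
    rw [abs_div, abs_of_pos hQ0, div_le_iff₀ hQ0]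
    nlinarith
  have herr : 2 * (4 * s) ^ 3 * ε * Q ≤ 256 * s ^ 3 * ε := by
    have : 0 ≤ s ^ 3 * ε := by positivity
    nlinarith
  have hlo := abs_sum_log_sub_le ha hlam hsε
  have hup := abs_sum_log_sub_le ha ht hsε
  rw [← hSdef, ← hQdef] at hlo hup
  have hle : Real.log (elRatio n a) ≤ -∑ i, Real.log (1 + S / Q * a i) := by
    rw [← hlog hlam]
    exact Real.log_le_log hel (elRatio_le_dual (hpos hlam))
  have heq' : Real.log (elRatio n a) = -∑ i, Real.log (1 + t * a i) := by
    rw [heq, hlog ht]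
  have h1 : S / Q * S - (S / Q) ^ 2 / 2 * Q = S ^ 2 / Q / 2 := by
    field_simp
    ring
  have h2 : t * S - t ^ 2 / 2 * Q ≤ S ^ 2 / Q / 2 := by
    have : S ^ 2 / Q / 2 - (t * S - t ^ 2 / 2 * Q) = (S - t * Q) ^ 2 / Q / 2 := by
      field_simp
      ring
    have h0 : 0 ≤ (S - t * Q) ^ 2 / Q / 2 := by positivity
    linarith
  rw [h1] at hlo
  have hlo' := abs_le.1 hlo
  have hup' := abs_le.1 hup
  rw [abs_le]
  constructor
  · linarith [hlo'.1]
  · rw [heq']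
    linarith [hup'.2]

/-- The supremum defining the empirical likelihood ratio is attained when it is positive. Zero
weights may be admitted, so that the simplex is compact: they make the product vanish. -/
lemma le_elRatio_iff {n : ℕ} {a : Fin n → ℝ} {c : ℝ} (hc : 0 < c) :
    c ≤ elRatio n a ↔ ∃ w ∈ stdSimplex ℝ (Fin n), ∑ i, w i * a i = 0 ∧ c ≤ ∏ i, (n * w i) := by
  have hposw : ∀ w ∈ stdSimplex ℝ (Fin n), c ≤ ∏ i, (n * w i) → ∀ i, 0 < w i := by
    intro w hw hcw i
    refine lt_of_le_of_ne (hw.1 i) fun h0 => ?_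
    have : ∏ i, (n * w i) = 0 :=
      Finset.prod_eq_zero (Finset.mem_univ i) (by rw [← h0, mul_zero])
    linarith
  constructor
  · intro h
    obtain ⟨p, w, hw, h1, h2, -⟩ : {p : ℝ | ∃ w : Fin n → ℝ, (∀ i, 0 < w i) ∧ ∑ i, w i = 1 ∧
        ∑ i, w i * a i = 0 ∧ p = ∏ i, (n * w i)}.Nonempty := by
      by_contra hne
      rw [Set.not_nonempty_iff_eq_empty] at hne
      rw [elRatio, hne, Real.sSup_empty] at h
      linarith
    have hK : IsCompact (stdSimplex ℝ (Fin n) ∩ {w | ∑ i, w i * a i = 0}) :=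
      (isCompact_stdSimplex ℝ (Fin n)).inter_right (isClosed_eq (by fun_prop) (by fun_prop))
    obtain ⟨v, hv, hmax⟩ := hK.exists_isMaxOn ⟨w, ⟨fun i => (hw i).le, h1⟩, h2⟩
      (f := fun w => ∏ i, ((n : ℝ) * w i)) (by fun_prop)
    have h0 : 0 ≤ ∏ i, (n * v i) :=
      Finset.prod_nonneg fun i _ => mul_nonneg n.cast_nonneg (hv.1.1 i)
    refine ⟨v, hv.1, hv.2, h.trans (Real.sSup_le ?_ h0)⟩
    rintro p ⟨w, hw, h1, h2, rfl⟩
    exact hmax ⟨⟨fun i => (hw i).le, h1⟩, h2⟩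
  · rintro ⟨w, hw, h2, hcw⟩
    exact hcw.trans (le_elRatio (hposw w hw hcw) hw.2 h2)

/-- Upper semicontinuity away from zero: positive superlevel sets are projections of closed sets
along the compact simplex. -/
lemma isClosed_le_elRatio {n : ℕ} {c : ℝ} (hc : 0 < c) :
    IsClosed {a : Fin n → ℝ | c ≤ elRatio n a} := by
  have : CompactSpace (stdSimplex ℝ (Fin n)) :=
    isCompact_iff_compactSpace.1 (isCompact_stdSimplex ℝ (Fin n))
  have hcl : IsClosed {p : stdSimplex ℝ (Fin n) × (Fin n → ℝ) |
      ∑ i, (p.1 : Fin n → ℝ) i * p.2 i = 0 ∧ c ≤ ∏ i, (n * (p.1 : Fin n → ℝ) i)} := by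
    have h1 : ∀ i, Continuous fun p : stdSimplex ℝ (Fin n) × (Fin n → ℝ) =>
        (p.1 : Fin n → ℝ) i := fun i =>
      (continuous_apply i).comp (continuous_subtype_val.comp continuous_fst)
    have h2 : ∀ i, Continuous fun p : stdSimplex ℝ (Fin n) × (Fin n → ℝ) => p.2 i := fun i =>
      (continuous_apply i).comp continuous_snd
    exact (isClosed_eq (continuous_finsetSum _ fun i _ => (h1 i).mul (h2 i))
      continuous_const).inter (isClosed_le continuous_const
        (continuous_finsetProd _ fun i _ => continuous_const.mul (h1 i)))
  convert! isClosedMap_snd_of_compactSpace _ hcl using 1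
  ext a
  simp only [Set.mem_ofPred_eq, le_elRatio_iff hc, Set.mem_image, Prod.exists,
    exists_eq_right, Subtype.exists]
  exact ⟨fun ⟨w, hw, h⟩ => ⟨w, hw, h⟩, fun ⟨w, hw, h⟩ => ⟨w, hw, h⟩⟩

lemma measurable_elRatio (n : ℕ) : Measurable (elRatio n) := by
  refine measurable_of_Ici fun c => ?_
  rcases lt_or_ge 0 c with hc | hc
  · exact (isClosed_le_elRatio hc).measurableSet
  · have : elRatio n ⁻¹' Set.Ici c = Set.univ :=
      Set.eq_univ_of_forall fun a => hc.trans (elRatio_nonneg n a)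
    rw [this]
    exact MeasurableSet.univ

/-- Log-concavity of `w ↦ ∏ i, n * w i`: it is at least `c` on a segment when it is so at the
end points. -/
lemma le_prod_convexCombination {n : ℕ} {v w : Fin n → ℝ} {c s t : ℝ} (hc : 0 < c)
    (hv : ∀ i, 0 ≤ v i) (hw : ∀ i, 0 ≤ w i) (hs : 0 ≤ s) (ht : 0 ≤ t) (hst : s + t = 1)
    (hcv : c ≤ ∏ i, (n * v i)) (hcw : c ≤ ∏ i, (n * w i)) :
    c ≤ ∏ i, (n * (s * v i + t * w i)) := by
  calc c = c ^ s * c ^ t := by rw [← Real.rpow_add hc, hst, Real.rpow_one]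
    _ ≤ (∏ i, (n * v i)) ^ s * (∏ i, (n * w i)) ^ t :=
      mul_le_mul (Real.rpow_le_rpow hc.le hcv hs) (Real.rpow_le_rpow hc.le hcw ht)
        (Real.rpow_nonneg hc.le _) (Real.rpow_nonneg (hc.le.trans hcv) _)
    _ = ∏ i, ((n * v i) ^ s * (n * w i) ^ t) := by
      rw [Finset.prod_mul_distrib (f := fun i => (n * v i) ^ s),
        Real.finsetProd_rpow _ _ fun i _ => mul_nonneg n.cast_nonneg (hv i),
        Real.finsetProd_rpow _ _ fun i _ => mul_nonneg n.cast_nonneg (hw i)]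
    _ ≤ _ := by
      refine Finset.prod_le_prod (fun i _ => ?_) fun i _ => ?_
      · have := hv i; have := hw i; positivity
      · refine (Real.geom_mean_le_arith_mean2_weighted hs ht
          (mul_nonneg n.cast_nonneg (hv i)) (mul_nonneg n.cast_nonneg (hw i)) hst).trans ?_
        exact le_of_eq (by ring)

/-- Superlevel sets of `θ ↦ elRatio n (b - θ)` are convex: the segment between optimal weights for
`θ₁` and `θ₂` consists of feasible weights for the points between them. -/
lemma ordConnected_elRatio_sub {n : ℕ} (b : Fin n → ℝ) {c : ℝ} (hc : 0 < c) :
    {θ : ℝ | c ≤ elRatio n fun i => b i - θ}.OrdConnected := by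
  have hiff : ∀ θ : ℝ, ∀ w ∈ stdSimplex ℝ (Fin n),
      ∑ i, w i * (b i - θ) = (∑ i, w i * b i) - θ := fun θ w hw => by
    simp_rw [mul_sub]
    rw [Finset.sum_sub_distrib, ← Finset.sum_mul, hw.2, one_mul]
  refine Convex.ordConnected ?_
  intro θ₁ h₁ θ₂ h₂ s t hs ht hst
  simp only [Set.mem_ofPred_eq, le_elRatio_iff hc] at h₁ h₂ ⊢
  obtain ⟨v, hv, hv0, hcv⟩ := h₁
  obtain ⟨w, hw, hw0, hcw⟩ := h₂
  have hmem := convex_stdSimplex ℝ (Fin n) hv hw hs ht hst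
  rw [hiff _ _ hv] at hv0
  rw [hiff _ _ hw] at hw0
  refine ⟨s • v + t • w, hmem, ?_, ?_⟩
  · rw [hiff _ _ hmem]
    have : ∑ i, (s • v + t • w) i * b i = s * ∑ i, v i * b i + t * ∑ i, w i * b i := by
      rw [Finset.mul_sum, Finset.mul_sum, ← Finset.sum_add_distrib]
      exact Finset.sum_congr rfl fun i _ => by simp; ring
    rw [this, smul_eq_mul, smul_eq_mul]
    linear_combination s * hv0 + t * hw0
  · exact le_prod_convexCombination hc hv.1 hw.1 hs ht hst hcv hcw

/-! ### Central limit theory for triangular arrays -/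

section Arrays

variable {Ω S : Type*} [MeasurableSpace Ω] [MeasurableSpace S] {P : Measure Ω}
  [IsProbabilityMeasure P] {Z : ℕ → Ω → S} {V : Ω → S}

lemma integrable_comp_of_bounded {V : Ω → S} (hV : AEMeasurable V P) {h : S → ℝ}
    (hh : Measurable h) {b : ℝ} (hb : ∀ z, |h z| ≤ b) : Integrable (fun ω => h (V ω)) P :=
  Integrable.of_bound (hh.comp_aemeasurable hV).aestronglyMeasurable b
    (Eventually.of_forall fun _ => hb _)

/-- Chebyshev's inequality for sums of bounded functions of i.i.d. observations. -/
lemma measure_sum_deviation_le (hind : iIndepFun Z P) (hlaw : ∀ i, IdentDistrib (Z i) V P P)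
    {h : S → ℝ} (hh : Measurable h) {b : ℝ} (hb : ∀ z, |h z| ≤ b) (n : ℕ) {c : ℝ} (hc : 0 < c) :
    P {ω | c ≤ |∑ i ∈ Finset.range n, h (Z i ω) - n * ∫ ω, h (V ω) ∂P|} ≤
      ENNReal.ofReal (n * (∫ ω, h (V ω) ^ 2 ∂P) / c ^ 2) := by
  have hid : ∀ i, IdentDistrib (fun ω => h (Z i ω)) (fun ω => h (V ω)) P P :=
    fun i => (hlaw i).comp hh
  have hVm : AEMeasurable V P := (hlaw 0).aemeasurable_snd
  have hmem : ∀ W : Ω → S, AEMeasurable W P → MemLp (fun ω => h (W ω)) 2 P := fun W hW =>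
    MemLp.of_bound (hh.comp_aemeasurable hW).aestronglyMeasurable b
      (Eventually.of_forall fun _ => hb _)
  have hmem' : ∀ i, MemLp (fun ω => h (Z i ω)) 2 P :=
    fun i => hmem _ (hlaw i).aemeasurable_fst
  have hsum : MemLp (∑ i ∈ Finset.range n, fun ω => h (Z i ω)) 2 P :=
    memLp_finsetSum' _ fun i _ => hmem' i
  have hvar : Var[∑ i ∈ Finset.range n, fun ω => h (Z i ω); P] ≤ n * ∫ ω, h (V ω) ^ 2 ∂P := by
    rw [IndepFun.variance_sum (fun i _ => hmem' i)
      (fun i _ j _ hij => (hind.indepFun hij).comp hh hh)]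
    simp_rw [fun i => (hid i).variance_eq]
    rw [Finset.sum_const, Finset.card_range, nsmul_eq_mul]
    refine mul_le_mul_of_nonneg_left ?_ n.cast_nonneg
    rw [variance_eq_sub (hmem V hVm)]
    simp only [Pi.pow_apply]
    linarith [sq_nonneg (∫ ω, h (V ω) ∂P)]
  have hmean : ∫ ω, (∑ i ∈ Finset.range n, fun ω => h (Z i ω)) ω ∂P =
      n * ∫ ω, h (V ω) ∂P := by
    simp only [Finset.sum_apply]
    rw [integral_finsetSum _ fun i _ =>
      integrable_comp_of_bounded (hlaw i).aemeasurable_fst hh hb]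
    simp_rw [fun i => (hid i).integral_eq]
    simp
  have := meas_ge_le_variance_div_sq hsum hc
  rw [hmean] at this
  simp only [Finset.sum_apply] at this
  refine this.trans (ENNReal.ofReal_le_ofReal ?_)
  gcongr

lemma norm_exp_sub_quadratic_le {x : ℝ} (hx : |x| ≤ 1) :
    ‖Complex.exp (x * Complex.I) - (1 + x * Complex.I - x ^ 2 / 2)‖ ≤ |x| ^ 3 := by
  have hn : ‖(x : ℂ) * Complex.I‖ = |x| := by simp
  have h := Complex.exp_bound (x := x * Complex.I) (by rwa [hn]) (n := 3) (by norm_num)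
  rw [hn] at h
  simp only [Finset.sum_range_succ, Finset.sum_range_zero] at h
  have e : (x : ℂ) * Complex.I * (x * Complex.I) = -(x : ℂ) ^ 2 := by
    linear_combination (x : ℂ) ^ 2 * Complex.I_mul_I
  have h3 : 0 ≤ |x| ^ 3 := by positivity
  refine le_trans (le_of_eq ?_) (h.trans ?_)
  · congr 2
    norm_num [Nat.factorial, pow_succ]
    linear_combination (-(1 : ℂ) / 2) * e
  · norm_num [Nat.factorial]
    nlinarith

variable {g : ℕ → S → ℝ} {ε : ℕ → ℝ}

/-- Second order expansion of the characteristic function of a row entry. -/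
lemma tendsto_mul_charFun_sub_one (hV : AEMeasurable V P) (hg : ∀ n, Measurable (g n))
    (hb : ∀ᶠ n in atTop, ∀ z, |g n z| ≤ ε n) (hε : Tendsto ε atTop (𝓝 0))
    (hm : Tendsto (fun n : ℕ => n * ∫ ω, g n (V ω) ∂P) atTop (𝓝 0))
    (hv : Tendsto (fun n : ℕ => n * ∫ ω, g n (V ω) ^ 2 ∂P) atTop (𝓝 1)) (t : ℝ) :
    Tendsto (fun n : ℕ => (n : ℂ) * (charFun (P.map fun ω => g n (V ω)) t - 1)) atTop
      (𝓝 (-(t : ℂ) ^ 2 / 2)) := by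
  have hmain : Tendsto (fun n : ℕ => ((n * ∫ ω, g n (V ω) ∂P : ℝ) : ℂ) * (t * Complex.I) -
      ((n * ∫ ω, g n (V ω) ^ 2 ∂P : ℝ) : ℂ) * ((t : ℂ) ^ 2 / 2)) atTop
      (𝓝 (((0 : ℝ) : ℂ) * (t * Complex.I) - ((1 : ℝ) : ℂ) * ((t : ℂ) ^ 2 / 2))) :=
    (((Complex.continuous_ofReal.tendsto _).comp hm).mul_const _).sub
      (((Complex.continuous_ofReal.tendsto _).comp hv).mul_const _)
  have herr : Tendsto (fun n : ℕ => |t| ^ 3 * ε n * (n * ∫ ω, g n (V ω) ^ 2 ∂P)) atTop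
      (𝓝 (|t| ^ 3 * 0 * 1)) := (hε.const_mul _).mul hv
  have hdiff : Tendsto (fun n : ℕ => (n : ℂ) * (charFun (P.map fun ω => g n (V ω)) t - 1) -
      (((n * ∫ ω, g n (V ω) ∂P : ℝ) : ℂ) * (t * Complex.I) -
      ((n * ∫ ω, g n (V ω) ^ 2 ∂P : ℝ) : ℂ) * ((t : ℂ) ^ 2 / 2))) atTop (𝓝 0) := by
    refine squeeze_zero_norm' ?_ (by simpa using herr)
    have hsmall : ∀ᶠ n in atTop, |t| * ε n ≤ 1 := by
      have : Tendsto (fun n => |t| * ε n) atTop (𝓝 (|t| * 0)) := hε.const_mul _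
      rw [mul_zero] at this
      exact (this.eventually_lt_const one_pos).mono fun n hn => hn.le
    filter_upwards [hb, hsmall] with n hbn hsn
    have hi1 := integrable_comp_of_bounded hV (hg n) hbn
    have hi2 : Integrable (fun ω => g n (V ω) ^ 2) P :=
      integrable_comp_of_bounded hV (h := fun z => g n z ^ 2) (b := ε n ^ 2) ((hg n).pow_const 2)
        fun z => by
          rw [abs_pow]
          exact pow_le_pow_left₀ (abs_nonneg _) (hbn z) 2
    have hie : Integrable (fun ω => Complex.exp ((t * g n (V ω) : ℝ) * Complex.I)) P := by
      refine Integrable.of_bound (C := 1) ?_ (Eventually.of_forall fun ω => ?_)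
      · have : AEMeasurable (fun ω => g n (V ω)) P := (hg n).comp_aemeasurable hV
        have h2 : Measurable fun x : ℝ => Complex.exp ((t * x : ℝ) * Complex.I) := by fun_prop
        exact (h2.comp_aemeasurable this).aestronglyMeasurable
      · exact (Complex.norm_exp_ofReal_mul_I _).le
    have hchar : charFun (P.map fun ω => g n (V ω)) t =
        ∫ ω, Complex.exp ((t * g n (V ω) : ℝ) * Complex.I) ∂P := by
      rw [charFun_apply_real, integral_map (φ := fun ω => g n (V ω))
        ((hg n).comp_aemeasurable hV) (Continuous.aestronglyMeasurable (by fun_prop))]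
      simp
    have hi3 : Integrable (fun ω => (1 : ℂ) + (t * g n (V ω) : ℝ) * Complex.I -
        ((t * g n (V ω) : ℝ) : ℂ) ^ 2 / 2) P := by
      have h1 := (hi1.ofReal (𝕜 := ℂ)).const_mul (t * Complex.I)
      have h2 := (hi2.ofReal (𝕜 := ℂ)).const_mul ((t : ℂ) ^ 2 / 2)
      refine (((integrable_const (1 : ℂ)).add h1).sub h2).congr (Eventually.of_forall fun ω => ?_)
      simp only [Pi.add_apply, Pi.sub_apply, RCLike.ofReal_alg,
        Complex.real_smul, mul_one]
      push_cast
      ring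
    have hI : ∫ ω, ((1 : ℂ) + (t * g n (V ω) : ℝ) * Complex.I -
        ((t * g n (V ω) : ℝ) : ℂ) ^ 2 / 2) ∂P = 1 + (t * Complex.I) * (∫ ω, g n (V ω) ∂P : ℝ) -
        ((t : ℂ) ^ 2 / 2) * (∫ ω, g n (V ω) ^ 2 ∂P : ℝ) := by
      have h1 : Integrable (fun ω => t * Complex.I * ((g n (V ω) : ℝ) : ℂ)) P :=
        (hi1.ofReal (𝕜 := ℂ)).const_mul (t * Complex.I)
      have h2 : Integrable (fun ω => (t : ℂ) ^ 2 / 2 * ((g n (V ω) ^ 2 : ℝ) : ℂ)) P :=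
        (hi2.ofReal (𝕜 := ℂ)).const_mul ((t : ℂ) ^ 2 / 2)
      have e : ∀ ω, (1 : ℂ) + (t * g n (V ω) : ℝ) * Complex.I -
          ((t * g n (V ω) : ℝ) : ℂ) ^ 2 / 2 = 1 + t * Complex.I * ((g n (V ω) : ℝ) : ℂ) -
          (t : ℂ) ^ 2 / 2 * ((g n (V ω) ^ 2 : ℝ) : ℂ) := fun ω => by push_cast; ring
      simp_rw [e]
      have h3 : Integrable (fun ω => 1 + t * Complex.I * ((g n (V ω) : ℝ) : ℂ)) P :=
        (integrable_const (1 : ℂ)).add h1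
      rw [integral_sub h3 h2, integral_add (integrable_const (1 : ℂ)) h1, integral_const_mul,
        integral_const_mul, integral_complex_ofReal, integral_complex_ofReal]
      simp
    have heq : (n : ℂ) * (charFun (P.map fun ω => g n (V ω)) t - 1) -
        (((n * ∫ ω, g n (V ω) ∂P : ℝ) : ℂ) * (t * Complex.I) -
        ((n * ∫ ω, g n (V ω) ^ 2 ∂P : ℝ) : ℂ) * ((t : ℂ) ^ 2 / 2)) =
        n * ∫ ω, (Complex.exp ((t * g n (V ω) : ℝ) * Complex.I) -
          (1 + (t * g n (V ω) : ℝ) * Complex.I - ((t * g n (V ω) : ℝ) : ℂ) ^ 2 / 2)) ∂P := by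
      rw [integral_sub hie hi3, hI, hchar]
      push_cast
      ring
    rw [heq, norm_mul, Complex.norm_natCast]
    have hle : ‖∫ ω, (Complex.exp ((t * g n (V ω) : ℝ) * Complex.I) -
        (1 + (t * g n (V ω) : ℝ) * Complex.I - ((t * g n (V ω) : ℝ) : ℂ) ^ 2 / 2)) ∂P‖ ≤
        ∫ ω, |t| ^ 3 * ε n * g n (V ω) ^ 2 ∂P := by
      refine norm_integral_le_of_norm_le (hi2.const_mul _) (Eventually.of_forall fun ω => ?_)
      refine (norm_exp_sub_quadratic_le ?_).trans ?_
      · rw [abs_mul]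
        exact (mul_le_mul_of_nonneg_left (hbn _) (abs_nonneg _)).trans hsn
      · rw [abs_mul, mul_pow, mul_assoc]
        refine mul_le_mul_of_nonneg_left ?_ (by positivity)
        rw [pow_succ', sq_abs]
        exact mul_le_mul_of_nonneg_right (hbn _) (sq_nonneg _)
    rw [integral_const_mul] at hle
    calc (n : ℝ) * _ ≤ n * (|t| ^ 3 * ε n * ∫ ω, g n (V ω) ^ 2 ∂P) :=
          mul_le_mul_of_nonneg_left hle n.cast_nonneg
      _ = _ := by ring
  have := hdiff.add hmain
  simp only [sub_add_cancel, Complex.ofReal_zero, zero_mul, Complex.ofReal_one, one_mul,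
    zero_sub, zero_add] at this
  rwa [neg_div]

/-- Central limit theorem for a triangular array of uniformly small row-wise i.i.d. variables
with asymptotically vanishing means and unit total variance. -/
lemma tendstoInDistribution_sum_array (hind : iIndepFun Z P)
    (hlaw : ∀ i, IdentDistrib (Z i) V P P) (hg : ∀ n, Measurable (g n))
    (hb : ∀ᶠ n in atTop, ∀ z, |g n z| ≤ ε n) (hε : Tendsto ε atTop (𝓝 0))
    (hm : Tendsto (fun n : ℕ => n * ∫ ω, g n (V ω) ∂P) atTop (𝓝 0))
    (hv : Tendsto (fun n : ℕ => n * ∫ ω, g n (V ω) ^ 2 ∂P) atTop (𝓝 1)) :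
    TendstoInDistribution (fun (n : ℕ) ω => ∑ i ∈ Finset.range n, g n (Z i ω)) atTop
      (fun x : ℝ => x) (fun _ => P) (gaussianReal 0 1) where
  forall_aemeasurable n := Finset.aemeasurable_fun_sum _ fun i _ =>
    (hg n).comp_aemeasurable (hlaw i).aemeasurable_fst
  tendsto := by
    refine ProbabilityMeasure.tendsto_iff_tendsto_charFun.2 fun t => ?_
    have hlim := Complex.tendsto_one_add_pow_exp_of_tendsto
      (tendsto_mul_charFun_sub_one (hlaw 0).aemeasurable_snd hg hb hε hm hv t)
    simp only [ProbabilityMeasure.coe_mk]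
    have h0 : charFun (Measure.map (fun x : ℝ => x) (gaussianReal 0 1)) t =
        Complex.exp (-(t : ℂ) ^ 2 / 2) := by
      rw [Measure.map_id', charFun_gaussianReal]
      simp [neg_div]
    rw [h0]
    refine hlim.congr fun n => ?_
    have hind' : iIndepFun (fun i ω => g n (Z i ω)) P := hind.comp _ fun _ => hg n
    have hprod := iIndepFun.charFun_map_fun_finsetSum_eq_prod (s := Finset.range n)
      (X := fun i ω => g n (Z i ω))
      (fun i _ => (hg n).comp_aemeasurable (hlaw i).aemeasurable_fst)
      (hind'.restrict (Finset.range n))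
    rw [hprod, Finset.prod_apply]
    have : ∀ i, P.map (fun ω => g n (Z i ω)) = P.map fun ω => g n (V ω) :=
      fun i => ((hlaw i).comp (hg n)).map_eq
    simp [this]

/-- Two sequences that agree with probability tending to one have the same limit in
distribution. -/
lemma tendstoInDistribution_of_measure_ne {E Ω' : Type*} [MeasurableSpace E] [TopologicalSpace E]
    [BorelSpace E] [MeasurableSpace Ω'] {Q : Measure Ω'} [IsProbabilityMeasure Q]
    {X Y : ℕ → Ω → E} {W : Ω' → E}
    (hX : TendstoInDistribution X atTop W (fun _ => P) Q) (hY : ∀ n, AEMeasurable (Y n) P)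
    {A : ℕ → Set Ω} (hA : Tendsto (fun n => P.real (A n)) atTop (𝓝 0))
    (hXY : ∀ n, ∀ ω, ω ∉ A n → Y n ω = X n ω) :
    TendstoInDistribution Y atTop W (fun _ => P) Q where
  forall_aemeasurable := hY
  aemeasurable_limit := hX.aemeasurable_limit
  tendsto := by
    have h := ProbabilityMeasure.tendsto_iff_forall_integral_tendsto.1 hX.tendsto
    refine ProbabilityMeasure.tendsto_iff_forall_integral_tendsto.2 fun f => ?_
    have hdiff : Tendsto (fun n => ∫ ω, f (Y n ω) ∂P - ∫ ω, f (X n ω) ∂P) atTop (𝓝 0) := by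
      have hlim : Tendsto (fun n => 2 * ‖f‖ * P.real (A n)) atTop (𝓝 0) := by
        simpa using hA.const_mul (2 * ‖f‖)
      refine squeeze_zero_norm (fun n => ?_) hlim
      have hi : ∀ {U : Ω → E}, AEMeasurable U P → Integrable (fun ω => f (U ω)) P :=
        fun hU => Integrable.of_bound
          (f.continuous.measurable.comp_aemeasurable hU).aestronglyMeasurable ‖f‖
          (Eventually.of_forall fun ω => f.norm_coe_le_norm _)
      rw [← integral_sub (hi (hY n)) (hi (hX.forall_aemeasurable n))]
      set B := toMeasurable P (A n)
      have hB : MeasurableSet B := measurableSet_toMeasurable _ _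
      have hPB : P.real B = P.real (A n) := by
        simp only [measureReal_def, B, measure_toMeasurable]
      calc ‖∫ ω, (f (Y n ω) - f (X n ω)) ∂P‖
          ≤ ∫ ω, B.indicator (fun _ => 2 * ‖f‖) ω ∂P := by
            refine norm_integral_le_of_norm_le ((integrable_const _).indicator hB)
              (Eventually.of_forall fun ω => ?_)
            by_cases hω : ω ∈ B
            · rw [Set.indicator_of_mem hω]
              refine (norm_sub_le _ _).trans ?_
              linarith [f.norm_coe_le_norm (Y n ω), f.norm_coe_le_norm (X n ω)]
            · rw [Set.indicator_of_notMem hω,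
                hXY n ω fun h => hω (subset_toMeasurable _ _ h)]
              simp
        _ = 2 * ‖f‖ * P.real (A n) := by
            rw [integral_indicator_const _ hB, smul_eq_mul, hPB, mul_comm]
    have h2 := hdiff.add (h f)
    simp only [zero_add] at h2
    refine h2.congr' (Eventually.of_forall fun n => ?_) |>.trans (le_of_eq ?_)
    · simp only [ProbabilityMeasure.coe_mk]
      rw [integral_map (hY n) f.continuous.aestronglyMeasurable,
        integral_map (hX.forall_aemeasurable n) f.continuous.aestronglyMeasurable]
      ring
    · rfl

end Arrays

/-! ### Wilks' theorem for triangular arrays -/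

lemma elRatio_const_mul {n : ℕ} {c : ℝ} (hc : c ≠ 0) (a : Fin n → ℝ) :
    elRatio n (fun i => c * a i) = elRatio n a := by
  have h : ∀ w : Fin n → ℝ, ∑ i, w i * (c * a i) = 0 ↔ ∑ i, w i * a i = 0 := fun w => by
    have : ∑ i, w i * (c * a i) = c * ∑ i, w i * a i := by
      rw [Finset.mul_sum]
      exact Finset.sum_congr rfl fun i _ => by ring
    rw [this, mul_eq_zero, or_iff_right hc]
  simp only [elRatio, h]

lemma negTwoLog_of_pos {e : ℝ} (he : 0 < e) : negTwoLog e = ((-2 * Real.log e : ℝ) : EReal) := by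
  rw [negTwoLog, ENNReal.log_ofReal_of_pos he, EReal.coe_mul]
  rfl

lemma negTwoLog_zero : negTwoLog 0 = ⊤ := by
  rw [negTwoLog, ENNReal.ofReal_zero, ENNReal.log_zero]
  exact EReal.coe_mul_bot_of_neg (by norm_num : (-2 : ℝ) < 0)

lemma negTwoLog_le_coe_iff {e q : ℝ} (he : 0 ≤ e) :
    negTwoLog e ≤ (q : EReal) ↔ Real.exp (-q / 2) ≤ e := by
  rcases he.eq_or_lt with rfl | h
  · rw [negTwoLog_zero]
    simp [Real.exp_pos]
  · rw [negTwoLog_of_pos h, EReal.coe_le_coe_iff, ← Real.le_log_iff_exp_le h]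
    constructor <;> intro h <;> linarith

lemma measurable_negTwoLog : Measurable negTwoLog := by
  have h : ∀ e, negTwoLog e = if 0 < e then ((-2 * Real.log e : ℝ) : EReal) else ⊤ := by
    intro e
    split_ifs with he
    · exact negTwoLog_of_pos he
    · rw [← negTwoLog_zero, negTwoLog, negTwoLog, ENNReal.ofReal_of_nonpos (not_lt.1 he),
        ENNReal.ofReal_zero]
  rw [funext h]
  exact Measurable.ite measurableSet_Ioi
    (measurable_coe_real_ereal.comp (Real.measurable_log.const_mul _)) measurable_const

section Wilks

variable {Ω S : Type*} [MeasurableSpace Ω] [MeasurableSpace S] {P : Measure Ω}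
  [IsProbabilityMeasure P] {Z : ℕ → Ω → S} {V : Ω → S} {g : ℕ → S → ℝ} {ε : ℕ → ℝ}

omit [IsProbabilityMeasure P] in
lemma aemeasurable_elRatio_comp (hZ : ∀ i, AEMeasurable (Z i) P) {h : S → ℝ} (hh : Measurable h)
    (n : ℕ) : AEMeasurable (fun ω => elRatio n fun i => h (Z i ω)) P :=
  (measurable_elRatio n).comp_aemeasurable
    (aemeasurable_pi_lambda _ fun i => hh.comp_aemeasurable (hZ i))

/-- On the event that the sum is at most `s + 1` and the sum of squares is close to one, the log
empirical likelihood ratio is close to the squared sum. -/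
lemma abs_neg_two_log_sub_sq_lt {n : ℕ} {a : Fin n → ℝ} {e s κ δ : ℝ} (hδ : 0 < δ)
    (hs : 0 ≤ s) (hκ : 0 < κ) (hκ1 : κ ≤ 1 / 4) (hκ2 : κ * (16 * (s + 1) ^ 2) ≤ δ)
    (ha : ∀ i, |a i| ≤ e) (hsum : |∑ i, a i| ≤ s + 1) (hQ : |∑ i, a i ^ 2 - 1| ≤ 2 * κ)
    (he1 : 4 * (s + 1) * e ≤ 1 / 2) (he2 : 512 * (s + 1) ^ 3 * e ≤ δ / 4) :
    |-2 * Real.log (elRatio n a) - (∑ i, a i) ^ 2| < δ := by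
  have hQ' := abs_le.1 hQ
  have hQ1 : 1 / 2 ≤ ∑ i, a i ^ 2 := by linarith
  have h := (abs_neg_two_log_elRatio_sub_le ha hsum hQ1 (by linarith) he1).2
  set T := ∑ i, a i
  set Q := ∑ i, a i ^ 2
  have hQ0 : 0 < Q := by linarith
  have hT : T ^ 2 ≤ (s + 1) ^ 2 := by
    rw [← sq_abs]
    exact pow_le_pow_left₀ (abs_nonneg _) hsum 2
  have h2 : |T ^ 2 / Q - T ^ 2| ≤ δ / 4 := by
    have : T ^ 2 / Q - T ^ 2 = T ^ 2 * (1 - Q) / Q := by field_simp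
    rw [this, abs_div, abs_mul, abs_of_pos hQ0, div_le_iff₀ hQ0, abs_of_nonneg (sq_nonneg T),
      abs_sub_comm]
    calc T ^ 2 * |Q - 1| ≤ (s + 1) ^ 2 * (2 * κ) := by gcongr
      _ ≤ δ / 4 * (1 / 2) := by linarith
      _ ≤ δ / 4 * Q := by gcongr
  have h3 : -2 * Real.log (elRatio n a) - T ^ 2 =
      (-2 * Real.log (elRatio n a) - T ^ 2 / Q) + (T ^ 2 / Q - T ^ 2) := by ring
  rw [h3]
  refine (abs_add_le _ _).trans_lt ?_
  linarith

/-- For a standardized triangular array, `-2 log` of the empirical likelihood ratio differs from the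
squared row sum by a term that vanishes in probability. -/
lemma tendstoInMeasure_neg_two_log_sub_sq (hind : iIndepFun Z P)
    (hlaw : ∀ i, IdentDistrib (Z i) V P P) (hg : ∀ n, Measurable (g n))
    (hb : ∀ᶠ n in atTop, ∀ z, |g n z| ≤ ε n) (hε : Tendsto ε atTop (𝓝 0))
    (hm : Tendsto (fun n : ℕ => n * ∫ ω, g n (V ω) ∂P) atTop (𝓝 0))
    (hv : Tendsto (fun n : ℕ => n * ∫ ω, g n (V ω) ^ 2 ∂P) atTop (𝓝 1)) :
    TendstoInMeasure P
      ((fun (n : ℕ) ω => -2 * Real.log (elRatio n fun i => g n (Z i ω))) -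
        fun (n : ℕ) ω => (∑ i ∈ Finset.range n, g n (Z i ω)) ^ 2) atTop 0 := by
  rw [tendstoInMeasure_iff_norm]
  intro δ hδ
  rw [ENNReal.tendsto_nhds_zero]
  intro η hη
  obtain ⟨r, hr0, hrη⟩ : ∃ r : ℝ, 0 < r ∧ ENNReal.ofReal r ≤ η := by
    obtain ⟨r, -, h1, h2⟩ := ENNReal.lt_iff_exists_real_btwn.1 hη
    exact ⟨r, ENNReal.ofReal_pos.1 h1, h2.le⟩
  -- the sum leaves `[-(s + 1), s + 1]` with probability at most `2 / s ^ 2 = r / 2`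
  set s := 2 / √r with hs
  have hsr : 0 < √r := Real.sqrt_pos.2 hr0
  have hs0 : 0 < s := by positivity
  have hs2 : 2 / s ^ 2 = r / 2 := by
    rw [hs, div_pow, Real.sq_sqrt hr0.le]
    field_simp
  set κ := min (1 / 4) (δ / (16 * (s + 1) ^ 2)) with hκdef
  have hκ : 0 < κ := lt_min (by norm_num) (by positivity)
  have hκ2 : κ * (16 * (s + 1) ^ 2) ≤ δ := by
    rw [← le_div_iff₀ (by positivity)]
    exact min_le_right _ _
  have hsmall : ∀ {C c : ℝ}, 0 < c → ∀ᶠ n in atTop, C * ε n ≤ c := fun {C c} hc => by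
    have : Tendsto (fun n => C * ε n) atTop (𝓝 (C * 0)) := hε.const_mul _
    rw [mul_zero] at this
    exact (this.eventually_lt_const hc).mono fun n hn => hn.le
  have hε2 : ∀ᶠ n in atTop, 2 * ε n ^ 2 / κ ^ 2 ≤ r / 2 := by
    have : Tendsto (fun n => 2 * ε n ^ 2 / κ ^ 2) atTop (𝓝 (2 * 0 ^ 2 / κ ^ 2)) :=
      ((hε.pow 2).const_mul 2).div_const _
    have h0 : (2 : ℝ) * 0 ^ 2 / κ ^ 2 = 0 := by simp
    rw [h0] at this
    exact (this.eventually_lt_const (by linarith : 0 < r / 2)).mono fun n hn => hn.le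
  have hv1 : ∀ᶠ n : ℕ in atTop, |n * ∫ ω, g n (V ω) ^ 2 ∂P - 1| < κ := by
    have := Metric.tendsto_nhds.1 hv κ hκ
    simpa [Real.dist_eq] using this
  have hm1 : ∀ᶠ n : ℕ in atTop, |n * ∫ ω, g n (V ω) ∂P| < 1 := by
    have := Metric.tendsto_nhds.1 hm 1 one_pos
    simpa [Real.dist_eq] using this
  filter_upwards [hb, hsmall (C := 4 * (s + 1)) (c := 1 / 2) (by norm_num),
    hsmall (C := 512 * (s + 1) ^ 3) (c := δ / 4) (by linarith), hε2, hv1, hm1]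
    with n hbn he1 he2 hε2n hvn hmn
  have hκ1 : κ ≤ 1 / 4 := min_le_left _ _
  have hvn' := abs_lt.1 hvn
  have hmn' := abs_lt.1 hmn
  have hsqb : ∀ z, |g n z ^ 2| ≤ ε n ^ 2 := fun z => by
    rw [abs_pow]
    exact pow_le_pow_left₀ (abs_nonneg _) (hbn z) 2
  have hd1 := measure_sum_deviation_le hind hlaw (hg n) hbn n hs0
  have hd2 := measure_sum_deviation_le hind hlaw ((hg n).pow_const 2) hsqb n hκ
  have hb1 : ENNReal.ofReal (n * (∫ ω, g n (V ω) ^ 2 ∂P) / s ^ 2) ≤ ENNReal.ofReal (r / 2) := by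
    refine ENNReal.ofReal_le_ofReal ?_
    rw [← hs2]
    gcongr
    linarith
  have hb2 : ENNReal.ofReal (n * (∫ ω, (g n (V ω) ^ 2) ^ 2 ∂P) / κ ^ 2) ≤
      ENNReal.ofReal (r / 2) := by
    refine ENNReal.ofReal_le_ofReal (le_trans ?_ hε2n)
    refine div_le_div_of_nonneg_right ?_ (sq_nonneg κ)
    have hV := (hlaw 0).aemeasurable_snd
    have h4 : ∫ ω, (g n (V ω) ^ 2) ^ 2 ∂P ≤ ∫ ω, ε n ^ 2 * g n (V ω) ^ 2 ∂P := by
      refine integral_mono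
        (integrable_comp_of_bounded hV (h := fun z => (g n z ^ 2) ^ 2) (b := (ε n ^ 2) ^ 2)
          (((hg n).pow_const 2).pow_const 2) fun z => ?_)
        ((integrable_comp_of_bounded hV (h := fun z => g n z ^ 2) ((hg n).pow_const 2)
          hsqb).const_mul _) fun ω => ?_
      · rw [abs_pow]
        exact pow_le_pow_left₀ (abs_nonneg _) (hsqb z) 2
      · change (g n (V ω) ^ 2) ^ 2 ≤ ε n ^ 2 * g n (V ω) ^ 2
        rw [sq (g n (V ω) ^ 2)]
        exact mul_le_mul_of_nonneg_right ((le_abs_self _).trans (hsqb _)) (sq_nonneg _)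
    rw [integral_const_mul] at h4
    calc n * ∫ ω, (g n (V ω) ^ 2) ^ 2 ∂P
        ≤ n * (ε n ^ 2 * ∫ ω, g n (V ω) ^ 2 ∂P) := by gcongr
      _ = ε n ^ 2 * (n * ∫ ω, g n (V ω) ^ 2 ∂P) := by ring
      _ ≤ ε n ^ 2 * 2 := by gcongr; linarith
      _ = 2 * ε n ^ 2 := mul_comm _ _
  have hsub : {ω | δ ≤ ‖((fun (n : ℕ) ω => -2 * Real.log (elRatio n fun i => g n (Z i ω))) -
        fun (n : ℕ) ω => (∑ i ∈ Finset.range n, g n (Z i ω)) ^ 2) n ω - (0 : Ω → ℝ) ω‖} ⊆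
      {ω | s ≤ |∑ i ∈ Finset.range n, g n (Z i ω) - n * ∫ ω, g n (V ω) ∂P|} ∪
      {ω | κ ≤ |∑ i ∈ Finset.range n, g n (Z i ω) ^ 2 - n * ∫ ω, g n (V ω) ^ 2 ∂P|} := by
    intro ω hω
    by_contra hnot
    simp only [Set.mem_union, Set.mem_ofPred_eq, not_or, not_le] at hnot
    obtain ⟨hn1, hn2⟩ := hnot
    refine absurd (Set.mem_ofPred_eq ▸ hω) (not_le.2 ?_)
    simp only [Pi.sub_apply, Pi.zero_apply, sub_zero, Real.norm_eq_abs]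
    have hn1' := abs_lt.1 hn1
    have hn2' := abs_lt.1 hn2
    rw [Finset.sum_range] at hn1' hn2' ⊢
    refine abs_neg_two_log_sub_sq_lt hδ hs0.le hκ hκ1 hκ2 (fun i => hbn _) ?_ ?_ he1 he2
    · rw [abs_le]
      constructor <;> linarith [hn1'.1, hn1'.2]
    · rw [abs_le]
      constructor <;> linarith [hn2'.1, hn2'.2]
  calc P _ ≤ _ := measure_mono hsub
    _ ≤ _ := measure_union_le _ _
    _ ≤ ENNReal.ofReal (r / 2) + ENNReal.ofReal (r / 2) :=
        add_le_add (hd1.trans hb1) (hd2.trans hb2)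
    _ = ENNReal.ofReal r := by
        rw [← ENNReal.ofReal_add (by linarith) (by linarith), add_halves]
    _ ≤ η := hrη

/-- Wilks' theorem: the log empirical likelihood ratio of a standardized triangular array is
asymptotically chi-square with one degree of freedom. -/
theorem tendstoInDistribution_negTwoLog_elRatio (hind : iIndepFun Z P)
    (hlaw : ∀ i, IdentDistrib (Z i) V P P) (hg : ∀ n, Measurable (g n))
    (hb : ∀ᶠ n in atTop, ∀ z, |g n z| ≤ ε n) (hε : Tendsto ε atTop (𝓝 0))
    (hm : Tendsto (fun n : ℕ => n * ∫ ω, g n (V ω) ∂P) atTop (𝓝 0))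
    (hv : Tendsto (fun n : ℕ => n * ∫ ω, g n (V ω) ^ 2 ∂P) atTop (𝓝 1))
    (hpos : Tendsto (fun n : ℕ => P.real {ω | 0 < elRatio n fun i => g n (Z i ω)})
      atTop (𝓝 1)) :
    TendstoInDistribution (fun (n : ℕ) ω => negTwoLog (elRatio n fun i => g n (Z i ω))) atTop
      (fun t : ℝ => (t : EReal)) (fun _ => P) chiSqOne := by
  have hZm := fun i => (hlaw i).aemeasurable_fst
  have hRm : ∀ n : ℕ, AEMeasurable (fun ω => elRatio n fun i => g n (Z i ω)) P :=
    fun n => aemeasurable_elRatio_comp hZm (hg n) n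
  have hsq := (tendstoInDistribution_sum_array hind hlaw hg hb hε hm hv).continuous_comp
    (g := fun x : ℝ => x ^ 2) (by fun_prop)
  have hreal := tendstoInDistribution_of_tendstoInMeasure_sub
    (fun (n : ℕ) ω => -2 * Real.log (elRatio n fun i => g n (Z i ω))) _ hsq
    (tendstoInMeasure_neg_two_log_sub_sq hind hlaw hg hb hε hm hv)
    (fun n => (Real.measurable_log.comp_aemeasurable (hRm n)).const_mul _)
  -- off the vanishing event where the ratio is zero, `negTwoLog` is the real number `-2 log`
  have hE := hreal.continuous_comp continuous_coe_real_ereal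
  have hbad : Tendsto (fun n : ℕ => P.real {ω | 0 < elRatio n fun i => g n (Z i ω)}ᶜ)
      atTop (𝓝 0) := by
    have h : ∀ n : ℕ, P.real {ω | 0 < elRatio n fun i => g n (Z i ω)}ᶜ =
        1 - P.real {ω | 0 < elRatio n fun i => g n (Z i ω)} := fun n =>
      probReal_compl_eq_one_sub₀ ((hRm n).nullMeasurableSet_preimage measurableSet_Ioi)
    simp_rw [h]
    simpa using hpos.const_sub 1
  have hfin := tendstoInDistribution_of_measure_ne hE
    (fun n => measurable_negTwoLog.comp_aemeasurable (hRm n)) hbad fun n ω hω => by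
      simp only [Set.mem_compl_iff, Set.mem_ofPred_eq, not_not] at hω
      exact negTwoLog_of_pos hω
  refine ⟨hfin.forall_aemeasurable, measurable_coe_real_ereal.aemeasurable, ?_⟩
  have hmap : (gaussianReal 0 1).map (Real.toEReal ∘ (fun x : ℝ => x ^ 2) ∘ fun x : ℝ => x) =
      chiSqOne.map fun t : ℝ => (t : EReal) := by
    unfold chiSqOne
    rw [Measure.map_map measurable_coe_real_ereal (by fun_prop)]
    rfl
  exact hfin.tendsto.mono_right (le_of_eq (congrArg 𝓝 (Subtype.ext hmap)))

end Wilks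

/-! ### Quantiles of the chi-square distribution -/

instance nullSingletonClass_chiSqOne : NullSingletonClass chiSqOne where
  measure_singleton q := by
    have : NullSingletonClass (gaussianReal 0 1) := nullSingletonClass_gaussianReal one_ne_zero
    rw [chiSqOne, Measure.map_apply (by fun_prop) (measurableSet_singleton q)]
    have hsub : (fun t : ℝ => t ^ 2) ⁻¹' {q} ⊆ {√q, -√q} := by
      intro t ht
      rw [Set.mem_preimage, Set.mem_singleton_iff] at ht
      rw [← ht, Real.sqrt_sq_eq_abs]
      rcases abs_choice t with h | h <;> simp [h]
    exact measure_mono_null hsub (Set.Finite.measure_zero (by simp) _)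

/-- The quantile is exact, since the chi-square distribution has no atoms. -/
lemma measureReal_chiSqOne_Iic_quantile {α : ℝ} (h0 : 0 < α) (h1 : α < 1) :
    chiSqOne.real (Set.Iic (chiSqQuantile α)) = 1 - α := by
  rw [← cdf_eq_real]
  set A := {t : ℝ | 1 - α ≤ cdf chiSqOne t} with hA
  have hne : A.Nonempty := by
    obtain ⟨t, ht⟩ := ((tendsto_cdf_atTop chiSqOne).eventually_const_lt
      (by linarith : 1 - α < 1)).exists
    exact ⟨t, ht.le⟩
  have hbdd : BddBelow A := by
    obtain ⟨t, ht⟩ := ((tendsto_cdf_atBot chiSqOne).eventually_lt_const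
      (by linarith : 0 < 1 - α)).exists
    refine ⟨t, fun s hs => le_of_lt ((monotone_cdf chiSqOne).reflect_lt (ht.trans_le hs))⟩
  have hq : chiSqQuantile α = sInf A := rfl
  rw [hq]
  refine le_antisymm ?_ ?_
  · have hleft : Function.leftLim (cdf chiSqOne) (sInf A) = cdf chiSqOne (sInf A) := by
      have h := (cdf chiSqOne).measure_singleton (sInf A)
      rw [measure_cdf, measure_singleton] at h
      have h2 := ENNReal.ofReal_eq_zero.1 h.symm
      exact le_antisymm ((monotone_cdf chiSqOne).leftLim_le le_rfl) (by linarith)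
    rw [← hleft]
    refine le_of_tendsto ((monotone_cdf chiSqOne).tendsto_leftLim (sInf A)) ?_
    filter_upwards [self_mem_nhdsWithin] with t ht
    by_contra hlt
    exact absurd (csInf_le hbdd (not_le.1 hlt).le) (not_le.2 ht)
  · have hright := ((cdf chiSqOne).right_continuous (sInf A)).mono Set.Ioi_subset_Ici_self
    refine ge_of_tendsto hright ?_
    filter_upwards [self_mem_nhdsWithin] with t ht
    obtain ⟨a, ha, hat⟩ := (csInf_lt_iff hbdd hne).1 ht
    exact ha.trans (monotone_cdf chiSqOne hat.le)

/-- Convergence of coverage probabilities at the quantiles of the limit. -/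
lemma tendsto_measureReal_le_quantile {Ω : Type*} [MeasurableSpace Ω] {P : Measure Ω}
    [IsProbabilityMeasure P] {W : ℕ → Ω → EReal}
    (hW : TendstoInDistribution W atTop (fun t : ℝ => (t : EReal)) (fun _ => P) chiSqOne)
    {α : ℝ} (h0 : 0 < α) (h1 : α < 1) :
    Tendsto (fun n => P.real {ω | W n ω ≤ ((chiSqQuantile α : ℝ) : EReal)}) atTop
      (𝓝 (1 - α)) := by
  have hfr : (chiSqOne.map fun t : ℝ => (t : EReal))
      (frontier (Set.Iic ((chiSqQuantile α : ℝ) : EReal))) = 0 := by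
    refine measure_mono_null (t := {((chiSqQuantile α : ℝ) : EReal)})
      (frontier_Iic_subset _) ?_
    rw [Measure.map_apply measurable_coe_real_ereal (measurableSet_singleton _)]
    have : (fun t : ℝ => (t : EReal)) ⁻¹' {((chiSqQuantile α : ℝ) : EReal)} =
        {chiSqQuantile α} := by
      ext t
      simp
    rw [this, measure_singleton]
  have h := ProbabilityMeasure.tendsto_measure_of_null_frontier_of_tendsto' hW.tendsto hfr
  have h2 := (ENNReal.tendsto_toReal ?_).comp h
  swap
  · exact (measure_lt_top (chiSqOne.map fun t : ℝ => (t : EReal)) _).ne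
  have hlim : ((chiSqOne.map fun t : ℝ => (t : EReal))
      (Set.Iic ((chiSqQuantile α : ℝ) : EReal))).toReal = 1 - α := by
    rw [← measureReal_chiSqOne_Iic_quantile h0 h1,
      Measure.map_apply measurable_coe_real_ereal measurableSet_Iic, measureReal_def]
    congr 2
    ext t
    simp
  rw [← hlim]
  refine h2.congr fun n => ?_
  simp only [Function.comp_apply, ProbabilityMeasure.coe_mk]
  rw [Measure.map_apply_of_aemeasurable (hW.forall_aemeasurable n) measurableSet_Iic]
  rfl

/-! ### Linear isometries acting on the sphere -/

/-- The ambient Euclidean space of the sphere. -/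
abbrev Eu (d : ℕ) : Type := EuclideanSpace ℝ (Fin (d + 1))

/-- The action of a linear isometry of the ambient space on the sphere. -/
def isoSph {d : ℕ} (L : Eu d ≃ₗᵢ[ℝ] Eu d) (x : Sph d) : Sph d :=
  ⟨L x, by rw [mem_sphere_zero_iff_norm, L.norm_map, norm_eq_of_mem_sphere]⟩

lemma continuous_isoSph {d : ℕ} (L : Eu d ≃ₗᵢ[ℝ] Eu d) : Continuous (isoSph L) :=
  Continuous.subtype_mk (L.continuous.comp continuous_subtype_val) _

lemma Sph.norm_coe {d : ℕ} (x : Sph d) : ‖(x : Eu d)‖ = 1 := norm_eq_of_mem_sphere x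

lemma Sph.coe_ne_zero {d : ℕ} (x : Sph d) : (x : Eu d) ≠ 0 := by
  rw [← norm_ne_zero_iff, x.norm_coe]
  exact one_ne_zero

instance instIsFiniteMeasureSurf (d : ℕ) : IsFiniteMeasure (surf d) := by
  unfold surf
  infer_instance

instance instIsOpenPosMeasureSurf (d : ℕ) : (surf d).IsOpenPosMeasure := by
  unfold surf
  infer_instance

/-- The surface measure is invariant under linear isometries, since the cone over the preimage
of a set is the preimage of the cone. -/
lemma measurePreserving_isoSph {d : ℕ} (L : Eu d ≃ₗᵢ[ℝ] Eu d) :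
    MeasurePreserving (isoSph L) (surf d) (surf d) := by
  refine ⟨(continuous_isoSph L).measurable, ?_⟩
  ext s hs
  rw [Measure.map_apply (continuous_isoSph L).measurable hs, surf,
    Measure.toSphere_apply' _ hs,
    Measure.toSphere_apply' _ ((continuous_isoSph L).measurable hs)]
  congr 1
  have hcone : Set.Ioo (0 : ℝ) 1 • (Subtype.val '' (isoSph L ⁻¹' s) : Set (Eu d)) =
      L ⁻¹' (Set.Ioo (0 : ℝ) 1 • (Subtype.val '' s : Set (Eu d))) := by
    ext y
    simp only [Set.mem_smul, Set.mem_image, Set.mem_preimage, Subtype.exists, exists_and_right,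
      exists_eq_right]
    constructor
    · rintro ⟨r, hr, z, ⟨hz, hzs⟩, rfl⟩
      exact ⟨r, hr, L z, ⟨(isoSph L ⟨z, hz⟩).2, hzs⟩, (L.map_smul r z).symm⟩
    · rintro ⟨r, hr, z, ⟨hz, hzs⟩, h⟩
      refine ⟨r, hr, L.symm z, ⟨?_, ?_⟩, ?_⟩
      · rw [mem_sphere_zero_iff_norm, L.symm.norm_map]
        exact mem_sphere_zero_iff_norm.1 hz
      · convert hzs using 1
        exact Subtype.ext (L.apply_symm_apply z)
      · rw [← L.symm.map_smul, h, L.symm_apply_apply]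
  rw [hcone]
  exact L.measurePreserving.measure_preimage_emb L.toHomeomorph.measurableEmbedding _

lemma integral_comp_isoSph {d : ℕ} (L : Eu d ≃ₗᵢ[ℝ] Eu d) {f : Sph d → ℂ} (hf : Continuous f) :
    ∫ x, f (isoSph L x) ∂(surf d) = ∫ x, f x ∂(surf d) := by
  have h := integral_map (μ := surf d) (φ := isoSph L) (continuous_isoSph L).aemeasurable
    (f := f) hf.aestronglyMeasurable
  rw [(measurePreserving_isoSph L).map_eq] at h
  exact h.symm

/-! ### Rotations in coordinate planes -/

section PlaneRotation

variable {d : ℕ}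

/-- The projection of `x` to the plane of the coordinates `i ≠ j`. -/
def planeProj (i j : Fin (d + 1)) (x : Eu d) : Eu d :=
  x i • EuclideanSpace.single i (1 : ℝ) + x j • EuclideanSpace.single j (1 : ℝ)

/-- The projection of `x` to the plane of the coordinates `i ≠ j`, turned by a right angle. -/
def planeTurn (i j : Fin (d + 1)) (x : Eu d) : Eu d :=
  x i • EuclideanSpace.single j (1 : ℝ) - x j • EuclideanSpace.single i (1 : ℝ)

/-- The rotation by the angle `t` in the plane of the coordinates `i ≠ j`. -/
def planeRot (i j : Fin (d + 1)) (t : ℝ) (x : Eu d) : Eu d :=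
  x + (Real.cos t - 1) • planeProj i j x + Real.sin t • planeTurn i j x

lemma planeRot_neg_planeRot {i j : Fin (d + 1)} (hij : i ≠ j) (t : ℝ) (x : Eu d) :
    planeRot i j (-t) (planeRot i j t x) = x := by
  have h := Real.sin_sq_add_cos_sq t
  ext k
  simp only [planeRot, planeProj, planeTurn, Real.cos_neg, Real.sin_neg, PiLp.add_apply,
    PiLp.sub_apply, PiLp.smul_apply, smul_eq_mul, PiLp.single_apply]
  by_cases hki : k = i
  · subst hki
    simp only [if_true, if_neg hij, if_neg hij.symm]
    linear_combination (x k) * h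
  · by_cases hkj : k = j
    · subst hkj
      simp only [if_true, if_neg hij, if_neg hij.symm]
      linear_combination (x k) * h
    · simp [hki, hkj]

lemma norm_planeRot {i j : Fin (d + 1)} (hij : i ≠ j) (t : ℝ) (x : Eu d) :
    ‖planeRot i j t x‖ = ‖x‖ := by
  have h := Real.sin_sq_add_cos_sq t
  have hsq : ‖planeRot i j t x‖ ^ 2 = ‖x‖ ^ 2 := by
    rw [← real_inner_self_eq_norm_sq, ← real_inner_self_eq_norm_sq, planeRot, planeProj, planeTurn]
    simp only [inner_add_left, inner_add_right, inner_sub_left, inner_sub_right,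
      real_inner_smul_left, real_inner_smul_right, EuclideanSpace.inner_single_left,
      EuclideanSpace.inner_single_right, PiLp.single_apply, PiLp.add_apply, PiLp.sub_apply,
      PiLp.smul_apply, smul_eq_mul, map_one, one_mul,
      if_true, if_neg hij, if_neg hij.symm, mul_one, mul_zero, conj_trivial]
    linear_combination (x i ^ 2 + x j ^ 2) * h
  exact (sq_eq_sq₀ (norm_nonneg _) (norm_nonneg _)).1 hsq

/-- The rotation in a coordinate plane as a linear isometry. -/
def planeIso {i j : Fin (d + 1)} (hij : i ≠ j) (t : ℝ) : Eu d ≃ₗᵢ[ℝ] Eu d where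
  toFun := planeRot i j t
  invFun := planeRot i j (-t)
  map_add' x y := by
    simp only [planeRot, planeProj, planeTurn, PiLp.add_apply]
    module
  map_smul' c x := by
    simp only [planeRot, planeProj, planeTurn, PiLp.smul_apply, smul_eq_mul, RingHom.id_apply]
    module
  left_inv := planeRot_neg_planeRot hij t
  right_inv x := by
    have := planeRot_neg_planeRot hij (-t) x
    rwa [neg_neg] at this
  norm_map' := norm_planeRot hij t

lemma continuous_planeProj (i j : Fin (d + 1)) : Continuous (planeProj (d := d) i j) := by
  unfold planeProj
  fun_prop

lemma continuous_planeTurn (i j : Fin (d + 1)) : Continuous (planeTurn (d := d) i j) := by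
  unfold planeTurn
  fun_prop

lemma planeRot_zero (i j : Fin (d + 1)) (x : Eu d) : planeRot i j 0 x = x := by
  simp [planeRot]

/-- The velocity of `t ↦ planeRot i j t x`. -/
def planeVel (i j : Fin (d + 1)) (t : ℝ) (x : Eu d) : Eu d :=
  -Real.sin t • planeProj i j x + Real.cos t • planeTurn i j x

/-- The acceleration of `t ↦ planeRot i j t x`. -/
def planeAcc (i j : Fin (d + 1)) (t : ℝ) (x : Eu d) : Eu d :=
  -Real.cos t • planeProj i j x + -Real.sin t • planeTurn i j x

lemma hasDerivAt_planeRot (i j : Fin (d + 1)) (t : ℝ) (x : Eu d) :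
    HasDerivAt (fun t => planeRot i j t x) (planeVel i j t x) t := by
  have h1 := ((Real.hasDerivAt_cos t).sub_const 1).smul_const (planeProj i j x)
  have h2 := (Real.hasDerivAt_sin t).smul_const (planeTurn i j x)
  exact (h1.const_add x).add h2

lemma hasDerivAt_planeVel (i j : Fin (d + 1)) (t : ℝ) (x : Eu d) :
    HasDerivAt (fun t => planeVel i j t x) (planeAcc i j t x) t := by
  have h1 := (Real.hasDerivAt_sin t).neg.smul_const (planeProj i j x)
  have h2 := (Real.hasDerivAt_cos t).smul_const (planeTurn i j x)
  exact h1.add h2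

/-- The second derivative at time zero of `F` along the rotations in the coordinate plane of
`i ≠ j`. -/
def rotSecondDeriv (i j : Fin (d + 1)) (F : Eu d → ℂ) (x : Eu d) : ℂ :=
  fderiv ℝ (fderiv ℝ F) x (planeTurn i j x) (planeTurn i j x) - fderiv ℝ F x (planeProj i j x)

/-- Twice continuous differentiability away from the origin. -/
def SmoothOff (F : Eu d → ℂ) : Prop := ∀ x, x ≠ 0 → ContDiffAt ℝ 2 F x

lemma SmoothOff.hasFDerivAt {F : Eu d → ℂ} (hF : SmoothOff F) {x : Eu d} (hx : x ≠ 0) :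
    HasFDerivAt F (fderiv ℝ F x) x :=
  ((hF x hx).differentiableAt (by norm_num)).hasFDerivAt

lemma SmoothOff.contDiffAt_fderiv {F : Eu d → ℂ} (hF : SmoothOff F) {x : Eu d} (hx : x ≠ 0) :
    ContDiffAt ℝ 1 (fderiv ℝ F) x :=
  (hF x hx).fderiv_right (by norm_num)

lemma SmoothOff.hasFDerivAt_fderiv {F : Eu d → ℂ} (hF : SmoothOff F) {x : Eu d} (hx : x ≠ 0) :
    HasFDerivAt (fderiv ℝ F) (fderiv ℝ (fderiv ℝ F) x) x :=
  ((hF.contDiffAt_fderiv hx).differentiableAt (by norm_num)).hasFDerivAt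

lemma SmoothOff.continuousAt_fderiv_fderiv {F : Eu d → ℂ} (hF : SmoothOff F) {x : Eu d}
    (hx : x ≠ 0) : ContinuousAt (fderiv ℝ (fderiv ℝ F)) x :=
  ((hF.contDiffAt_fderiv hx).fderiv_right (m := 0) (by norm_num)).continuousAt

lemma SmoothOff.continuous_restrict {F : Eu d → ℂ} (hF : SmoothOff F) :
    Continuous fun x : Sph d => F x :=
  continuous_iff_continuousAt.2 fun x =>
    ContinuousAt.comp (f := ((↑) : Sph d → Eu d)) (hF x x.coe_ne_zero).continuousAt
      continuous_subtype_val.continuousAt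

/-- Differentiation under the integral over a compact space. -/
lemma hasDerivAt_integral_of_continuous {X : Type*} [TopologicalSpace X] [CompactSpace X]
    [MeasurableSpace X] [OpensMeasurableSpace X] (ν : Measure X) [IsFiniteMeasure ν]
    {u u' : ℝ → X → ℂ} (hu : ∀ t, Continuous (u t))
    (hu' : Continuous fun p : ℝ × X => u' p.1 p.2)
    (hd : ∀ t x, HasDerivAt (fun t => u t x) (u' t x) t) (t₀ : ℝ) :
    HasDerivAt (fun t => ∫ x, u t x ∂ν) (∫ x, u' t₀ x ∂ν) t₀ := by
  obtain ⟨C, hC⟩ := ((isCompact_Icc (a := t₀ - 1) (b := t₀ + 1)).prod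
    (isCompact_univ (X := X))).exists_bound_of_continuousOn hu'.continuousOn
  have hint : Integrable (u t₀) ν := by
    obtain ⟨K, hK⟩ := (isCompact_univ (X := X)).exists_bound_of_continuousOn (hu t₀).continuousOn
    exact Integrable.of_bound (hu t₀).aestronglyMeasurable K
      (Eventually.of_forall fun x => hK x (Set.mem_univ x))
  refine (hasDerivAt_integral_of_dominated_loc_of_deriv_le (μ := ν) (F' := u')
    (bound := fun _ => C) (Metric.ball_mem_nhds t₀ one_pos)
    (Eventually.of_forall fun t => (hu t).aestronglyMeasurable) hint
    (hu'.comp (Continuous.prodMk_right t₀)).aestronglyMeasurable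
    (Eventually.of_forall fun x t ht => ?_) (integrable_const C)
    (Eventually.of_forall fun x t _ => hd t x)).2
  refine hC (t, x) ⟨?_, Set.mem_univ x⟩
  rw [Metric.mem_ball, Real.dist_eq] at ht
  have := abs_lt.1 ht
  constructor <;> linarith [this.1, this.2]

lemma planeRot_ne_zero {i j : Fin (d + 1)} (hij : i ≠ j) (t : ℝ) (x : Sph d) :
    planeRot i j t (x : Eu d) ≠ 0 := by
  rw [← norm_ne_zero_iff, norm_planeRot hij, x.norm_coe]
  exact one_ne_zero

lemma continuous_planeRot_uncurry (i j : Fin (d + 1)) :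
    Continuous fun p : ℝ × Sph d => planeRot i j p.1 (p.2 : Eu d) := by
  have h1 := (continuous_planeProj (d := d) i j).comp
    (continuous_subtype_val.comp continuous_snd : Continuous fun p : ℝ × Sph d => (p.2 : Eu d))
  have h2 := (continuous_planeTurn (d := d) i j).comp
    (continuous_subtype_val.comp continuous_snd : Continuous fun p : ℝ × Sph d => (p.2 : Eu d))
  exact ((continuous_subtype_val.comp continuous_snd).add
    (((Real.continuous_cos.comp continuous_fst).sub continuous_const).smul h1)).add
    ((Real.continuous_sin.comp continuous_fst).smul h2)

lemma continuous_planeVel_uncurry (i j : Fin (d + 1)) :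
    Continuous fun p : ℝ × Sph d => planeVel i j p.1 (p.2 : Eu d) := by
  have h1 := (continuous_planeProj (d := d) i j).comp
    (continuous_subtype_val.comp continuous_snd : Continuous fun p : ℝ × Sph d => (p.2 : Eu d))
  have h2 := (continuous_planeTurn (d := d) i j).comp
    (continuous_subtype_val.comp continuous_snd : Continuous fun p : ℝ × Sph d => (p.2 : Eu d))
  exact ((Real.continuous_sin.comp continuous_fst).neg.smul h1).add
    ((Real.continuous_cos.comp continuous_fst).smul h2)

lemma continuous_planeAcc_uncurry (i j : Fin (d + 1)) :
    Continuous fun p : ℝ × Sph d => planeAcc i j p.1 (p.2 : Eu d) := by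
  have h1 := (continuous_planeProj (d := d) i j).comp
    (continuous_subtype_val.comp continuous_snd : Continuous fun p : ℝ × Sph d => (p.2 : Eu d))
  have h2 := (continuous_planeTurn (d := d) i j).comp
    (continuous_subtype_val.comp continuous_snd : Continuous fun p : ℝ × Sph d => (p.2 : Eu d))
  exact ((Real.continuous_cos.comp continuous_fst).neg.smul h1).add
    ((Real.continuous_sin.comp continuous_fst).neg.smul h2)

lemma SmoothOff.hasDerivAt_fderiv_planeRot {F : Eu d → ℂ} (hF : SmoothOff F)
    {i j : Fin (d + 1)} (hij : i ≠ j) (t : ℝ) (x : Sph d) :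
    HasDerivAt (fun t => fderiv ℝ F (planeRot i j t (x : Eu d)) (planeVel i j t x))
      (fderiv ℝ (fderiv ℝ F) (planeRot i j t (x : Eu d)) (planeVel i j t x) (planeVel i j t x) +
        fderiv ℝ F (planeRot i j t (x : Eu d)) (planeAcc i j t x)) t := by
  have h1 : HasDerivAt (fun t => fderiv ℝ F (planeRot i j t (x : Eu d)))
      (fderiv ℝ (fderiv ℝ F) (planeRot i j t (x : Eu d)) (planeVel i j t x)) t :=
    HasFDerivAt.comp_hasDerivAt (f := fun t => planeRot i j t (x : Eu d)) t
      (hF.hasFDerivAt_fderiv (planeRot_ne_zero hij t x)) (hasDerivAt_planeRot i j t (x : Eu d))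
  exact HasDerivAt.clm_apply h1 (hasDerivAt_planeVel i j t (x : Eu d))

/-- First and second time derivatives of `∫ F (R_t x) g x`, where `R_t` is the rotation by the
angle `t` in a coordinate plane. -/
lemma exists_hasDerivAt_integral_planeRot {F : Eu d → ℂ} (hF : SmoothOff F) {g : Sph d → ℂ}
    (hg : Continuous g) {i j : Fin (d + 1)} (hij : i ≠ j) :
    ∃ D : ℝ → ℂ,
      (∀ t, HasDerivAt (fun t => ∫ x : Sph d, F (planeRot i j t x) * g x ∂(surf d)) (D t) t) ∧
      HasDerivAt D (∫ x : Sph d, rotSecondDeriv i j F x * g x ∂(surf d)) 0 := by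
  have hR := continuous_planeRot_uncurry (d := d) i j
  have hV := continuous_planeVel_uncurry (d := d) i j
  have hA := continuous_planeAcc_uncurry (d := d) i j
  have hg' : Continuous fun p : ℝ × Sph d => g p.2 := hg.comp continuous_snd
  have hF0 : Continuous fun p : ℝ × Sph d => F (planeRot i j p.1 (p.2 : Eu d)) :=
    continuous_iff_continuousAt.2 fun p => ContinuousAt.comp
      (f := fun p : ℝ × Sph d => planeRot i j p.1 (p.2 : Eu d))
      (hF _ (planeRot_ne_zero hij p.1 p.2)).continuousAt hR.continuousAt
  have hF1 : Continuous fun p : ℝ × Sph d => fderiv ℝ F (planeRot i j p.1 (p.2 : Eu d)) :=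
    continuous_iff_continuousAt.2 fun p => ContinuousAt.comp
      (f := fun p : ℝ × Sph d => planeRot i j p.1 (p.2 : Eu d))
      (hF.contDiffAt_fderiv (planeRot_ne_zero hij p.1 p.2)).continuousAt hR.continuousAt
  have hF2 : Continuous fun p : ℝ × Sph d =>
      fderiv ℝ (fderiv ℝ F) (planeRot i j p.1 (p.2 : Eu d)) :=
    continuous_iff_continuousAt.2 fun p => ContinuousAt.comp
      (f := fun p : ℝ × Sph d => planeRot i j p.1 (p.2 : Eu d))
      (hF.continuousAt_fderiv_fderiv (planeRot_ne_zero hij p.1 p.2)) hR.continuousAt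
  have hc1 : Continuous fun p : ℝ × Sph d =>
      fderiv ℝ F (planeRot i j p.1 (p.2 : Eu d)) (planeVel i j p.1 p.2) * g p.2 :=
    (hF1.clm_apply hV).mul hg'
  have hc2 : Continuous fun p : ℝ × Sph d =>
      (fderiv ℝ (fderiv ℝ F) (planeRot i j p.1 (p.2 : Eu d)) (planeVel i j p.1 p.2)
        (planeVel i j p.1 p.2) +
      fderiv ℝ F (planeRot i j p.1 (p.2 : Eu d)) (planeAcc i j p.1 p.2)) * g p.2 :=
    (((hF2.clm_apply hV).clm_apply hV).add (hF1.clm_apply hA)).mul hg'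
  refine ⟨fun t => ∫ x : Sph d,
    fderiv ℝ F (planeRot i j t (x : Eu d)) (planeVel i j t x) * g x ∂(surf d), fun t => ?_, ?_⟩
  · refine hasDerivAt_integral_of_continuous (surf d)
      (u := fun t (x : Sph d) => F (planeRot i j t x) * g x)
      (u' := fun t (x : Sph d) => fderiv ℝ F (planeRot i j t (x : Eu d)) (planeVel i j t x) * g x)
      (fun t => ((hF0.mul hg').comp (Continuous.prodMk_right t))) hc1 (fun t x => ?_) t
    exact ((hF.hasFDerivAt (planeRot_ne_zero hij t x)).comp_hasDerivAt t
      (hasDerivAt_planeRot i j t (x : Eu d))).mul_const _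
  · have hc1' : ∀ t, Continuous fun x : Sph d =>
        fderiv ℝ F (planeRot i j t (x : Eu d)) (planeVel i j t x) * g x := fun t =>
      Continuous.comp (f := fun x : Sph d => ((t, x) : ℝ × Sph d)) hc1
        (Continuous.prodMk_right t)
    have h := hasDerivAt_integral_of_continuous (surf d)
      (u := fun t (x : Sph d) => fderiv ℝ F (planeRot i j t (x : Eu d)) (planeVel i j t x) * g x)
      (u' := fun t (x : Sph d) =>
        (fderiv ℝ (fderiv ℝ F) (planeRot i j t (x : Eu d)) (planeVel i j t x) (planeVel i j t x) +
          fderiv ℝ F (planeRot i j t (x : Eu d)) (planeAcc i j t x)) * g x)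
      hc1' hc2 (fun t x => (hF.hasDerivAt_fderiv_planeRot hij t x).mul_const (g x)) 0
    have e : ∀ x : Sph d, rotSecondDeriv i j F x * g x =
          (fderiv ℝ (fderiv ℝ F) (planeRot i j 0 (x : Eu d)) (planeVel i j 0 x)
            (planeVel i j 0 x) +
          fderiv ℝ F (planeRot i j 0 (x : Eu d)) (planeAcc i j 0 x)) * g x := fun x => by
      have hv : planeVel i j 0 (x : Eu d) = planeTurn i j x := by simp [planeVel]
      have ha : planeAcc i j 0 (x : Eu d) = -planeProj i j x := by simp [planeAcc]
      rw [planeRot_zero, hv, ha, map_neg, ← sub_eq_add_neg, rotSecondDeriv]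
    simp_rw [e]
    exact h

/-- The second derivative along the rotations in a coordinate plane is symmetric for the
inner product of the sphere: as the measure is invariant, `∫ F (R_t x) G x = ∫ F x G (R_{-t} x)`,
and the second derivative at zero does not see the sign of `t`. -/
lemma integral_rotSecondDeriv_mul {F G : Eu d → ℂ} (hF : SmoothOff F) (hG : SmoothOff G)
    {i j : Fin (d + 1)} (hij : i ≠ j) :
    ∫ x : Sph d, rotSecondDeriv i j F x * G x ∂(surf d) =
      ∫ x : Sph d, F x * rotSecondDeriv i j G x ∂(surf d) := by
  obtain ⟨D, hD, hD0⟩ := exists_hasDerivAt_integral_planeRot hF hG.continuous_restrict hij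
  obtain ⟨D', hD', hD0'⟩ := exists_hasDerivAt_integral_planeRot hG hF.continuous_restrict hij
  have hswap : ∀ t, ∫ x : Sph d, F (planeRot i j t x) * G x ∂(surf d) =
      ∫ x : Sph d, G (planeRot i j (-t) x) * F x ∂(surf d) := fun t => by
    have hc : Continuous fun x : Sph d => G (planeRot i j (-t) x) * F x :=
      (hG.continuous_restrict.comp (continuous_isoSph (planeIso hij (-t)))).mul
        hF.continuous_restrict
    rw [← integral_comp_isoSph (planeIso hij t) hc]
    refine integral_congr_ae (Eventually.of_forall fun x => ?_)
    change F (planeRot i j t x) * G x =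
      G (planeRot i j (-t) (planeRot i j t x)) * F (planeRot i j t x)
    rw [planeRot_neg_planeRot hij, mul_comm]
  have hDD : ∀ t, D t = -D' (-t) := fun t => by
    have h1 := hD t
    simp_rw [hswap] at h1
    have h2 := (hD' (-t)).scomp t (hasDerivAt_neg t)
    have h3 := h1.unique h2
    rw [h3]
    simp
  have h4 : HasDerivAt D (∫ x : Sph d, rotSecondDeriv i j G x * F x ∂(surf d)) 0 := by
    rw [funext hDD]
    have h0 : HasDerivAt D' (∫ x : Sph d, rotSecondDeriv i j G x * F x ∂(surf d)) (-0) := by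
      rwa [neg_zero]
    have h2 := (h0.scomp (0 : ℝ) (hasDerivAt_neg (0 : ℝ))).neg
    rw [neg_one_smul, neg_neg] at h2
    exact h2
  rw [hD0.unique h4]
  simp_rw [mul_comm]

end PlaneRotation

/-! ### Green's formula on the sphere for homogeneous functions -/

section Green

variable {d : ℕ}

open Laplacian in
lemma laplacian_eq_sum_fderiv {W : Type*} [NormedAddCommGroup W] [NormedSpace ℝ W]
    (F : Eu d → W) (x : Eu d) :
    Δ F x = ∑ i, fderiv ℝ (fderiv ℝ F) x (EuclideanSpace.single i 1)
      (EuclideanSpace.single i 1) := by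
  rw [InnerProductSpace.laplacian_eq_iteratedFDeriv_orthonormalBasis F
    (EuclideanSpace.basisFun (Fin (d + 1)) ℝ)]
  refine Finset.sum_congr rfl fun i _ => ?_
  rw [iteratedFDeriv_two_apply]
  simp

lemma eq_sum_single (x : Eu d) : x = ∑ i, x i • EuclideanSpace.single i (1 : ℝ) := by
  conv_lhs => rw [← (EuclideanSpace.basisFun (Fin (d + 1)) ℝ).sum_repr x]
  simp

lemma clm_apply_eq_sum (L : Eu d →L[ℝ] ℂ) (y : Eu d) :
    L y = ∑ i, y i * L (EuclideanSpace.single i 1) := by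
  conv_lhs => rw [eq_sum_single y]
  simp only [map_sum, map_smul, Complex.real_smul]

lemma sum_sq_eq_norm_sq (x : Eu d) : ∑ i, (x i : ℂ) * x i = ((‖x‖ ^ 2 : ℝ) : ℂ) := by
  rw [EuclideanSpace.norm_sq_eq]
  push_cast
  refine Finset.sum_congr rfl fun i _ => ?_
  rw [← sq, ← Complex.ofReal_pow, ← Complex.ofReal_pow, Real.norm_eq_abs, sq_abs]

open Laplacian in
/-- The sum over all coordinate planes of the second derivatives along rotations is the
Laplacian corrected by radial derivatives. -/
lemma sum_rotSecondDeriv (F : Eu d → ℂ) (x : Eu d) :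
    ∑ i, ∑ j, (if i = j then 0 else rotSecondDeriv i j F x) =
      2 * (((‖x‖ ^ 2 : ℝ) : ℂ) * Δ F x - fderiv ℝ (fderiv ℝ F) x x x - d * fderiv ℝ F x x) := by
  set A : Fin (d + 1) → Fin (d + 1) → ℂ := fun i j =>
    fderiv ℝ (fderiv ℝ F) x (EuclideanSpace.single i 1) (EuclideanSpace.single j 1) with hA
  set D : Fin (d + 1) → ℂ := fun i => fderiv ℝ F x (EuclideanSpace.single i 1) with hD
  have hrot : ∀ i j, (if i = j then 0 else rotSecondDeriv i j F x) =
      (x i * x i) * A j j + (x j * x j) * A i i - (x i * A i j) * x j - (x j * A j i) * x i -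
        x i * D i - x j * D j + (if i = j then 2 * (x i * D i) else 0) := by
    intro i j
    split_ifs with h
    · subst h
      ring
    · simp only [rotSecondDeriv, planeTurn, planeProj, map_sub, map_add, map_smul,
        sub_apply, smul_apply, Complex.real_smul, hA, hD]
      ring
  have hDx : fderiv ℝ F x x = ∑ i, x i * D i := clm_apply_eq_sum _ _
  have hAx : fderiv ℝ (fderiv ℝ F) x x x = ∑ i, ∑ j, (x i * A i j) * x j := by
    rw [clm_apply_eq_sum, Finset.sum_comm]
    refine Finset.sum_congr rfl fun j _ => ?_
    have h := clm_apply_eq_sum ((ContinuousLinearMap.apply ℝ ℂ (EuclideanSpace.single j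
      (1 : ℝ))).comp (fderiv ℝ (fderiv ℝ F) x)) x
    simp only [ContinuousLinearMap.comp_apply, ContinuousLinearMap.apply_apply] at h
    rw [h, mul_comm, Finset.sum_mul]
  have hcomm : ∑ i, ∑ j, (x j * A j i) * x i = ∑ i, ∑ j, ((x i : ℂ) * A i j) * x j :=
    Finset.sum_comm
  simp_rw [hrot]
  simp only [Finset.sum_add_distrib, Finset.sum_sub_distrib, Finset.sum_ite_eq, Finset.mem_univ,
    if_true, Finset.sum_const, Finset.card_univ, Fintype.card_fin, nsmul_eq_mul,
    ← Finset.mul_sum, ← Finset.sum_mul]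
  rw [hDx, hAx, laplacian_eq_sum_fderiv, ← sum_sq_eq_norm_sq]
  simp only [← Finset.sum_mul] at hcomm ⊢
  rw [hcomm]
  push_cast
  ring

/-- Positive homogeneity of degree `l`. -/
def HomogeneousDeg (l : ℕ) (F : Eu d → ℂ) : Prop :=
  ∀ t : ℝ, 0 < t → ∀ x, F (t • x) = (t : ℂ) ^ l * F x

/-- Euler's identities for the first two radial derivatives. -/
lemma HomogeneousDeg.euler {l : ℕ} {F : Eu d → ℂ} (hF : SmoothOff F) (hl : HomogeneousDeg l F)
    {x : Eu d} (hx : x ≠ 0) :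
    fderiv ℝ F x x = l * F x ∧ fderiv ℝ (fderiv ℝ F) x x x = l * (l - 1) * F x := by
  have hray : ∀ t : ℝ, HasDerivAt (fun t : ℝ => t • x) x t := fun t => by
    simpa using (hasDerivAt_id t).smul_const x
  have hne : ∀ t : ℝ, 0 < t → t • x ≠ 0 := fun t ht => smul_ne_zero ht.ne' hx
  have hpow : ∀ (m : ℕ) (t : ℝ), HasDerivAt (fun t : ℝ => (t : ℂ) ^ m)
      (m * (t : ℂ) ^ (m - 1)) t := fun m t => by
    simpa using (hasDerivAt_pow m (t : ℂ)).comp_ofReal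
  have h1 : ∀ t : ℝ, 0 < t → fderiv ℝ F (t • x) x = l * (t : ℂ) ^ (l - 1) * F x := by
    intro t ht
    have ha : HasDerivAt (fun t : ℝ => F (t • x)) (fderiv ℝ F (t • x) x) t :=
      HasFDerivAt.comp_hasDerivAt (f := fun t : ℝ => t • x) t (hF.hasFDerivAt (hne t ht)) (hray t)
    have hb : HasDerivAt (fun t : ℝ => F (t • x)) (l * (t : ℂ) ^ (l - 1) * F x) t := by
      refine ((hpow l t).mul_const (F x)).congr_of_eventuallyEq ?_
      filter_upwards [lt_mem_nhds ht] with s hs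
      exact hl s hs x
    exact ha.unique hb
  constructor
  · simpa using h1 1 one_pos
  · have ha : HasDerivAt (fun t : ℝ => fderiv ℝ F (t • x) x)
        (fderiv ℝ (fderiv ℝ F) ((1 : ℝ) • x) x x) 1 := by
      have h0 : HasDerivAt (fun t : ℝ => fderiv ℝ F (t • x))
          (fderiv ℝ (fderiv ℝ F) ((1 : ℝ) • x) x) 1 :=
        HasFDerivAt.comp_hasDerivAt (f := fun t : ℝ => t • x) 1
          (hF.hasFDerivAt_fderiv (hne 1 one_pos)) (hray 1)
      have := HasDerivAt.clm_apply h0 (hasDerivAt_const (1 : ℝ) x)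
      simpa using this
    have hb : HasDerivAt (fun t : ℝ => fderiv ℝ F (t • x) x)
        (l * ((l - 1 : ℕ) * ((1 : ℝ) : ℂ) ^ (l - 1 - 1)) * F x) 1 := by
      refine (((hpow (l - 1) 1).const_mul (l : ℂ)).mul_const (F x)).congr_of_eventuallyEq ?_
      filter_upwards [lt_mem_nhds one_pos] with s hs
      exact h1 s hs
    have h := ha.unique hb
    rw [one_smul] at h
    rw [h]
    rcases Nat.eq_zero_or_pos l with rfl | hl0
    · simp
    · rw [Nat.cast_sub hl0]
      simp

open Laplacian in
/-- The spherical part of the Laplacian of a homogeneous function. The factor `2` appears because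
every coordinate plane is counted twice. -/
lemma sum_rotSecondDeriv_of_homogeneousDeg {l : ℕ} {F : Eu d → ℂ} (hF : SmoothOff F)
    (hl : HomogeneousDeg l F) (x : Sph d) :
    ∑ i, ∑ j, (if i = j then 0 else rotSecondDeriv i j F x) =
      2 * (Δ F (x : Eu d) - l * (l + d - 1) * F x) := by
  obtain ⟨h1, h2⟩ := hl.euler hF x.coe_ne_zero
  rw [sum_rotSecondDeriv, h1, h2, x.norm_coe]
  push_cast
  ring

lemma SmoothOff.continuous_rotSecondDeriv {F : Eu d → ℂ} (hF : SmoothOff F) (i j : Fin (d + 1)) :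
    Continuous fun x : Sph d => rotSecondDeriv i j F x := by
  have h1 : Continuous fun x : Sph d => fderiv ℝ F (x : Eu d) :=
    continuous_iff_continuousAt.2 fun x => ContinuousAt.comp (f := ((↑) : Sph d → Eu d))
      (hF.contDiffAt_fderiv x.coe_ne_zero).continuousAt continuous_subtype_val.continuousAt
  have h2 : Continuous fun x : Sph d => fderiv ℝ (fderiv ℝ F) (x : Eu d) :=
    continuous_iff_continuousAt.2 fun x => ContinuousAt.comp (f := ((↑) : Sph d → Eu d))
      (hF.continuousAt_fderiv_fderiv x.coe_ne_zero) continuous_subtype_val.continuousAt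
  have hT := (continuous_planeTurn (d := d) i j).comp
    (continuous_subtype_val : Continuous ((↑) : Sph d → Eu d))
  have hP := (continuous_planeProj (d := d) i j).comp
    (continuous_subtype_val : Continuous ((↑) : Sph d → Eu d))
  exact ((h2.clm_apply hT).clm_apply hT).sub (h1.clm_apply hP)

lemma integrable_surf_of_continuous {f : Sph d → ℂ} (hf : Continuous f) :
    Integrable f (surf d) := by
  obtain ⟨K, hK⟩ := (isCompact_univ (X := Sph d)).exists_bound_of_continuousOn hf.continuousOn
  exact Integrable.of_bound hf.aestronglyMeasurable K
    (Eventually.of_forall fun x => hK x (Set.mem_univ x))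

open Laplacian in
/-- Green's formula: on functions that are homogeneous of some degree, the spherical part of
the Laplacian is symmetric for the inner product of the sphere. -/
theorem integral_laplacian_sub_mul {l m : ℕ} {F G : Eu d → ℂ} (hF : SmoothOff F)
    (hG : SmoothOff G) (hl : HomogeneousDeg l F) (hm : HomogeneousDeg m G) :
    ∫ x : Sph d, (Δ F (x : Eu d) - l * (l + d - 1) * F x) * G x ∂(surf d) =
      ∫ x : Sph d, F x * (Δ G (x : Eu d) - m * (m + d - 1) * G x) ∂(surf d) := by
  have hc1 : ∀ i j, Continuous fun x : Sph d =>
      (if i = j then 0 else rotSecondDeriv i j F x) * G x := fun i j => by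
    refine Continuous.mul ?_ hG.continuous_restrict
    split_ifs
    exacts [continuous_const, hF.continuous_rotSecondDeriv i j]
  have hc2 : ∀ i j, Continuous fun x : Sph d =>
      F x * (if i = j then 0 else rotSecondDeriv i j G x) := fun i j => by
    refine Continuous.mul hF.continuous_restrict ?_
    split_ifs
    exacts [continuous_const, hG.continuous_rotSecondDeriv i j]
  have h1 : ∫ x : Sph d, (∑ i, ∑ j, (if i = j then 0 else rotSecondDeriv i j F x)) * G x
      ∂(surf d) = ∫ x : Sph d, F x * ∑ i, ∑ j, (if i = j then 0 else rotSecondDeriv i j G x)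
      ∂(surf d) := by
    simp_rw [Finset.sum_mul, Finset.mul_sum]
    rw [integral_finsetSum _ fun i _ => integrable_surf_of_continuous
        (continuous_finsetSum _ fun j _ => hc1 i j),
      integral_finsetSum _ fun i _ => integrable_surf_of_continuous
        (continuous_finsetSum _ fun j _ => hc2 i j)]
    refine Finset.sum_congr rfl fun i _ => ?_
    rw [integral_finsetSum _ fun j _ => integrable_surf_of_continuous (hc1 i j),
      integral_finsetSum _ fun j _ => integrable_surf_of_continuous (hc2 i j)]
    refine Finset.sum_congr rfl fun j _ => ?_
    split_ifs with h
    · simp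
    · exact integral_rotSecondDeriv_mul hF hG h
  simp_rw [sum_rotSecondDeriv_of_homogeneousDeg hF hl,
    sum_rotSecondDeriv_of_homogeneousDeg hG hm, mul_left_comm _ (2 : ℂ), mul_assoc (2 : ℂ)] at h1
  rw [integral_const_mul, integral_const_mul] at h1
  exact mul_left_cancel₀ two_ne_zero h1

end Green

/-! ### Polynomials as functions on Euclidean space -/

section Polynomials

open MvPolynomial Laplacian

variable {d : ℕ}

/-- The complex function on Euclidean space defined by a complex polynomial. -/
def polyFun (p : MvPolynomial (Fin (d + 1)) ℂ) (y : Eu d) : ℂ :=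
  aeval (fun i => ((y i : ℝ) : ℂ)) p

lemma restrictSph_apply (p : MvPolynomial (Fin (d + 1)) ℂ) (x : Sph d) :
    restrictSph d p x = polyFun p (x : Eu d) := rfl

lemma polyFun_eq_eval (p : MvPolynomial (Fin (d + 1)) ℂ) (y : Eu d) :
    polyFun p y = eval (fun i => ((y i : ℝ) : ℂ)) p := by
  rw [polyFun, aeval_eq_eval]

lemma hasFDerivAt_coord (i : Fin (d + 1)) (y : Eu d) :
    HasFDerivAt (fun y : Eu d => ((y i : ℝ) : ℂ))
      (Complex.ofRealCLM.comp (EuclideanSpace.proj i : Eu d →L[ℝ] ℝ)) y :=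
  (Complex.ofRealCLM.comp (EuclideanSpace.proj i : Eu d →L[ℝ] ℝ)).hasFDerivAt

lemma contDiff_polyFun (p : MvPolynomial (Fin (d + 1)) ℂ) {n : WithTop ℕ∞} :
    ContDiff ℝ n (polyFun p) := by
  unfold polyFun
  induction p using MvPolynomial.induction_on with
  | C a => simpa using contDiff_const
  | add p q hp hq => simpa using hp.add hq
  | mul_X p i hp =>
    simpa using hp.mul (Complex.ofRealCLM.comp (EuclideanSpace.proj i : Eu d →L[ℝ] ℝ)).contDiff

lemma fderiv_polyFun (p : MvPolynomial (Fin (d + 1)) ℂ) (y v : Eu d) :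
    fderiv ℝ (polyFun p) y v = ∑ i, (v i : ℂ) * polyFun (pderiv i p) y := by
  have hd : ∀ p : MvPolynomial (Fin (d + 1)) ℂ, DifferentiableAt ℝ (polyFun p) y :=
    fun p => (contDiff_polyFun p (n := 1)).contDiffAt.differentiableAt one_ne_zero
  induction p using MvPolynomial.induction_on with
  | C a =>
    have : polyFun (C a : MvPolynomial (Fin (d + 1)) ℂ) = fun _ => a := by
      ext y
      simp [polyFun]
    rw [this]
    simp [polyFun]
  | add p q hp hq =>
    have : polyFun (p + q) = polyFun p + polyFun q := by
      ext y
      simp [polyFun]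
    rw [this, fderiv_add (hd p) (hd q), add_apply, hp, hq, ← Finset.sum_add_distrib]
    refine Finset.sum_congr rfl fun i _ => ?_
    simp [polyFun, mul_add]
  | mul_X p i hp =>
    have : polyFun (p * X i) = fun y => polyFun p y * ((y i : ℝ) : ℂ) := by
      ext y
      simp [polyFun]
    have h := ((hd p).hasFDerivAt.mul (hasFDerivAt_coord i y)).fderiv
    rw [this]
    refine (DFunLike.congr_fun h v).trans ?_
    simp only [add_apply, smul_apply, ContinuousLinearMap.comp_apply, smul_eq_mul, hp,
      Complex.ofRealCLM_apply]
    have hs : ∀ k, polyFun (pderiv k (p * X i)) y =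
        polyFun (pderiv k p) y * y i + if k = i then polyFun p y else 0 := fun k => by
      rw [Derivation.leibniz, pderiv_X, polyFun]
      by_cases hk : k = i
      · subst hk
        simp [polyFun, mul_comm, add_comm]
      · simp [polyFun, hk, mul_comm, Ne.symm hk]
    simp_rw [hs, mul_add, mul_ite, mul_zero]
    rw [Finset.sum_add_distrib, Finset.sum_ite_eq' Finset.univ i, if_pos (Finset.mem_univ i),
      add_comm, Finset.mul_sum]
    congr 1
    · exact Finset.sum_congr rfl fun k _ => by ring
    · exact mul_comm _ _

lemma laplacian_polyFun (p : MvPolynomial (Fin (d + 1)) ℂ) :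
    Δ (polyFun p) = polyFun (polyLaplacian d p) := by
  have hpart : ∀ (p : MvPolynomial (Fin (d + 1)) ℂ) (i : Fin (d + 1)) (y : Eu d),
      fderiv ℝ (polyFun p) y (EuclideanSpace.single i 1) = polyFun (pderiv i p) y :=
    fun p i y => by
      rw [fderiv_polyFun, Finset.sum_eq_single i (fun k _ hk => by simp [hk])
        (fun h => absurd (Finset.mem_univ i) h)]
      simp
  ext y
  rw [laplacian_eq_sum_fderiv]
  have hL : polyFun (polyLaplacian d p) y = ∑ i, polyFun (pderiv i (pderiv i p)) y := by
    simp [polyLaplacian, polyFun, LinearMap.sum_apply, map_sum]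
  rw [hL]
  refine Finset.sum_congr rfl fun i _ => ?_
  have hdd : DifferentiableAt ℝ (fderiv ℝ (polyFun p)) y :=
    ((contDiff_polyFun p (n := 2)).contDiffAt.fderiv_right (m := 1)
      (by norm_num)).differentiableAt one_ne_zero
  have h1 := (hdd.hasFDerivAt.clm_apply
    (hasFDerivAt_const (EuclideanSpace.single i (1 : ℝ)) y)).fderiv
  have h2 : (fun z => fderiv ℝ (polyFun p) z (EuclideanSpace.single i 1)) =
      polyFun (pderiv i p) := funext fun z => hpart p i z
  rw [h2] at h1
  rw [← hpart (pderiv i p) i y, h1]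
  simp

lemma polyFun_injective : Function.Injective (polyFun (d := d)) := by
  intro p q h
  refine MvPolynomial.funext_set (fun _ => Set.range ((↑) : ℝ → ℂ))
    (fun _ => Set.infinite_range_of_injective Complex.ofReal_injective) fun x hx => ?_
  choose r hr using fun i => hx i (Set.mem_univ i)
  have := congrFun h (WithLp.toLp 2 r)
  rw [polyFun_eq_eval, polyFun_eq_eval] at this
  simp only [hr] at this
  exact this

lemma homogeneousDeg_polyFun {l : ℕ} {p : MvPolynomial (Fin (d + 1)) ℂ}
    (hp : p.IsHomogeneous l) : HomogeneousDeg l (polyFun p) := by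
  intro t _ y
  rw [polyFun_eq_eval, polyFun_eq_eval, eval_eq, eval_eq, Finset.mul_sum]
  refine Finset.sum_congr rfl fun m hm => ?_
  rw [hp.degree_eq_sum_deg_support hm, ← Finset.prod_pow_eq_pow_sum]
  rw [mul_left_comm, ← Finset.prod_mul_distrib]
  refine congrArg _ (Finset.prod_congr rfl fun i _ => ?_)
  simp [mul_pow]

lemma smoothOff_polyFun (p : MvPolynomial (Fin (d + 1)) ℂ) : SmoothOff (polyFun p) :=
  fun _ _ => (contDiff_polyFun p).contDiffAt

/-- Substitution of a linear isometry in a polynomial. -/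
def substIso (L : Eu d ≃ₗᵢ[ℝ] Eu d) (p : MvPolynomial (Fin (d + 1)) ℂ) :
    MvPolynomial (Fin (d + 1)) ℂ :=
  aeval (fun i => ∑ k, C (((L (EuclideanSpace.single k 1)) i : ℝ) : ℂ) * X k) p

lemma polyFun_substIso (L : Eu d ≃ₗᵢ[ℝ] Eu d) (p : MvPolynomial (Fin (d + 1)) ℂ) :
    polyFun (substIso L p) = polyFun p ∘ L := by
  ext y
  have hL : ∀ i, L y i = ∑ k, L (EuclideanSpace.single k 1) i * y k := fun i => by
    conv_lhs => rw [eq_sum_single y]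
    simp [map_sum, mul_comm]
  rw [Function.comp_apply, polyFun, polyFun, substIso, ← AlgHom.comp_apply, comp_aeval]
  congr 2
  funext i
  rw [hL]
  simp

lemma isHomogeneous_substIso (L : Eu d ≃ₗᵢ[ℝ] Eu d) {l : ℕ}
    {p : MvPolynomial (Fin (d + 1)) ℂ} (hp : p.IsHomogeneous l) :
    (substIso L p).IsHomogeneous l := by
  have h := hp.aeval (fun i => ∑ k, C (((L (EuclideanSpace.single k 1)) i : ℝ) : ℂ) * X k)
    (n := 1) fun i => IsHomogeneous.sum _ _ _ fun k _ => isHomogeneous_C_mul_X _ _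
  rwa [one_mul] at h

lemma laplacian_comp_isometry {F : Eu d → ℂ} (hF : ContDiff ℝ 2 F) (L : Eu d ≃ₗᵢ[ℝ] Eu d) :
    Δ (F ∘ L) = Δ F ∘ L := by
  ext y
  set b := EuclideanSpace.basisFun (Fin (d + 1)) ℝ
  rw [InnerProductSpace.laplacian_eq_iteratedFDeriv_orthonormalBasis (F ∘ L) b,
    InnerProductSpace.laplacian_eq_iteratedFDeriv_orthonormalBasis F (b.map L)]
  refine Finset.sum_congr rfl fun i _ => ?_
  have h := ContinuousLinearMap.iteratedFDeriv_comp_right (n := 2)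
    (L.toContinuousLinearEquiv : Eu d →L[ℝ] Eu d) hF y (i := 2) le_rfl
  change iteratedFDeriv ℝ 2 (F ∘ L) y = _ at h
  rw [h, ContinuousMultilinearMap.compContinuousLinearMap_apply]
  congr 1
  ext k
  fin_cases k <;> simp

/-- Spherical harmonics of a given order are preserved by linear isometries. -/
lemma comp_isoSph_mem_sphHarm (L : Eu d ≃ₗᵢ[ℝ] Eu d) {l : ℕ} {f : Sph d → ℂ}
    (hf : f ∈ sphHarm d l) : f ∘ isoSph L ∈ sphHarm d l := by
  obtain ⟨p, ⟨hp, hharm⟩, rfl⟩ := hf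
  refine ⟨substIso L p, ⟨isHomogeneous_substIso L hp, ?_⟩, ?_⟩
  · rw [SetLike.mem_coe, LinearMap.mem_ker] at hharm ⊢
    refine polyFun_injective ?_
    rw [← laplacian_polyFun, polyFun_substIso, laplacian_comp_isometry (contDiff_polyFun p),
      laplacian_polyFun, hharm]
    ext y
    simp [polyFun]
  · ext x
    rw [restrictSph_apply, polyFun_substIso]
    rfl

lemma exists_harmonic_extension {l : ℕ} {f : Sph d → ℂ} (hf : f ∈ sphHarm d l) :
    ∃ F : Eu d → ℂ, SmoothOff F ∧ HomogeneousDeg l F ∧ (∀ x, Δ F x = 0) ∧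
      ∀ x : Sph d, F x = f x := by
  obtain ⟨p, ⟨hp, hharm⟩, rfl⟩ := hf
  refine ⟨polyFun p, smoothOff_polyFun p, homogeneousDeg_polyFun hp, fun x => ?_, fun x => rfl⟩
  rw [SetLike.mem_coe, LinearMap.mem_ker] at hharm
  rw [laplacian_polyFun, hharm]
  simp [polyFun]

lemma exists_harmonic_extension_conj {l : ℕ} {f : Sph d → ℂ} (hf : f ∈ sphHarm d l) :
    ∃ F : Eu d → ℂ, SmoothOff F ∧ HomogeneousDeg l F ∧ (∀ x, Δ F x = 0) ∧
      ∀ x : Sph d, F x = starRingEnd ℂ (f x) := by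
  obtain ⟨F, h1, h2, h3, h4⟩ := exists_harmonic_extension hf
  refine ⟨Complex.conjCLE ∘ F, fun x hx => ?_, fun t ht x => ?_, fun x => ?_, fun x => ?_⟩
  · exact Complex.conjCLE.contDiff.contDiffAt.comp x (h1 x hx)
  · simp [h2 t ht x]
  · rw [InnerProductSpace.laplacian_CLE_comp_left, Function.comp_apply, h3 x, map_zero]
  · simp [h4 x]

lemma continuous_of_mem_sphHarm {l : ℕ} {f : Sph d → ℂ} (hf : f ∈ sphHarm d l) :
    Continuous f := by
  obtain ⟨F, h1, -, -, h4⟩ := exists_harmonic_extension hf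
  rw [← funext h4]
  exact h1.continuous_restrict

/-- Spherical harmonics of different orders are orthogonal, as eigenfunctions of a symmetric
operator with different eigenvalues `-l * (l + d - 1)`. -/
lemma integral_mul_conj_eq_zero_of_ne (hd : 1 ≤ d) {l m : ℕ} (hlm : l ≠ m) {f g : Sph d → ℂ}
    (hf : f ∈ sphHarm d l) (hg : g ∈ sphHarm d m) :
    ∫ x, f x * starRingEnd ℂ (g x) ∂(surf d) = 0 := by
  obtain ⟨F, hF1, hF2, hF3, hF4⟩ := exists_harmonic_extension hf
  obtain ⟨G, hG1, hG2, hG3, hG4⟩ := exists_harmonic_extension_conj hg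
  have h := integral_laplacian_sub_mul hF1 hG1 hF2 hG2
  simp_rw [hF3, hG3, hF4, hG4, zero_sub] at h
  have e1 : ∀ x, -((l : ℂ) * (l + d - 1) * f x) * starRingEnd ℂ (g x) =
      -((l : ℂ) * (l + d - 1)) * (f x * starRingEnd ℂ (g x)) := fun x => by ring
  have e2 : ∀ x, f x * -((m : ℂ) * (m + d - 1) * starRingEnd ℂ (g x)) =
      -((m : ℂ) * (m + d - 1)) * (f x * starRingEnd ℂ (g x)) := fun x => by ring
  simp_rw [e1, e2] at h
  rw [integral_const_mul, integral_const_mul] at h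
  have hne : (l : ℂ) * (l + d - 1) - m * (m + d - 1) ≠ 0 := by
    have : (l : ℂ) * (l + d - 1) - m * (m + d - 1) = ((l : ℂ) - m) * (l + m + d - 1) := by ring
    rw [this]
    refine mul_ne_zero (sub_ne_zero.2 (Nat.cast_injective.ne hlm)) ?_
    have hcast : (l : ℂ) + m + d - 1 = ((l + m + d - 1 : ℕ) : ℂ) := by
      rw [Nat.cast_sub (by omega)]
      push_cast
      ring
    rw [hcast, Nat.cast_ne_zero]
    omega
  refine (mul_eq_zero.1 ?_).resolve_left hne
  linear_combination -h

end Polynomials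

/-! ### Completeness of the spherical harmonics -/

section Completeness

open MvPolynomial Laplacian

variable {d : ℕ}

lemma integrable_mul_conj {f g : Sph d → ℂ} (hf : Continuous f) (hg : Continuous g) :
    Integrable (fun x => f x * starRingEnd ℂ (g x)) (surf d) :=
  integrable_surf_of_continuous (hf.mul (Complex.continuous_conj.comp hg))

/-- The continuous functions on the sphere that are orthogonal to `g`. -/
def orthSub (g : Sph d → ℂ) (hg : Continuous g) : Submodule ℂ (Sph d → ℂ) where
  carrier := {f | Continuous f ∧ ∫ x, f x * starRingEnd ℂ (g x) ∂(surf d) = 0}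
  add_mem' := by
    rintro f₁ f₂ ⟨hc₁, h₁⟩ ⟨hc₂, h₂⟩
    refine ⟨hc₁.add hc₂, ?_⟩
    simp only [Pi.add_apply, add_mul]
    rw [integral_add (integrable_mul_conj hc₁ hg) (integrable_mul_conj hc₂ hg), h₁, h₂, add_zero]
  zero_mem' := ⟨continuous_const, by simp⟩
  smul_mem' := by
    rintro c f ⟨hc, h⟩
    refine ⟨hc.const_smul c, ?_⟩
    simp only [Pi.smul_apply, smul_eq_mul, mul_assoc]
    rw [integral_const_mul, h, mul_zero]

lemma eq_zero_of_integral_mul_conj_self {f : Sph d → ℂ} (hf : Continuous f)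
    (h : ∫ x, f x * starRingEnd ℂ (f x) ∂(surf d) = 0) : f = 0 := by
  simp_rw [Complex.mul_conj] at h
  rw [integral_complex_ofReal, Complex.ofReal_eq_zero] at h
  have hc : Continuous fun x => Complex.normSq (f x) := Complex.continuous_normSq.comp hf
  have hint : Integrable (fun x => Complex.normSq (f x)) (surf d) := by
    have := integrable_surf_of_continuous (Complex.continuous_ofReal.comp hc)
    exact this.re
  have h0 := (integral_eq_zero_iff_of_nonneg (fun x => Complex.normSq_nonneg _) hint).1 h
  have h1 := (Continuous.ae_eq_iff_eq (surf d) hc continuous_const).1 h0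
  ext x
  exact Complex.normSq_eq_zero.1 (congrFun h1 x)

/-- The span of the spherical harmonics of order at most `n`. -/
def harmUpTo (d n : ℕ) : Submodule ℂ (Sph d → ℂ) := ⨆ l : Fin (n + 1), sphHarm d l

lemma sphHarm_le_harmUpTo {l n : ℕ} (h : l ≤ n) : sphHarm d l ≤ harmUpTo d n :=
  le_iSup (fun l : Fin (n + 1) => sphHarm d l) ⟨l, Nat.lt_succ_of_le h⟩

lemma harmUpTo_mono {m n : ℕ} (h : m ≤ n) : harmUpTo d m ≤ harmUpTo d n :=
  iSup_le fun l => sphHarm_le_harmUpTo ((Nat.le_of_lt_succ l.2).trans h)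

/-- The square of the Euclidean norm as a polynomial. -/
def normSqPoly (d : ℕ) : MvPolynomial (Fin (d + 1)) ℂ := ∑ i, X i ^ 2

lemma isHomogeneous_normSqPoly : (normSqPoly d).IsHomogeneous 2 :=
  IsHomogeneous.sum _ _ _ fun i _ => by simpa using isHomogeneous_X_pow (R := ℂ) i 2

lemma polyFun_normSqPoly_mul (q : MvPolynomial (Fin (d + 1)) ℂ) (y : Eu d) :
    polyFun (normSqPoly d * q) y = ((‖y‖ ^ 2 : ℝ) : ℂ) * polyFun q y := by
  rw [← sum_sq_eq_norm_sq]
  simp [polyFun, normSqPoly, map_sum, sq]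

lemma restrictSph_normSqPoly_mul (q : MvPolynomial (Fin (d + 1)) ℂ) :
    restrictSph d (normSqPoly d * q) = restrictSph d q := by
  ext x
  rw [restrictSph_apply, restrictSph_apply, polyFun_normSqPoly_mul, x.norm_coe]
  simp

lemma eq_zero_of_restrictSph_eq_zero {l : ℕ} {q : MvPolynomial (Fin (d + 1)) ℂ}
    (hq : q.IsHomogeneous l) (h : restrictSph d q = 0) : q = 0 := by
  have hne : ∀ y : Eu d, y ≠ 0 → polyFun q y = 0 := fun y hy => by
    have hy' : 0 < ‖y‖ := norm_pos_iff.2 hy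
    have hmem : ‖y‖⁻¹ • y ∈ Metric.sphere (0 : Eu d) 1 := by
      rw [mem_sphere_zero_iff_norm, norm_smul, norm_inv, norm_norm, inv_mul_cancel₀ hy'.ne']
    have h1 : polyFun q (‖y‖⁻¹ • y) = 0 := congrFun h ⟨_, hmem⟩
    have h2 := homogeneousDeg_polyFun hq ‖y‖ hy' (‖y‖⁻¹ • y)
    rwa [smul_smul, mul_inv_cancel₀ hy'.ne', one_smul, h1, mul_zero] at h2
  refine polyFun_injective (funext fun y => ?_)
  have hcl : Dense ({0}ᶜ : Set (Eu d)) := dense_compl_singleton 0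
  have := Continuous.ext_on hcl (contDiff_polyFun q (n := 0)).continuous
    (contDiff_polyFun (0 : MvPolynomial (Fin (d + 1)) ℂ) (n := 0)).continuous
    fun y hy => by rw [hne y hy]; simp [polyFun]
  exact congrFun this y

lemma polyLaplacian_apply (p : MvPolynomial (Fin (d + 1)) ℂ) :
    polyLaplacian d p = ∑ i, pderiv i (pderiv i p) := by
  simp [polyLaplacian, LinearMap.sum_apply]

lemma isHomogeneous_polyLaplacian {l : ℕ} {p : MvPolynomial (Fin (d + 1)) ℂ}
    (hp : p.IsHomogeneous l) : (polyLaplacian d p).IsHomogeneous (l - 1 - 1) := by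
  rw [polyLaplacian_apply]
  exact IsHomogeneous.sum _ _ _ fun i _ => hp.pderiv.pderiv

lemma polyLaplacian_eq_zero_of_le_one {l : ℕ} (hl : l ≤ 1) {p : MvPolynomial (Fin (d + 1)) ℂ}
    (hp : p.IsHomogeneous l) : polyLaplacian d p = 0 := by
  rw [polyLaplacian_apply]
  refine Finset.sum_eq_zero fun i _ => ?_
  have h0 : (pderiv i p).IsHomogeneous 0 := by
    have := hp.pderiv (i := i)
    rwa [Nat.sub_eq_zero_of_le hl] at this
  rw [← totalDegree_zero_iff_isHomogeneous, totalDegree_eq_zero_iff_eq_C] at h0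
  rw [h0, pderiv_C]

/-- Every homogeneous polynomial of degree `n` agrees on the sphere with a sum of spherical
harmonics of order at most `n`. In the inductive step, `q ↦ Δ (‖x‖² q)` is injective on
polynomials of degree `n - 2`: if `‖x‖² q` is harmonic, then its restriction to the sphere has
order `n`, but equals that of `q`, which is a sum of lower orders; so it is orthogonal to itself. -/
lemma restrictSph_mem_harmUpTo (hd : 1 ≤ d) (n : ℕ) : ∀ p : MvPolynomial (Fin (d + 1)) ℂ,
    p.IsHomogeneous n → restrictSph d p ∈ harmUpTo d n := by
  induction n using Nat.strong_induction_on with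
  | _ n ih =>
    intro p hp
    rcases le_or_gt n 1 with hn | hn
    · exact sphHarm_le_harmUpTo le_rfl
        ⟨p, ⟨hp, LinearMap.mem_ker.2 (polyLaplacian_eq_zero_of_le_one hn hp)⟩, rfl⟩
    have hmul : ∀ q : MvPolynomial (Fin (d + 1)) ℂ, q.IsHomogeneous (n - 2) →
        (normSqPoly d * q).IsHomogeneous n := fun q hq => by
      have := isHomogeneous_normSqPoly.mul hq
      rwa [Nat.add_sub_cancel' hn] at this
    let T : homogeneousSubmodule (Fin (d + 1)) ℂ (n - 2) →ₗ[ℂ]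
        homogeneousSubmodule (Fin (d + 1)) ℂ (n - 2) :=
      ((polyLaplacian d).comp (LinearMap.mulLeft ℂ (normSqPoly d))).restrict fun q hq => by
        have := isHomogeneous_polyLaplacian (hmul q hq)
        rwa [Nat.sub_sub] at this
    have hT : ∀ q, (T q : MvPolynomial (Fin (d + 1)) ℂ) =
        polyLaplacian d (normSqPoly d * q) := fun q => rfl
    have : FiniteDimensional ℂ (homogeneousSubmodule (Fin (d + 1)) ℂ (n - 2)) :=
      Module.Finite.iff_fg.2 (homogeneousSubmodule_fg (Fin (d + 1)) ℂ (n - 2))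
    have hinj : Function.Injective T := by
      rw [← LinearMap.ker_eq_bot, LinearMap.ker_eq_bot']
      rintro ⟨q, hq⟩ hTq
      have h0 : polyLaplacian d (normSqPoly d * q) = 0 := by
        rw [← hT ⟨q, hq⟩, hTq]
        rfl
      set f := restrictSph d q with hf
      have hfn : f ∈ sphHarm d n :=
        ⟨normSqPoly d * q, ⟨hmul q hq, LinearMap.mem_ker.2 h0⟩, restrictSph_normSqPoly_mul q⟩
      have hfc := continuous_of_mem_sphHarm hfn
      have hle : harmUpTo d (n - 2) ≤ orthSub f hfc := iSup_le fun l g hg =>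
        ⟨continuous_of_mem_sphHarm hg,
          integral_mul_conj_eq_zero_of_ne hd (by have := l.2; omega) hg hfn⟩
      have hf0 := eq_zero_of_integral_mul_conj_self hfc
        (hle (ih (n - 2) (by omega) q hq)).2
      exact Subtype.ext (eq_zero_of_restrictSph_eq_zero hq hf0)
    obtain ⟨⟨q, hq⟩, hTq⟩ := (LinearMap.injective_iff_surjective.1 hinj)
      ⟨polyLaplacian d p, by
        have := isHomogeneous_polyLaplacian hp
        rwa [Nat.sub_sub] at this⟩
    have hΔ : polyLaplacian d (normSqPoly d * q) = polyLaplacian d p := by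
      rw [← hT ⟨q, hq⟩, hTq]
    have hsplit : restrictSph d p = restrictSph d (p - normSqPoly d * q) + restrictSph d q := by
      rw [map_sub, restrictSph_normSqPoly_mul, sub_add_cancel]
    rw [hsplit]
    refine Submodule.add_mem _ (sphHarm_le_harmUpTo le_rfl ⟨p - normSqPoly d * q, ⟨?_, ?_⟩, rfl⟩)
      (harmUpTo_mono (Nat.sub_le n 2) (ih (n - 2) (by omega) q hq))
    · exact hp.sub (hmul q hq)
    · rw [SetLike.mem_coe, LinearMap.mem_ker, map_sub, hΔ, sub_self]

/-- A coordinate as a continuous function on the sphere. -/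
def coordFun (d : ℕ) (i : Fin (d + 1)) : C(Sph d, ℂ) where
  toFun x := (((x : Eu d) i : ℝ) : ℂ)
  continuous_toFun := by fun_prop

lemma coe_aeval_coordFun (p : MvPolynomial (Fin (d + 1)) ℂ) :
    ⇑(aeval (coordFun d) p) = restrictSph d p := by
  ext x
  rw [restrictSph_apply, polyFun]
  have h := map_aeval (coordFun d)
    ((ContinuousMap.evalAlgHom ℂ ℂ x : C(Sph d, ℂ) →ₐ[ℂ] ℂ) : C(Sph d, ℂ) →+* ℂ) p
  exact h.trans (by simp [aeval_def, coordFun])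

/-- Completeness: a continuous function orthogonal to all spherical harmonics vanishes, since it is
orthogonal to all polynomials, which are uniformly dense by the Stone-Weierstrass theorem. -/
theorem eq_zero_of_orthogonal_sphHarm (hd : 1 ≤ d) {g : Sph d → ℂ} (hg : Continuous g)
    (h : ∀ l, ∀ f ∈ sphHarm d l, ∫ x, f x * starRingEnd ℂ (g x) ∂(surf d) = 0) : g = 0 := by
  have hpoly : ∀ p : MvPolynomial (Fin (d + 1)) ℂ, restrictSph d p ∈ orthSub g hg := fun p => by
    rw [← sum_homogeneousComponent p, map_sum]
    refine Submodule.sum_mem _ fun n _ => ?_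
    refine (iSup_le fun l f hf => ?_ : harmUpTo d n ≤ orthSub g hg)
      (restrictSph_mem_harmUpTo hd n _ (homogeneousComponent_isHomogeneous n p))
    exact ⟨continuous_of_mem_sphHarm hf, h l f hf⟩
  set A : StarSubalgebra ℂ C(Sph d, ℂ) := StarAlgebra.adjoin ℂ (Set.range (coordFun d)) with hA
  have hAmem : ∀ a ∈ A, ⇑a ∈ orthSub g hg := by
    intro a ha
    have hstar : star (Set.range (coordFun d)) ⊆ Set.range (coordFun d) := by
      rintro a ⟨i, hi⟩
      refine ⟨i, ?_⟩
      have hself : star (coordFun d i) = coordFun d i := by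
        ext x
        simp [coordFun]
      rw [← hself, hi, star_star]
    have hmem : a ∈ Algebra.adjoin ℂ (Set.range (coordFun d)) := by
      have := StarAlgebra.adjoin_toSubalgebra ℂ (Set.range (coordFun d))
      rw [Set.union_eq_self_of_subset_right hstar] at this
      rw [← this]
      exact ha
    rw [Algebra.adjoin_range_eq_range_aeval] at hmem
    obtain ⟨p, hp⟩ := hmem
    have hp' : aeval (coordFun d) p = a := hp
    rw [← hp', coe_aeval_coordFun]
    exact hpoly p
  have hsep : A.SeparatesPoints := by
    intro x y hxy
    have : ∃ i, (x : Eu d) i ≠ (y : Eu d) i := by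
      by_contra hcon
      push Not at hcon
      exact hxy (Subtype.ext (PiLp.ext hcon))
    obtain ⟨i, hi⟩ := this
    refine ⟨coordFun d i, ⟨coordFun d i, StarAlgebra.subset_adjoin ℂ _ ⟨i, rfl⟩, rfl⟩, ?_⟩
    exact fun h => hi (Complex.ofReal_injective h)
  have hdense := ContinuousMap.starSubalgebra_topologicalClosure_eq_top_of_separatesPoints A hsep
  set G : C(Sph d, ℂ) := ⟨g, hg⟩
  have hG : G ∈ closure (A : Set C(Sph d, ℂ)) := by
    have : G ∈ A.topologicalClosure := by rw [hdense]; trivial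
    exact this
  refine eq_zero_of_integral_mul_conj_self hg ?_
  rw [← norm_eq_zero]
  refine le_antisymm (le_of_forall_pos_le_add fun ε hε => ?_) (norm_nonneg _)
  set K := ‖G‖ * (surf d).real Set.univ + 1 with hK
  have hK0 : 0 < K := by positivity
  obtain ⟨a, ha, hdist⟩ := Metric.mem_closure_iff.1 hG (ε / K) (by positivity)
  have hz := (hAmem a ha).2
  have heq : ∫ x, g x * starRingEnd ℂ (g x) ∂(surf d) =
      ∫ x, (g x - a x) * starRingEnd ℂ (g x) ∂(surf d) := by
    simp_rw [sub_mul]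
    rw [integral_sub (integrable_mul_conj hg hg) (integrable_mul_conj a.continuous hg), hz,
      sub_zero]
  rw [heq, zero_add]
  have hb : ∀ x, ‖(g x - a x) * starRingEnd ℂ (g x)‖ ≤ ε / K * ‖G‖ := fun x => by
    rw [norm_mul, RCLike.norm_conj]
    refine mul_le_mul ?_ (G.norm_coe_le_norm x) (norm_nonneg _) (by positivity)
    have := (G - a).norm_coe_le_norm x
    rw [dist_eq_norm] at hdist
    exact this.trans hdist.le
  refine (norm_integral_le_of_norm_le_const (Eventually.of_forall hb)).trans ?_
  rw [mul_assoc, div_mul_eq_mul_div, div_le_iff₀ hK0]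
  exact mul_le_mul_of_nonneg_left (by rw [hK]; linarith) hε.le

end Completeness

/-! ### The dimension of the space of spherical harmonics -/

section Dimension

open MvPolynomial

variable {d : ℕ}

lemma coeff_polyLaplacian (p : MvPolynomial (Fin (d + 1)) ℂ) (m : Fin (d + 1) →₀ ℕ) :
    coeff m (polyLaplacian d p) =
      ∑ i, coeff (m + Finsupp.single i 2) p * ((m i + 2 : ℕ) : ℂ) * ((m i + 1 : ℕ) : ℂ) := by
  rw [polyLaplacian_apply, coeff_sum]
  refine Finset.sum_congr rfl fun i _ => ?_
  rw [coeff_pderiv, coeff_pderiv, add_assoc, ← Finsupp.single_add]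
  simp only [Finsupp.add_apply, Finsupp.single_eq_same]
  push_cast
  ring

/-- A harmonic polynomial is determined by its coefficients of degree at most one in the first
variable, since the equation `Δ p = 0` expresses all others through them. -/
lemma eq_zero_of_coeff_eq_zero {p : MvPolynomial (Fin (d + 1)) ℂ} (hp : polyLaplacian d p = 0)
    (h : ∀ m : Fin (d + 1) →₀ ℕ, m 0 ≤ 1 → coeff m p = 0) : p = 0 := by
  have key : ∀ k, ∀ m : Fin (d + 1) →₀ ℕ, m 0 = k → coeff m p = 0 := by
    intro k
    induction k using Nat.strong_induction_on with
    | _ k ih =>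
      intro m hm
      rcases le_or_gt (m 0) 1 with h1 | h1
      · exact h m h1
      set m' := m - Finsupp.single 0 2 with hm'
      have hmm : m' + Finsupp.single 0 2 = m := by
        refine tsub_add_cancel_of_le ?_
        rw [Finsupp.single_le_iff]
        exact h1
      have hm0 : m' 0 = k - 2 := by simp [hm', hm]
      have hc := coeff_polyLaplacian p m'
      rw [hp, coeff_zero, Finset.sum_eq_single 0, hmm] at hc
      · have h2 : coeff m p * (((m' 0 + 2 : ℕ) : ℂ) * ((m' 0 + 1 : ℕ) : ℂ)) = 0 := by
          rw [← mul_assoc]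
          exact hc.symm
        refine (mul_eq_zero.1 h2).resolve_right ?_
        exact mul_ne_zero (Nat.cast_ne_zero.2 (by omega)) (Nat.cast_ne_zero.2 (by omega))
      · intro i _ hi
        rw [ih (k - 2) (by omega) (m' + Finsupp.single i 2) (by simp [hm0, hi]), zero_mul,
          zero_mul]
      · exact fun h => absurd (Finset.mem_univ _) h
  ext m
  rw [key _ m rfl, coeff_zero]

/-- The exponent of total degree `l` with given entries in all but the last variable. The truncated
subtraction gives an irrelevant exponent when these entries add up to more than `l`. -/
def expOf {e : ℕ} (l : ℕ) (b : Fin 2 × (Fin e → Fin (l + 1))) : Fin (e + 1 + 1) →₀ ℕ :=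
  Finsupp.equivFunOnFinite.symm
    (Fin.cons (b.1 : ℕ) (Fin.snoc (α := fun _ => ℕ) (fun j => (b.2 j : ℕ))
      (l - b.1 - ∑ j, (b.2 j : ℕ))))

lemma exists_expOf_eq {e l : ℕ} {m : Fin (e + 1 + 1) →₀ ℕ} (hm : m.degree = l) (h0 : m 0 ≤ 1) :
    ∃ b : Fin 2 × (Fin e → Fin (l + 1)), expOf l b = m := by
  rw [Finsupp.degree_eq_sum, Fin.sum_univ_succ, Fin.sum_univ_castSucc] at hm
  have hle : ∀ j : Fin e, m (Fin.succ (Fin.castSucc j)) ≤ l := fun j => by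
    have := Finset.single_le_sum (f := fun j : Fin e => m (Fin.succ (Fin.castSucc j)))
      (fun _ _ => Nat.zero_le _) (Finset.mem_univ j)
    omega
  refine ⟨(⟨m 0, by omega⟩, fun j => ⟨m (Fin.succ (Fin.castSucc j)),
    Nat.lt_succ_of_le (hle j)⟩), ?_⟩
  ext i
  simp only [expOf, Finsupp.equivFunOnFinite_symm_apply_apply]
  refine Fin.cases ?_ (fun i => ?_) i
  · simp
  · refine Fin.lastCases ?_ (fun j => ?_) i
    · simp only [Fin.cons_succ, Fin.snoc_last]
      omega
    · simp

/-- Upper bound for `N(d,l)`: the number of admissible exponents of degree at most one in the first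
variable. -/
lemma harmDim_le (hd : 1 ≤ d) (l : ℕ) : harmDim d l ≤ 2 * (l + 1) ^ (d - 1) := by
  obtain ⟨e, rfl⟩ : ∃ e, d = e + 1 := ⟨d - 1, by omega⟩
  set H := homogeneousSubmodule (Fin (e + 1 + 1)) ℂ l ⊓ (polyLaplacian (e + 1)).ker with hH
  have hfin : FiniteDimensional ℂ (homogeneousSubmodule (Fin (e + 1 + 1)) ℂ l) :=
    Module.Finite.iff_fg.2 (homogeneousSubmodule_fg (Fin (e + 1 + 1)) ℂ l)
  have hfinH : FiniteDimensional ℂ H := Submodule.finiteDimensional_inf_left _ _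
  have h1 : harmDim (e + 1) l ≤ Module.finrank ℂ H := Submodule.finrank_map_le _ _
  let c : H →ₗ[ℂ] (Fin 2 × (Fin e → Fin (l + 1)) → ℂ) :=
    LinearMap.pi fun b => (lcoeff ℂ (expOf l b)).comp H.subtype
  have hc : Function.Injective c := by
    rw [← LinearMap.ker_eq_bot, LinearMap.ker_eq_bot']
    rintro ⟨p, hp⟩ hcp
    refine Subtype.ext (eq_zero_of_coeff_eq_zero (LinearMap.mem_ker.1 hp.2) fun m hm => ?_)
    by_cases hdeg : m.degree = l
    · obtain ⟨b, rfl⟩ := exists_expOf_eq hdeg hm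
      exact congrFun hcp b
    · exact IsHomogeneous.coeff_eq_zero hp.1 hdeg
  refine h1.trans ((LinearMap.finrank_le_finrank_of_injective hc).trans (le_of_eq ?_))
  rw [Module.finrank_fintype_fun_eq_card]
  simp

end Dimension

/-! ### Orthonormal bases of spherical harmonics -/

section Basis

variable {d : ℕ} {B : (l : ℕ) → Fin (harmDim d l) → Sph d → ℂ}

lemma IsHarmonicBasis.mem (hB : IsHarmonicBasis d B) (l : ℕ) (q : Fin (harmDim d l)) :
    B l q ∈ sphHarm d l := by
  rw [← hB.span_eq l]
  exact Submodule.subset_span ⟨q, rfl⟩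

lemma IsHarmonicBasis.continuous (hB : IsHarmonicBasis d B) (l : ℕ) (q : Fin (harmDim d l)) :
    Continuous (B l q) :=
  continuous_of_mem_sphHarm (hB.mem l q)

lemma IsHarmonicBasis.expand (hB : IsHarmonicBasis d B) {l : ℕ} {f : Sph d → ℂ}
    (hf : f ∈ sphHarm d l) (x : Sph d) : f x = ∑ q, fourierCoeff B f l q * B l q x := by
  rw [← hB.span_eq l, Submodule.mem_span_range_iff_exists_fun] at hf
  obtain ⟨c, rfl⟩ := hf
  have hcoef : ∀ r, fourierCoeff B (∑ q, c q • B l q) l r = c r := fun r => by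
    rw [fourierCoeff]
    simp only [Finset.sum_apply, Pi.smul_apply, smul_eq_mul, Finset.sum_mul, mul_assoc]
    rw [integral_finsetSum _ fun q _ =>
      (integrable_mul_conj (hB.continuous l q) (hB.continuous l r)).const_mul _]
    simp_rw [integral_const_mul, hB.orthonormal]
    simp
  simp_rw [hcoef]
  simp

/-- Parseval's identity within a space of spherical harmonics. -/
lemma IsHarmonicBasis.integral_mul_conj (hB : IsHarmonicBasis d B) {l : ℕ} {f g : Sph d → ℂ}
    (hf : Continuous f) (hg : g ∈ sphHarm d l) :
    ∫ x, f x * starRingEnd ℂ (g x) ∂(surf d) =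
      ∑ r, fourierCoeff B f l r * starRingEnd ℂ (fourierCoeff B g l r) := by
  have h : ∀ x, f x * starRingEnd ℂ (g x) =
      ∑ r, starRingEnd ℂ (fourierCoeff B g l r) * (f x * starRingEnd ℂ (B l r x)) := fun x => by
    rw [hB.expand hg x, map_sum, Finset.mul_sum]
    refine Finset.sum_congr rfl fun r _ => ?_
    rw [map_mul]
    ring
  simp_rw [h]
  rw [integral_finsetSum _ fun r _ =>
    (integrable_mul_conj hf (hB.continuous l r)).const_mul _]
  refine Finset.sum_congr rfl fun r _ => ?_
  rw [integral_const_mul, mul_comm]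
  rfl

/-- The Christoffel function of the spherical harmonics of order `l`. -/
def christoffel (B : (l : ℕ) → Fin (harmDim d l) → Sph d → ℂ) (l : ℕ) (x : Sph d) : ℝ :=
  ∑ q, ‖B l q x‖ ^ 2

lemma christoffel_eq (l : ℕ) (x : Sph d) :
    ((christoffel B l x : ℝ) : ℂ) = ∑ q, B l q x * starRingEnd ℂ (B l q x) := by
  rw [christoffel]
  push_cast
  exact Finset.sum_congr rfl fun q _ => (Complex.mul_conj' _).symm

/-- Linear isometries act on an orthonormal basis of spherical harmonics by unitary matrices. -/
lemma christoffel_isoSph (hB : IsHarmonicBasis d B) (L : Eu d ≃ₗᵢ[ℝ] Eu d) (l : ℕ) (x : Sph d) :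
    christoffel B l (isoSph L x) = christoffel B l x := by
  set M : Matrix (Fin (harmDim d l)) (Fin (harmDim d l)) ℂ :=
    Matrix.of fun q r => fourierCoeff B (B l q ∘ isoSph L) l r with hM
  have hmem := fun q => comp_isoSph_mem_sphHarm L (hB.mem l q)
  have hMM : M * M.conjTranspose = 1 := by
    ext q q'
    have hinv := integral_comp_isoSph L (f := fun x => B l q x * starRingEnd ℂ (B l q' x))
      ((hB.continuous l q).mul (Complex.continuous_conj.comp (hB.continuous l q')))
    rw [Matrix.mul_apply, Matrix.one_apply, ← hB.orthonormal l q q', ← hinv]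
    exact (hB.integral_mul_conj (continuous_of_mem_sphHarm (hmem q)) (hmem q')).symm
  have hMM' : M.conjTranspose * M = 1 := mul_eq_one_comm.1 hMM
  have hexp : (fun q => B l q (isoSph L x)) = M.mulVec fun r => B l r x := by
    ext q
    exact hB.expand (hmem q) x
  have hdot : ∀ y, ((christoffel B l y : ℝ) : ℂ) =
      (star fun q => B l q y) ⬝ᵥ (fun q => B l q y) := fun y => by
    rw [christoffel_eq]
    exact Finset.sum_congr rfl fun q _ => mul_comm _ _
  refine Complex.ofReal_injective ?_
  rw [hdot, hdot, hexp, Matrix.star_mulVec, Matrix.dotProduct_mulVec, Matrix.vecMul_vecMul, hMM',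
    Matrix.vecMul_one]

lemma exists_isoSph_eq (x y : Sph d) : ∃ L : Eu d ≃ₗᵢ[ℝ] Eu d, isoSph L x = y :=
  ⟨(Submodule.span ℝ {(x : Eu d) - y})ᗮ.reflection,
    Subtype.ext (Submodule.reflection_sub (by rw [x.norm_coe, y.norm_coe]))⟩

/-- The addition theorem on the diagonal: the Christoffel function is constant, hence equal to
its mean. -/
lemma christoffel_mul_area (hB : IsHarmonicBasis d B) (l : ℕ) (x : Sph d) :
    christoffel B l x * (surf d).real Set.univ = harmDim d l := by
  have hconst : ∀ y, christoffel B l y = christoffel B l x := fun y => by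
    obtain ⟨L, rfl⟩ := exists_isoSph_eq x y
    exact christoffel_isoSph hB L l x
  have h1 : ∫ y, ((christoffel B l y : ℝ) : ℂ) ∂(surf d) = (harmDim d l : ℂ) := by
    simp_rw [christoffel_eq]
    rw [integral_finsetSum _ fun q _ =>
      integrable_mul_conj (hB.continuous l q) (hB.continuous l q)]
    simp_rw [hB.orthonormal]
    simp
  simp_rw [hconst] at h1
  rw [integral_const, Complex.real_smul] at h1
  rw [mul_comm]
  exact_mod_cast h1

lemma area_pos (d : ℕ) : 0 < (surf d).real Set.univ := by
  have hne : Nonempty (Sph d) := ⟨⟨EuclideanSpace.single 0 1, by simp⟩⟩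
  exact ENNReal.toReal_pos (isOpen_univ.measure_ne_zero (surf d) Set.univ_nonempty)
    (measure_ne_top _ _)

/-- Growth of the Christoffel function. -/
lemma exists_christoffel_le (hd : 1 ≤ d) (hB : IsHarmonicBasis d B) :
    ∃ C : ℝ, 0 < C ∧ ∀ l x, christoffel B l x ≤ C * ((l : ℝ) + 1) ^ (d - 1) := by
  have hA := area_pos d
  refine ⟨2 / (surf d).real Set.univ, by positivity, fun l x => ?_⟩
  rw [div_mul_eq_mul_div, le_div_iff₀ hA, christoffel_mul_area hB]
  exact_mod_cast harmDim_le hd l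

end Basis

/-! ### The Laplace-Beltrami operator in Fourier space -/

section LaplaceBeltrami

open Laplacian

variable {d : ℕ}

/-- The extension of a function on the sphere that is constant along rays, with the conventional
value zero at the origin. Its Laplacian on the sphere is the Laplace-Beltrami operator. -/
def radialExt (f : Sph d → ℝ) (y : Eu d) : ℝ :=
  if h : y = 0 then (0 : ℝ) else f ⟨‖y‖⁻¹ • y, by
    rw [mem_sphere_zero_iff_norm, norm_smul, norm_inv, norm_norm,
      inv_mul_cancel₀ (norm_ne_zero_iff.2 h)]⟩

lemma radialExt_coe (f : Sph d → ℝ) (x : Sph d) : radialExt f (x : Eu d) = f x := by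
  rw [radialExt, dif_neg x.coe_ne_zero]
  congr 1
  ext1
  simp only [x.norm_coe, inv_one, one_smul]

lemma radialExt_smul (f : Sph d → ℝ) {t : ℝ} (ht : 0 < t) (y : Eu d) :
    radialExt f (t • y) = radialExt f y := by
  by_cases hy : y = 0
  · rw [hy, smul_zero]
  · have hty : t • y ≠ 0 := smul_ne_zero ht.ne' hy
    rw [radialExt, radialExt, dif_neg hy, dif_neg hty]
    congr 1
    ext1
    simp only [norm_smul, Real.norm_eq_abs, abs_of_pos ht, smul_smul]
    congr 1
    have := norm_ne_zero_iff.2 hy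
    field_simp

/-- Smoothness of a function on the sphere, expressed through its radially constant extension. -/
def SphSmooth (m : WithTop ℕ∞) (f : Sph d → ℝ) : Prop :=
  ∀ y : Eu d, y ≠ 0 → ContDiffAt ℝ m (radialExt f) y

lemma SphSmooth.of_le {m n : WithTop ℕ∞} {f : Sph d → ℝ} (hf : SphSmooth n f) (h : m ≤ n) :
    SphSmooth m f := fun y hy => (hf y hy).of_le h

lemma SphSmooth.continuous {m : WithTop ℕ∞} {f : Sph d → ℝ} (hf : SphSmooth m f) :
    Continuous f := by
  have h : Continuous fun x : Sph d => radialExt f (x : Eu d) :=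
    continuous_iff_continuousAt.2 fun x =>
      (hf x x.coe_ne_zero).continuousAt.comp continuous_subtype_val.continuousAt
  simpa only [radialExt_coe] using h

lemma contDiffAt_normalize {m : WithTop ℕ∞} {y : Eu d} (hy : y ≠ 0) :
    ContDiffAt ℝ m (fun y : Eu d => ‖y‖⁻¹ • y) y :=
  ((contDiffAt_norm ℝ hy).inv (norm_ne_zero_iff.2 hy)).smul contDiffAt_id

/-- The normalization `y ↦ y / ‖y‖` is smooth from the punctured space to the manifold `S^d`. -/
lemma sphSmooth_of_contMDiff {m : WithTop ℕ∞} {f : Sph d → ℝ}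
    (hf : ContMDiff (𝓡 d) 𝓘(ℝ, ℝ) m f) : SphSmooth m f := by
  let M : TopologicalSpace.Opens (Eu d) := ⟨{0}ᶜ, isOpen_compl_singleton⟩
  have hfact : Fact (Module.finrank ℝ (Eu d) = d + 1) := ⟨finrank_euclideanSpace_fin⟩
  let ν : Eu d → Eu d := fun y => ‖y‖⁻¹ • y
  have hν : ContMDiff 𝓘(ℝ, Eu d) 𝓘(ℝ, Eu d) m fun y : M => ν y := fun y =>
    contMDiffAt_subtype_iff.2 (contDiffAt_normalize y.2).contMDiffAt
  have hmem : ∀ y : M, ν y ∈ Metric.sphere (0 : Eu d) 1 := fun y => by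
    rw [mem_sphere_zero_iff_norm, norm_smul, norm_inv, norm_norm,
      inv_mul_cancel₀ (norm_ne_zero_iff.2 y.2)]
  have hcomp := hf.comp (ContMDiff.codRestrict_sphere hν hmem)
  intro y hy
  have h1 := hcomp ⟨y, hy⟩
  rw [← contMDiffAt_iff_contDiffAt]
  have h2 : ContMDiffAt 𝓘(ℝ, Eu d) 𝓘(ℝ, ℝ) m (fun z : M => radialExt f z) ⟨y, hy⟩ := by
    refine h1.congr_of_eventuallyEq (Eventually.of_forall fun z => ?_)
    change radialExt f z = _
    rw [radialExt, dif_neg (show ¬(z : Eu d) = 0 from z.2)]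
    rfl
  exact contMDiffAt_subtype_iff.1 h2

lemma SphSmooth.laplaceBeltrami {m : WithTop ℕ∞} {f : Sph d → ℝ} (hf : SphSmooth (m + 2) f) :
    SphSmooth m (laplaceBeltrami f) := by
  intro y hy
  have hΔ : ∀ z : Eu d, z ≠ 0 → ContDiffAt ℝ m (Δ (radialExt f)) z := fun z hz => by
    have h1 : ContDiffAt ℝ m (fun z => ∑ i, fderiv ℝ (fderiv ℝ (radialExt f)) z
        (EuclideanSpace.single i 1) (EuclideanSpace.single i 1)) z := by
      refine ContDiffAt.sum fun i _ => ?_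
      have h2 : ContDiffAt ℝ (m + 1) (fderiv ℝ (radialExt f)) z :=
        (hf z hz).fderiv_right (by rw [add_assoc]; norm_num)
      exact ((h2.fderiv_right le_rfl).clm_apply contDiffAt_const).clm_apply contDiffAt_const
    refine h1.congr_of_eventuallyEq (Eventually.of_forall fun z => ?_)
    exact laplacian_eq_sum_fderiv _ _
  have hne : ‖y‖⁻¹ • y ≠ 0 := smul_ne_zero (inv_ne_zero (norm_ne_zero_iff.2 hy)) hy
  refine (ContDiffAt.comp (f := fun y : Eu d => ‖y‖⁻¹ • y) y (hΔ _ hne)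
    (contDiffAt_normalize hy)).congr_of_eventuallyEq ?_
  filter_upwards [isOpen_compl_singleton.mem_nhds hy] with z hz
  rw [radialExt, dif_neg (show ¬z = 0 from hz)]
  rfl

lemma SphSmooth.iterate_laplaceBeltrami {f : Sph d → ℝ} (k : ℕ) {m : ℕ}
    (hf : SphSmooth ((m + 2 * k : ℕ) : WithTop ℕ∞) f) :
    SphSmooth (m : WithTop ℕ∞) (SphDeconv.laplaceBeltrami^[k] f) := by
  induction k generalizing f with
  | zero => simpa using hf
  | succ k ih =>
    rw [Function.iterate_succ_apply]
    refine ih (SphSmooth.laplaceBeltrami (hf.of_le (le_of_eq ?_)))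
    push_cast
    ring

variable {B : (l : ℕ) → Fin (harmDim d l) → Sph d → ℂ}

/-- The Laplace-Beltrami operator is symmetric and has the spherical harmonics of order `l` as
eigenfunctions with eigenvalue `-l (l + d - 1)`. -/
lemma fourierCoeff_laplaceBeltrami (hB : IsHarmonicBasis d B) {f : Sph d → ℝ}
    (hf : SphSmooth 2 f) (l : ℕ) (q : Fin (harmDim d l)) :
    fourierCoeff B (fun x => (laplaceBeltrami f x : ℂ)) l q =
      -((l : ℂ) * (l + d - 1)) * fourierCoeff B (fun x => (f x : ℂ)) l q := by
  obtain ⟨G, hG1, hG2, hG3, hG4⟩ := exists_harmonic_extension_conj (hB.mem l q)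
  let F : Eu d → ℂ := Complex.ofRealCLM ∘ radialExt f
  have hF1 : SmoothOff F := fun y hy => Complex.ofRealCLM.contDiff.contDiffAt.comp y (hf y hy)
  have hF2 : HomogeneousDeg 0 F := fun t ht y => by
    simp only [F, Function.comp_apply, radialExt_smul f ht, pow_zero, one_mul]
  have hF3 : ∀ x : Sph d, Δ F (x : Eu d) = (laplaceBeltrami f x : ℂ) := fun x =>
    (hf x x.coe_ne_zero).laplacian_CLM_comp_left
  have hF4 : ∀ x : Sph d, F x = (f x : ℂ) := fun x => by
    simp only [F, Function.comp_apply, radialExt_coe, Complex.ofRealCLM_apply]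
  have h := integral_laplacian_sub_mul hF1 hG1 hF2 hG2
  simp_rw [hF3, hG3, hF4, hG4] at h
  rw [fourierCoeff, fourierCoeff, ← integral_const_mul]
  simp only [Nat.cast_zero, zero_mul, sub_zero, zero_sub] at h
  rw [h]
  exact integral_congr_ae (Eventually.of_forall fun x => by ring)

lemma fourierCoeff_iterate_laplaceBeltrami (hB : IsHarmonicBasis d B) (k : ℕ) {f : Sph d → ℝ}
    (hf : SphSmooth ((2 * k : ℕ) : WithTop ℕ∞) f) (l : ℕ) (q : Fin (harmDim d l)) :
    fourierCoeff B (fun x => (laplaceBeltrami^[k] f x : ℂ)) l q =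
      (-((l : ℂ) * (l + d - 1))) ^ k * fourierCoeff B (fun x => (f x : ℂ)) l q := by
  induction k generalizing f with
  | zero => simp
  | succ k ih =>
    rw [Function.iterate_succ_apply, ih, fourierCoeff_laplaceBeltrami hB, pow_succ, mul_assoc]
    · refine hf.of_le ?_
      exact_mod_cast (by omega : 2 ≤ 2 * (k + 1))
    · refine SphSmooth.laplaceBeltrami (hf.of_le (le_of_eq ?_))
      push_cast
      ring

end LaplaceBeltrami

/-! ### Fourier-Laplace series -/

section Series

variable {d : ℕ} {B : (l : ℕ) → Fin (harmDim d l) → Sph d → ℂ}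

lemma IsHarmonicBasis.integral_mul_conj_eq_ite (hd : 1 ≤ d) (hB : IsHarmonicBasis d B)
    (p q : (l : ℕ) × Fin (harmDim d l)) :
    ∫ x, B p.1 p.2 x * starRingEnd ℂ (B q.1 q.2 x) ∂(surf d) = if q = p then 1 else 0 := by
  obtain ⟨l, i⟩ := p
  obtain ⟨m, j⟩ := q
  by_cases hlm : l = m
  · subst hlm
    rw [hB.orthonormal]
    simp [eq_comm]
  · rw [integral_mul_conj_eq_zero_of_ne hd hlm (hB.mem l i) (hB.mem m j), if_neg]
    intro h
    exact hlm (congrArg Sigma.fst h).symm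

/-- Bessel's inequality. -/
lemma summable_sum_norm_fourierCoeff_sq (hd : 1 ≤ d) (hB : IsHarmonicBasis d B) {f : Sph d → ℂ}
    (hf : Continuous f) : Summable fun l => ∑ q, ‖fourierCoeff B f l q‖ ^ 2 := by
  let e : ((l : ℕ) × Fin (harmDim d l)) → Lp ℂ 2 (surf d) := fun p =>
    ContinuousMap.toLp 2 (surf d) ℂ ⟨B p.1 p.2, hB.continuous p.1 p.2⟩
  have he : Orthonormal ℂ e := by
    rw [orthonormal_iff_ite]
    intro p q
    rw [ContinuousMap.inner_toLp]
    simp only [ContinuousMap.coe_mk]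
    rw [hB.integral_mul_conj_eq_ite hd]
  have h := he.inner_products_summable (x := ContinuousMap.toLp 2 (surf d) ℂ ⟨f, hf⟩)
  have h2 : ∀ p, ‖inner ℂ (e p) (ContinuousMap.toLp 2 (surf d) ℂ ⟨f, hf⟩)‖ ^ 2 =
      ‖fourierCoeff B f p.1 p.2‖ ^ 2 := fun p => by
    rw [ContinuousMap.inner_toLp]
    rfl
  simp_rw [h2] at h
  simpa only [tsum_fintype] using h.sigma

/-- The orthogonal projection of a function to the spherical harmonics of order `l`. -/
def harmProj (B : (l : ℕ) → Fin (harmDim d l) → Sph d → ℂ) (f : Sph d → ℂ) (l : ℕ)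
    (x : Sph d) : ℂ :=
  ∑ q, fourierCoeff B f l q * B l q x

lemma harmProj_mem (hB : IsHarmonicBasis d B) (f : Sph d → ℂ) (l : ℕ) :
    harmProj B f l ∈ sphHarm d l := by
  have h : harmProj B f l = ∑ q, fourierCoeff B f l q • B l q := by
    ext x
    simp [harmProj]
  rw [h]
  exact Submodule.sum_mem _ fun q _ => Submodule.smul_mem _ _ (hB.mem l q)

lemma fourierCoeff_harmProj (hB : IsHarmonicBasis d B) (f : Sph d → ℂ) (l : ℕ)
    (r : Fin (harmDim d l)) : fourierCoeff B (harmProj B f l) l r = fourierCoeff B f l r := by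
  rw [fourierCoeff]
  simp only [harmProj, Finset.sum_mul, mul_assoc]
  rw [integral_finsetSum _ fun q _ =>
    (integrable_mul_conj (hB.continuous l q) (hB.continuous l r)).const_mul _]
  simp_rw [integral_const_mul, hB.orthonormal]
  simp

/-- A uniformly convergent Fourier-Laplace series of a continuous function has the right sum:
the difference is continuous and orthogonal to all spherical harmonics. -/
lemma hasSum_harmProj_of_summable (hd : 1 ≤ d) (hB : IsHarmonicBasis d B) {f : Sph d → ℂ}
    (hf : Continuous f) {b : ℕ → ℝ} (hb : Summable b) (hfb : ∀ l x, ‖harmProj B f l x‖ ≤ b l)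
    (x : Sph d) : HasSum (fun l => harmProj B f l x) (f x) := by
  have hcl : ∀ l, Continuous (harmProj B f l) := fun l =>
    continuous_of_mem_sphHarm (harmProj_mem hB f l)
  have hsum : ∀ x, Summable fun l => harmProj B f l x := fun x =>
    hb.of_norm_bounded fun l => hfb l x
  set S : Sph d → ℂ := fun x => ∑' l, harmProj B f l x with hS
  have hSc : Continuous S := continuous_tsum hcl hb hfb
  have horth : ∀ m, ∀ p ∈ sphHarm d m,
      ∫ x, S x * starRingEnd ℂ (p x) ∂(surf d) = ∫ x, f x * starRingEnd ℂ (p x) ∂(surf d) := by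
    intro m p hp
    have hpc := continuous_of_mem_sphHarm hp
    have h1 : HasSum (fun l => ∫ x, harmProj B f l x * starRingEnd ℂ (p x) ∂(surf d))
        (∫ x, S x * starRingEnd ℂ (p x) ∂(surf d)) := by
      refine hasSum_integral_of_dominated_convergence (fun l x => b l * ‖p x‖) (fun l => ?_)
        (fun l => ?_) ?_ ?_ ?_
      · exact (integrable_mul_conj (hcl l) hpc).aestronglyMeasurable
      · refine Eventually.of_forall fun x => ?_
        rw [norm_mul, RCLike.norm_conj]
        exact mul_le_mul_of_nonneg_right (hfb l x) (norm_nonneg _)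
      · exact Eventually.of_forall fun x => hb.mul_right _
      · simp_rw [tsum_mul_right]
        exact ((integrable_surf_of_continuous hpc).norm).const_mul _
      · exact Eventually.of_forall fun x => (hsum x).hasSum.mul_right _
    have h2 := hasSum_single (f := fun l =>
      ∫ x, harmProj B f l x * starRingEnd ℂ (p x) ∂(surf d)) m fun l hl =>
        integral_mul_conj_eq_zero_of_ne hd hl (harmProj_mem hB f l) hp
    rw [h1.unique h2, hB.integral_mul_conj (hcl m) hp, hB.integral_mul_conj hf hp]
    simp_rw [fourierCoeff_harmProj hB]
  have hzero : (fun x => S x - f x) = 0 := by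
    refine eq_zero_of_orthogonal_sphHarm hd (hSc.sub hf) fun m p hp => ?_
    have hpc := continuous_of_mem_sphHarm hp
    have h3 : ∫ x, (S x - f x) * starRingEnd ℂ (p x) ∂(surf d) = 0 := by
      simp_rw [sub_mul]
      rw [integral_sub (integrable_mul_conj hSc hpc) (integrable_mul_conj hf hpc), horth m p hp,
        sub_self]
    have h4 := congrArg (starRingEnd ℂ) h3
    rw [← integral_conj, map_zero] at h4
    rw [← h4]
    exact integral_congr_ae (Eventually.of_forall fun x => by
      simp only [map_mul, Complex.conj_conj]
      ring)
  have hx : S x = f x := sub_eq_zero.1 (congrFun hzero x)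
  rw [← hx]
  exact (hsum x).hasSum

end Series

/-! ### Rate of convergence for smooth functions -/

section SmoothSeries

variable {d : ℕ} {B : (l : ℕ) → Fin (harmDim d l) → Sph d → ℂ} {k : ℕ} {f : Sph d → ℝ}

lemma pow_mul_norm_fourierCoeff_le (hd : 1 ≤ d) (hB : IsHarmonicBasis d B)
    (hf : SphSmooth ((2 * k : ℕ) : WithTop ℕ∞) f) (l : ℕ) (q : Fin (harmDim d l)) :
    (l : ℝ) ^ (2 * k) * ‖fourierCoeff B (fun x => (f x : ℂ)) l q‖ ≤
      ‖fourierCoeff B (fun x => (laplaceBeltrami^[k] f x : ℂ)) l q‖ := by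
  rw [fourierCoeff_iterate_laplaceBeltrami hB k hf, norm_mul, norm_pow, norm_neg, norm_mul,
    pow_mul]
  refine mul_le_mul_of_nonneg_right (pow_le_pow_left₀ (by positivity) ?_ k) (norm_nonneg _)
  have h : ((l : ℂ) + d - 1) = ((l + d - 1 : ℕ) : ℂ) := by
    rw [Nat.cast_sub (by omega)]
    push_cast
    rfl
  rw [h, Complex.norm_natCast, Complex.norm_natCast, sq]
  refine mul_le_mul_of_nonneg_left ?_ (by positivity)
  exact_mod_cast (by omega : l ≤ l + d - 1)

/-- A uniform bound, summable over the degrees, on the terms of the Fourier-Laplace series: the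
coefficients of `f` decay faster than those of its iterated Laplacian, which are square summable
by Bessel's inequality, and the excess decay beats the growth of the Christoffel function. -/
lemma exists_summable_norm_harmProj_le (hd : 1 ≤ d) (hB : IsHarmonicBasis d B)
    (hk : d + 1 ≤ 4 * k) (hf : SphSmooth ((2 * k : ℕ) : WithTop ℕ∞) f) :
    ∃ b : ℕ → ℝ, Summable b ∧ ∀ l x, ‖harmProj B (fun x => (f x : ℂ)) l x‖ ≤ b l := by
  obtain ⟨C, hC, hCx⟩ := exists_christoffel_le hd hB
  set φ := fourierCoeff B (fun x => (f x : ℂ)) with hφ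
  set ψ := fourierCoeff B (fun x => (laplaceBeltrami^[k] f x : ℂ)) with hψ
  have hcf : Continuous fun x => (f x : ℂ) := Complex.continuous_ofReal.comp hf.continuous
  have hch : Continuous fun x => (laplaceBeltrami^[k] f x : ℂ) := by
    refine Complex.continuous_ofReal.comp (SphSmooth.continuous (m := ((0 : ℕ) : WithTop ℕ∞))
      (SphSmooth.iterate_laplaceBeltrami k ?_))
    rwa [zero_add]
  have hsφ := summable_sum_norm_fourierCoeff_sq hd hB hcf
  have hsψ := summable_sum_norm_fourierCoeff_sq hd hB hch
  have hs2 : Summable fun l : ℕ => C * (((l : ℝ) + 1) ^ 2)⁻¹ := by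
    have h := (summable_nat_add_iff 1).2 (Real.summable_nat_pow_inv (p := 2) |>.2 one_lt_two)
    refine Summable.mul_left C ?_
    simpa using h
  refine ⟨fun l => 4 ^ k * (∑ q, ‖φ l q‖ ^ 2 + ∑ q, ‖ψ l q‖ ^ 2 + C * (((l : ℝ) + 1) ^ 2)⁻¹),
    ((hsφ.add hsψ).add hs2).mul_left _, fun l x => ?_⟩
  set a : ℝ := ((l : ℝ) + 1) ^ (2 * k) with ha
  have ha0 : 0 < a := by positivity
  -- the sum of both coefficients on the right makes the estimate hold in degree zero too
  have hcoef : ∀ q, a * ‖φ l q‖ ≤ 4 ^ k * (‖φ l q‖ + ‖ψ l q‖) := fun q => by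
    have h1 := pow_mul_norm_fourierCoeff_le hd hB hf l q
    have h2 : a ≤ 4 ^ k * (1 + (l : ℝ) ^ (2 * k)) := by
      rcases Nat.eq_zero_or_pos l with rfl | hl
      · have h4 : (1 : ℝ) ≤ 4 ^ k := one_le_pow₀ (by norm_num)
        have h0 : (0 : ℝ) ≤ 0 ^ (2 * k) := by positivity
        rw [ha, Nat.cast_zero, zero_add, one_pow]
        exact h4.trans (le_mul_of_one_le_right (by positivity) (by linarith))
      · have hl' : (1 : ℝ) ≤ l := by exact_mod_cast hl
        calc a ≤ (2 * (l : ℝ)) ^ (2 * k) := pow_le_pow_left₀ (by positivity) (by linarith) _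
          _ = 4 ^ k * (l : ℝ) ^ (2 * k) := by rw [mul_pow, pow_mul]; norm_num
          _ ≤ _ := by gcongr; linarith
    calc a * ‖φ l q‖ ≤ 4 ^ k * (1 + (l : ℝ) ^ (2 * k)) * ‖φ l q‖ := by gcongr
      _ = 4 ^ k * (‖φ l q‖ + (l : ℝ) ^ (2 * k) * ‖φ l q‖) := by ring
      _ ≤ _ := by gcongr
  have hterm : ∀ q, ‖φ l q‖ * ‖B l q x‖ ≤
      4 ^ k * (‖φ l q‖ ^ 2 + ‖ψ l q‖ ^ 2 + (a ^ 2)⁻¹ * ‖B l q x‖ ^ 2) := fun q => by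
    have h1 : ‖φ l q‖ ≤ 4 ^ k * (‖φ l q‖ + ‖ψ l q‖) * a⁻¹ := by
      rw [← div_eq_mul_inv, le_div_iff₀ ha0, mul_comm]
      exact hcoef q
    calc ‖φ l q‖ * ‖B l q x‖ ≤ 4 ^ k * (‖φ l q‖ + ‖ψ l q‖) * a⁻¹ * ‖B l q x‖ := by gcongr
      _ = 4 ^ k * ((‖φ l q‖ + ‖ψ l q‖) * (a⁻¹ * ‖B l q x‖)) := by ring
      _ ≤ 4 ^ k * (‖φ l q‖ ^ 2 + ‖ψ l q‖ ^ 2 + (a⁻¹ * ‖B l q x‖) ^ 2) := by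
        gcongr
        nlinarith [sq_nonneg (‖φ l q‖ - ‖ψ l q‖),
          sq_nonneg (‖φ l q‖ + ‖ψ l q‖ - a⁻¹ * ‖B l q x‖), sq_nonneg (a⁻¹ * ‖B l q x‖)]
      _ = _ := by rw [mul_pow, inv_pow]
  have hchr : (a ^ 2)⁻¹ * christoffel B l x ≤ C * (((l : ℝ) + 1) ^ 2)⁻¹ := by
    rw [← div_eq_inv_mul, ← div_eq_mul_inv, div_le_div_iff₀ (by positivity) (by positivity)]
    calc christoffel B l x * ((l : ℝ) + 1) ^ 2
        ≤ C * ((l : ℝ) + 1) ^ (d - 1) * ((l : ℝ) + 1) ^ 2 := by gcongr; exact hCx l x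
      _ = C * ((l : ℝ) + 1) ^ (d - 1 + 2) := by rw [mul_assoc, ← pow_add]
      _ ≤ C * ((l : ℝ) + 1) ^ (2 * k * 2) := by
        gcongr
        · linarith [(Nat.cast_nonneg l : (0 : ℝ) ≤ l)]
        · omega
      _ = C * a ^ 2 := by rw [ha, ← pow_mul]
  calc ‖harmProj B (fun x => (f x : ℂ)) l x‖ ≤ ∑ q, ‖φ l q‖ * ‖B l q x‖ :=
        (norm_sum_le _ _).trans (Finset.sum_le_sum fun q _ => (norm_mul _ _).le)
    _ ≤ ∑ q, 4 ^ k * (‖φ l q‖ ^ 2 + ‖ψ l q‖ ^ 2 + (a ^ 2)⁻¹ * ‖B l q x‖ ^ 2) :=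
        Finset.sum_le_sum fun q _ => hterm q
    _ = 4 ^ k * (∑ q, ‖φ l q‖ ^ 2 + ∑ q, ‖ψ l q‖ ^ 2 + (a ^ 2)⁻¹ * christoffel B l x) := by
        rw [← Finset.mul_sum, Finset.sum_add_distrib, Finset.sum_add_distrib, christoffel,
          Finset.mul_sum]
    _ ≤ _ := mul_le_mul_of_nonneg_left (add_le_add le_rfl hchr) (by positivity)

/-- The truncation error of the Fourier-Laplace series is `o(N ^ (-2k))`: the remainder is at most
`N ^ (-2k)` times a remainder of the absolutely convergent series of the iterated Laplacian. -/
lemma exists_norm_sum_harmProj_sub_le (hd : 1 ≤ d) (hB : IsHarmonicBasis d B)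
    (hk : d + 1 ≤ 4 * k) (hf : SphSmooth ((2 * k : ℕ) : WithTop ℕ∞) f)
    (habs : AbsConvFourierLaplace B (laplaceBeltrami^[k] f)) (x : Sph d) :
    ∃ r : ℕ → ℝ, Tendsto r atTop (𝓝 0) ∧ (∀ N, 0 ≤ r N) ∧ ∀ N : ℕ, 1 ≤ N →
      ‖∑ l ∈ Finset.range N, harmProj B (fun x => (f x : ℂ)) l x - f x‖ ≤
        ((N : ℝ) ^ (2 * k))⁻¹ * r N := by
  obtain ⟨b, hb, hfb⟩ := exists_summable_norm_harmProj_le hd hB hk hf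
  have hcf : Continuous fun x => (f x : ℂ) := Complex.continuous_ofReal.comp hf.continuous
  have hsum := hasSum_harmProj_of_summable hd hB hcf hb hfb x
  set v : ℕ → ℝ := fun l =>
    ∑ q, ‖fourierCoeff B (fun x => (laplaceBeltrami^[k] f x : ℂ)) l q * B l q x‖ with hv
  have hvs : Summable v := by simpa only [tsum_fintype] using (habs x).sigma
  have hv0 : ∀ l, 0 ≤ v l := fun l => Finset.sum_nonneg fun _ _ => norm_nonneg _
  refine ⟨fun N => ∑' l, v (l + N), tendsto_sum_nat_add v, fun N => tsum_nonneg fun l => hv0 _,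
    fun N hN => ?_⟩
  have hN0 : (0 : ℝ) < N := by exact_mod_cast hN
  rw [← hsum.tsum_eq, ← hsum.summable.sum_add_tsum_nat_add N, sub_add_cancel_left, norm_neg]
  refine tsum_of_norm_bounded (((summable_nat_add_iff N).2 hvs).hasSum.mul_left _) fun l => ?_
  rw [← div_eq_inv_mul, le_div_iff₀ (by positivity)]
  have hterm : ‖harmProj B (fun x => (f x : ℂ)) (l + N) x‖ * (N : ℝ) ^ (2 * k) ≤
      ∑ q, ‖fourierCoeff B (fun x => (f x : ℂ)) (l + N) q‖ * ‖B (l + N) q x‖ *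
        ((l + N : ℕ) : ℝ) ^ (2 * k) := by
    rw [← Finset.sum_mul]
    gcongr
    · exact (norm_sum_le _ _).trans (Finset.sum_le_sum fun q _ => (norm_mul _ _).le)
    · omega
  refine hterm.trans (Finset.sum_le_sum fun q _ => ?_)
  rw [norm_mul]
  have h := pow_mul_norm_fourierCoeff_le hd hB hf (l + N) q
  calc _ = ((l + N : ℕ) : ℝ) ^ (2 * k) * ‖fourierCoeff B (fun x => (f x : ℂ)) (l + N) q‖ *
        ‖B (l + N) q x‖ := by ring
    _ ≤ _ := by gcongr

end SmoothSeries

/-! ### The action of the rotation group -/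

section Rotations

variable {d : ℕ}

instance instSecondCountableTopologySO (d : ℕ) : SecondCountableTopology (SO d) := by
  have h : SecondCountableTopology (Matrix (Fin (d + 1)) (Fin (d + 1)) ℝ) :=
    inferInstanceAs (SecondCountableTopology (Fin (d + 1) → Fin (d + 1) → ℝ))
  exact TopologicalSpace.Subtype.secondCountableTopology _

instance instIsFiniteMeasureHaarSO (d : ℕ) : IsFiniteMeasure (haarSO d) := by
  unfold haarSO
  infer_instance

lemma continuous_rot (d : ℕ) : Continuous fun p : SO d × Sph d => rot p.1 p.2 := by
  refine Continuous.subtype_mk ?_ _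
  refine (PiLp.continuous_toLp 2 _).comp ?_
  exact (continuous_subtype_val.comp continuous_fst).matrix_mulVec
    ((PiLp.continuous_ofLp 2 _).comp (continuous_subtype_val.comp continuous_snd))

lemma exists_isoSph_eq_rot (u : SO d) : ∃ L : Eu d ≃ₗᵢ[ℝ] Eu d, ∀ x, isoSph L x = rot u x := by
  let A : Eu d →ₗ[ℝ] Eu d := Matrix.toLpLin 2 2 (u : Matrix (Fin (d + 1)) (Fin (d + 1)) ℝ)
  have hA : ∀ x : Sph d, A x = rot u x := fun x => rfl
  have hnorm : ∀ v, ‖A v‖ = ‖v‖ := fun v => by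
    by_cases hv : v = 0
    · rw [hv, map_zero]
    · have hv' := norm_ne_zero_iff.2 hv
      have hmem : ‖v‖⁻¹ • v ∈ Metric.sphere (0 : Eu d) 1 := by
        rw [mem_sphere_zero_iff_norm, norm_smul, norm_inv, norm_norm, inv_mul_cancel₀ hv']
      have h1 : ‖A (‖v‖⁻¹ • v)‖ = 1 := by
        rw [hA ⟨_, hmem⟩, Sph.norm_coe]
      rw [map_smul, norm_smul, norm_inv, norm_norm, inv_mul_eq_one₀ hv'] at h1
      exact h1.symm
  exact ⟨LinearIsometry.toLinearIsometryEquiv ⟨A, hnorm⟩ rfl, fun x => Subtype.ext rfl⟩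

/-- The law of a rotated random point, for an independent rotation, tested against a continuous
function. -/
lemma integral_comp_rot {Ω : Type*} [MeasurableSpace Ω] {P : Measure Ω} [IsProbabilityMeasure P]
    {X : Ω → Sph d} (hX : Measurable X) {U : Ω → SO d} (hU : Measurable U)
    (hXU : IndepFun U X P) {fX : Sph d → ℝ} (hfX_cont : Continuous fX)
    (hfX_nonneg : ∀ x, 0 ≤ fX x)
    (hfX : P.map X = (surf d).withDensity fun x => ENNReal.ofReal (fX x))
    {fU : SO d → ℝ} (hfU_meas : AEMeasurable fU (haarSO d)) (hfU_nonneg : ∀ u, 0 ≤ fU u)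
    (hfU : P.map U = (haarSO d).withDensity fun u => ENNReal.ofReal (fU u))
    {F : Sph d → ℂ} (hF : Continuous F) :
    ∫ ω, F (rot (U ω) (X ω)) ∂P =
      ∫ u, (fU u : ℂ) * ∫ x, (fX x : ℂ) * F (rot u x) ∂(surf d) ∂(haarSO d) := by
  have hc : Continuous fun p : SO d × Sph d => F (rot p.1 p.2) := hF.comp (continuous_rot d)
  have hPU : IsProbabilityMeasure (P.map U) := Measure.isProbabilityMeasure_map hU.aemeasurable
  have hPX : IsProbabilityMeasure (P.map X) := Measure.isProbabilityMeasure_map hX.aemeasurable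
  have h1 : ∫ ω, F (rot (U ω) (X ω)) ∂P =
      ∫ p, F (rot p.1 p.2) ∂((P.map U).prod (P.map X)) := by
    rw [← (indepFun_iff_map_prod_eq_prod_map_map hU.aemeasurable hX.aemeasurable).1 hXU,
      integral_map (hU.prodMk hX).aemeasurable hc.aestronglyMeasurable]
  obtain ⟨K, hK⟩ := (isCompact_univ (X := Sph d)).exists_bound_of_continuousOn hF.continuousOn
  rw [h1, integral_prod _ (Integrable.of_bound hc.aestronglyMeasurable K
    (Eventually.of_forall fun p => hK _ (Set.mem_univ _))), hfU, hfX,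
    integral_withDensity_eq_integral_toReal_smul₀ hfU_meas.ennreal_ofReal
      (Eventually.of_forall fun _ => ENNReal.ofReal_lt_top)]
  refine integral_congr_ae (Eventually.of_forall fun u => ?_)
  simp only
  rw [integral_withDensity_eq_integral_toReal_smul₀ hfX_cont.aemeasurable.ennreal_ofReal
      (Eventually.of_forall fun _ => ENNReal.ofReal_lt_top),
    ENNReal.toReal_ofReal (hfU_nonneg u), Complex.real_smul]
  congr 1
  refine integral_congr_ae (Eventually.of_forall fun x => ?_)
  simp only
  rw [ENNReal.toReal_ofReal (hfX_nonneg x), Complex.real_smul]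

end Rotations

/-! ### The deconvolution kernel -/

section Kernel

variable {d : ℕ} {B : (l : ℕ) → Fin (harmDim d l) → Sph d → ℂ}

/-- The matrix coefficients of the representation of the rotation group on spherical harmonics
are continuous. -/
lemma continuous_integral_conj_rot (hB : IsHarmonicBasis d B) (l : ℕ) (q r : Fin (harmDim d l)) :
    Continuous fun u : SO d =>
      ∫ x, starRingEnd ℂ (B l q (rot u x)) * B l r x ∂(surf d) := by
  have h := continuous_parametric_integral_of_continuous (μ := surf d) (s := Set.univ)
    (f := fun (u : SO d) x => starRingEnd ℂ (B l q (rot u x)) * B l r x)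
    ((Complex.continuous_conj.comp ((hB.continuous l q).comp (continuous_rot d))).mul
      ((hB.continuous l r).comp continuous_snd)) isCompact_univ
  simpa only [Measure.restrict_univ] using h

/-- The convolution theorem: the rotational Fourier transform of the law of the rotation maps the
Fourier coefficients of the law of `X` to those of the rotated point. -/
lemma integral_conj_basis_rot (hB : IsHarmonicBasis d B)
    {Ω : Type*} [MeasurableSpace Ω] {P : Measure Ω} [IsProbabilityMeasure P]
    {X : Ω → Sph d} (hX : Measurable X) {U : Ω → SO d} (hU : Measurable U)
    (hXU : IndepFun U X P) {fX : Sph d → ℝ} (hfX_cont : Continuous fX)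
    (hfX_nonneg : ∀ x, 0 ≤ fX x)
    (hfX : P.map X = (surf d).withDensity fun x => ENNReal.ofReal (fX x))
    {fU : SO d → ℝ} (hfU_int : Integrable fU (haarSO d)) (hfU_nonneg : ∀ u, 0 ≤ fU u)
    (hfU : P.map U = (haarSO d).withDensity fun u => ENNReal.ofReal (fU u))
    (l : ℕ) (r : Fin (harmDim d l)) :
    ∫ ω, starRingEnd ℂ (B l r (rot (U ω) (X ω))) ∂P =
      ∑ q, rotFourier B fU l r q * fourierCoeff B (fun x => (fX x : ℂ)) l q := by
  rw [integral_comp_rot hX hU hXU hfX_cont hfX_nonneg hfX hfU_int.aestronglyMeasurable.aemeasurable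
    hfU_nonneg hfU (F := fun x => starRingEnd ℂ (B l r x))
    (Complex.continuous_conj.comp (hB.continuous l r))]
  have hinner : ∀ u : SO d, ∫ x, (fX x : ℂ) * starRingEnd ℂ (B l r (rot u x)) ∂(surf d) =
      ∑ q, fourierCoeff B (fun x => (fX x : ℂ)) l q *
        ∫ x, starRingEnd ℂ (B l r (rot u x)) * B l q x ∂(surf d) := fun u => by
    obtain ⟨L, hL⟩ := exists_isoSph_eq_rot u
    have hmem := comp_isoSph_mem_sphHarm L (hB.mem l r)
    have h := hB.integral_mul_conj (Complex.continuous_ofReal.comp hfX_cont) hmem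
    simp only [Function.comp_apply, hL] at h
    rw [h]
    refine Finset.sum_congr rfl fun q _ => ?_
    rw [fourierCoeff, fourierCoeff, ← integral_conj]
    congr 1
    refine integral_congr_ae (Eventually.of_forall fun x => ?_)
    simp only [Function.comp_apply, map_mul, Complex.conj_conj, hL]
  have hint : ∀ q, Integrable (fun u : SO d => (fU u : ℂ) *
      ∫ x, starRingEnd ℂ (B l r (rot u x)) * B l q x ∂(surf d)) (haarSO d) := fun q => by
    have hc := continuous_integral_conj_rot hB l r q
    obtain ⟨K, hK⟩ := (isCompact_univ (X := SO d)).exists_bound_of_continuousOn hc.continuousOn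
    exact hfU_int.ofReal.mul_bdd (c := K) hc.aestronglyMeasurable
      (Eventually.of_forall fun u => hK u (Set.mem_univ u))
  have hsum : ∀ u : SO d, (fU u : ℂ) * ∑ q, fourierCoeff B (fun x => (fX x : ℂ)) l q *
        ∫ x, starRingEnd ℂ (B l r (rot u x)) * B l q x ∂(surf d) =
      ∑ q, fourierCoeff B (fun x => (fX x : ℂ)) l q * ((fU u : ℂ) *
        ∫ x, starRingEnd ℂ (B l r (rot u x)) * B l q x ∂(surf d)) := fun u => by
    rw [Finset.mul_sum]
    exact Finset.sum_congr rfl fun q _ => by ring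
  simp_rw [hinner, hsum]
  rw [integral_finsetSum _ fun q _ => (hint q).const_mul _]
  refine Finset.sum_congr rfl fun q _ => ?_
  rw [integral_const_mul, mul_comm]
  rfl

lemma continuous_kern (hB : IsHarmonicBasis d B) (fU : SO d → ℝ) (T : ℝ) (x : Sph d) :
    Continuous fun z => kern B fU T x z := by
  unfold kern
  refine continuous_finsetSum _ fun l _ => continuous_finsetSum _ fun q _ =>
    (continuous_finsetSum _ fun r _ => ?_).mul continuous_const
  exact continuous_const.mul (Complex.continuous_conj.comp (hB.continuous l r))

/-- The kernel undoes the rotation: its mean is the truncated Fourier-Laplace series of the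
density of the unrotated point. -/
lemma integral_kern_rot (hB : IsHarmonicBasis d B)
    {Ω : Type*} [MeasurableSpace Ω] {P : Measure Ω} [IsProbabilityMeasure P]
    {X : Ω → Sph d} (hX : Measurable X) {U : Ω → SO d} (hU : Measurable U)
    (hXU : IndepFun U X P) {fX : Sph d → ℝ} (hfX_cont : Continuous fX)
    (hfX_nonneg : ∀ x, 0 ≤ fX x)
    (hfX : P.map X = (surf d).withDensity fun x => ENNReal.ofReal (fX x))
    {fU : SO d → ℝ} (hfU_int : Integrable fU (haarSO d)) (hfU_nonneg : ∀ u, 0 ≤ fU u)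
    (hfU : P.map U = (haarSO d).withDensity fun u => ENNReal.ofReal (fU u))
    (hfU_inv : ∀ l, IsUnit (rotFourier B fU l)) (T : ℝ) (x : Sph d) :
    ∫ ω, kern B fU T x (rot (U ω) (X ω)) ∂P =
      ∑ l ∈ Finset.range (⌊T⌋₊ + 1), harmProj B (fun y => (fX y : ℂ)) l x := by
  have hV : Measurable fun ω => rot (U ω) (X ω) :=
    (continuous_rot d).measurable.comp (hU.prodMk hX)
  have hint : ∀ l r, Integrable (fun ω => starRingEnd ℂ (B l r (rot (U ω) (X ω)))) P :=
    fun l r => by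
      have hc := Complex.continuous_conj.comp (hB.continuous l r)
      obtain ⟨K, hK⟩ := (isCompact_univ (X := Sph d)).exists_bound_of_continuousOn
        hc.continuousOn
      exact Integrable.of_bound (hc.measurable.comp hV).aestronglyMeasurable K
        (Eventually.of_forall fun ω => hK _ (Set.mem_univ _))
  have hint2 : ∀ l q, Integrable (fun ω => (∑ r, (rotFourier B fU l)⁻¹ q r *
      starRingEnd ℂ (B l r (rot (U ω) (X ω)))) * B l q x) P := fun l q =>
    (integrable_finsetSum _ fun r _ => (hint l r).const_mul _).mul_const _
  unfold kern
  rw [integral_finsetSum _ fun l _ => integrable_finsetSum _ fun q _ => hint2 l q]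
  refine Finset.sum_congr rfl fun l _ => ?_
  rw [integral_finsetSum _ fun q _ => hint2 l q, harmProj]
  refine Finset.sum_congr rfl fun q _ => ?_
  rw [integral_mul_const, integral_finsetSum _ fun r _ => (hint l r).const_mul _]
  congr 1
  simp_rw [integral_const_mul, integral_conj_basis_rot hB hX hU hXU hfX_cont hfX_nonneg hfX
    hfU_int hfU_nonneg hfU]
  have h : (rotFourier B fU l)⁻¹.mulVec ((rotFourier B fU l).mulVec
      fun q => fourierCoeff B (fun x => (fX x : ℂ)) l q) =
      fun q => fourierCoeff B (fun x => (fX x : ℂ)) l q := by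
    rw [Matrix.mulVec_mulVec, Matrix.nonsing_inv_mul _
      ((Matrix.isUnit_iff_isUnit_det _).1 (hfU_inv l)), Matrix.one_mulVec]
  exact congrFun h q

/-- The Cauchy-Schwarz inequality for a sesquilinear form. -/
lemma norm_sum_mulVec_mul_le {m : ℕ} (A : Matrix (Fin m) (Fin m) ℂ) (b v : Fin m → ℂ) :
    ‖∑ q, (∑ r, A q r * starRingEnd ℂ (b r)) * v q‖ ≤
      opNorm A * (√(∑ q, ‖b q‖ ^ 2) * √(∑ q, ‖v q‖ ^ 2)) := by
  set b' : EuclideanSpace ℂ (Fin m) := WithLp.toLp 2 (star b) with hb'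
  set v' : EuclideanSpace ℂ (Fin m) := WithLp.toLp 2 (star v) with hv'
  have hnb : ‖b'‖ = √(∑ q, ‖b q‖ ^ 2) := by simp [EuclideanSpace.norm_eq, hb']
  have hnv : ‖v'‖ = √(∑ q, ‖v q‖ ^ 2) := by simp [EuclideanSpace.norm_eq, hv']
  have h : ∑ q, (∑ r, A q r * starRingEnd ℂ (b r)) * v q =
      inner ℂ v' (Matrix.toEuclideanCLM (𝕜 := ℂ) A b') := by
    rw [hb', Matrix.toEuclideanCLM_toLp, hv', EuclideanSpace.inner_toLp_toLp, dotProduct]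
    simp [Matrix.mulVec, dotProduct]
  rw [h, ← hnb, ← hnv]
  calc ‖inner ℂ v' (Matrix.toEuclideanCLM (𝕜 := ℂ) A b')‖
      ≤ ‖v'‖ * ‖Matrix.toEuclideanCLM (𝕜 := ℂ) A b'‖ := norm_inner_le_norm _ _
    _ ≤ ‖v'‖ * (opNorm A * ‖b'‖) := by
      gcongr
      exact ContinuousLinearMap.le_opNorm _ _
    _ = _ := by ring

/-- Uniform bound for the kernel: the inverse of the rotational Fourier transform contributes
`l ^ β`, the Christoffel function `l ^ (d - 1)` and the sum over the degrees one more power. -/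
lemma exists_norm_kern_le (hd : 1 ≤ d) (hB : IsHarmonicBasis d B) {fU : SO d → ℝ} {β : ℝ}
    (hβ : 0 ≤ β)
    (hS1 : ∃ c₁ : ℝ, 0 < c₁ ∧ ∀ l : ℕ, 1 ≤ l → opNorm (rotFourier B fU l)⁻¹ ≤ c₁ * (l : ℝ) ^ β) :
    ∃ C : ℝ, 0 < C ∧ ∀ T : ℝ, 1 ≤ T → ∀ x z, ‖kern B fU T x z‖ ≤ C * T ^ (β + d) := by
  obtain ⟨c₁, hc₁, hop⟩ := hS1
  obtain ⟨C, hC, hCx⟩ := exists_christoffel_le hd hB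
  -- the smoothness assumption says nothing about degree zero
  set a := opNorm (rotFourier B fU 0)⁻¹ with ha
  have ha0 : 0 ≤ a := norm_nonneg _
  have hop' : ∀ l : ℕ, opNorm (rotFourier B fU l)⁻¹ ≤ (a + c₁) * ((l : ℝ) + 1) ^ β := fun l => by
    rcases Nat.eq_zero_or_pos l with rfl | hl
    · rw [Nat.cast_zero, zero_add, Real.one_rpow, mul_one]
      linarith
    · refine (hop l hl).trans ?_
      gcongr <;> linarith
  refine ⟨(a + c₁) * C * 2 ^ (β + d), by positivity, fun T hT x z => ?_⟩
  set N : ℕ := ⌊T⌋₊ + 1 with hN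
  have hNT : (N : ℝ) ≤ 2 * T := by
    have := Nat.floor_le (zero_le_one.trans hT)
    rw [hN]
    push_cast
    linarith
  have hN0 : (0 : ℝ) < N := by rw [hN]; positivity
  have hterm : ∀ l ∈ Finset.range N, ‖∑ q, (∑ r, (rotFourier B fU l)⁻¹ q r *
      starRingEnd ℂ (B l r z)) * B l q x‖ ≤ (a + c₁) * C * (N : ℝ) ^ (β + d - 1) := by
    intro l hl
    have hlN : (l : ℝ) + 1 ≤ N := by exact_mod_cast Finset.mem_range.1 hl
    have hl1 : (0 : ℝ) < (l : ℝ) + 1 := by positivity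
    refine (norm_sum_mulVec_mul_le _ _ _).trans ?_
    have hsq : √(∑ q, ‖B l q z‖ ^ 2) * √(∑ q, ‖B l q x‖ ^ 2) ≤ C * ((l : ℝ) + 1) ^ (d - 1) := by
      have hz := Real.sqrt_le_sqrt (hCx l z)
      have hx := Real.sqrt_le_sqrt (hCx l x)
      refine (mul_le_mul hz hx (Real.sqrt_nonneg _) (Real.sqrt_nonneg _)).trans_eq ?_
      exact Real.mul_self_sqrt (by positivity)
    calc opNorm (rotFourier B fU l)⁻¹ * (√(∑ q, ‖B l q z‖ ^ 2) * √(∑ q, ‖B l q x‖ ^ 2))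
        ≤ ((a + c₁) * ((l : ℝ) + 1) ^ β) * (C * ((l : ℝ) + 1) ^ (d - 1)) := by
          refine mul_le_mul (hop' l) hsq (by positivity) (by positivity)
      _ = (a + c₁) * C * ((l : ℝ) + 1) ^ (β + d - 1) := by
          rw [← Real.rpow_natCast ((l : ℝ) + 1) (d - 1), Nat.cast_sub hd, add_sub_assoc,
            Real.rpow_add hl1]
          push_cast
          ring
      _ ≤ (a + c₁) * C * (N : ℝ) ^ (β + d - 1) := by
          have : (1 : ℝ) ≤ d := by exact_mod_cast hd
          gcongr
          linarith
  calc ‖kern B fU T x z‖ ≤ ∑ l ∈ Finset.range N, (a + c₁) * C * (N : ℝ) ^ (β + d - 1) :=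
        (norm_sum_le _ _).trans (Finset.sum_le_sum hterm)
    _ = (a + c₁) * C * (N : ℝ) ^ (β + d) := by
        rw [Finset.sum_const, Finset.card_range, nsmul_eq_mul, Real.rpow_sub_one hN0.ne']
        field_simp
    _ ≤ (a + c₁) * C * (2 * T) ^ (β + d) := by gcongr
    _ = _ := by rw [Real.mul_rpow (by norm_num) (by linarith)]; ring

end Kernel

/-! ### Self-normalization and the rate conditions -/

section Rates

/-- Wilks' theorem for triangular arrays in self-normalized form: `A n` bounds the squares of the
summands, `L n` is a lower bound for their second moments. -/
theorem tendstoInDistribution_negTwoLog_elRatio_of_bounds {Ω S : Type*} [MeasurableSpace Ω]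
    [MeasurableSpace S] {P : Measure Ω} [IsProbabilityMeasure P] {Z : ℕ → Ω → S} {V : Ω → S}
    (hind : iIndepFun Z P) (hlaw : ∀ i, IdentDistrib (Z i) V P P) {h : ℕ → S → ℝ}
    (hh : ∀ n, Measurable (h n)) {A L : ℕ → ℝ}
    (hL : ∀ᶠ n in atTop, 0 < L n ∧ L n ≤ ∫ ω, h n (V ω) ^ 2 ∂P)
    (hA : ∀ᶠ n in atTop, ∀ z, h n z ^ 2 ≤ A n)
    (hAL : Tendsto (fun n : ℕ => A n / (n * L n)) atTop (𝓝 0))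
    (hm : Tendsto (fun n : ℕ => n * (∫ ω, h n (V ω) ∂P) ^ 2 / L n) atTop (𝓝 0))
    (hpos : Tendsto (fun n : ℕ => P.real {ω | 0 < elRatio n fun i => h n (Z i ω)}) atTop (𝓝 1)) :
    TendstoInDistribution (fun n ω => negTwoLog (elRatio n fun i => h n (Z i ω)))
      atTop (fun t : ℝ => (t : EReal)) (fun _ => P) chiSqOne := by
  set s : ℕ → ℝ := fun n => n * ∫ ω, h n (V ω) ^ 2 ∂P with hs
  -- the value `1` keeps the factor nonzero for the finitely many `n` where `s n` may vanish
  set c : ℕ → ℝ := fun n => if s n = 0 then 1 else (√(s n))⁻¹ with hc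
  have hs0 : ∀ n, 0 ≤ s n := fun n =>
    mul_nonneg n.cast_nonneg (integral_nonneg fun _ => sq_nonneg _)
  have hc0 : ∀ n, c n ≠ 0 := fun n => by
    by_cases h0 : s n = 0
    · simp [hc, h0]
    · simp [hc, h0, Real.sqrt_eq_zero (hs0 n)]
  have hcs : ∀ n, s n ≠ 0 → c n ^ 2 = (s n)⁻¹ := fun n h0 => by
    simp only [hc, h0, if_false, inv_pow, Real.sq_sqrt (hs0 n)]
  have hev : ∀ᶠ n : ℕ in atTop, 0 < (n : ℝ) ∧ 0 < L n ∧ n * L n ≤ s n ∧ s n ≠ 0 := by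
    filter_upwards [hL, eventually_gt_atTop 0] with n hn hn0
    have hn0' : (0 : ℝ) < n := by exact_mod_cast hn0
    have h1 : n * L n ≤ s n := by
      simp only [hs]
      gcongr
      exact hn.2
    exact ⟨hn0', hn.1, h1, ((mul_pos hn0' hn.1).trans_le h1).ne'⟩
  have hel : ∀ n ω, (elRatio n fun i => c n * h n (Z i ω)) = elRatio n fun i => h n (Z i ω) :=
    fun n ω => elRatio_const_mul (hc0 n) fun i => h n (Z i ω)
  have key := tendstoInDistribution_negTwoLog_elRatio hind hlaw (g := fun n z => c n * h n z)
    (ε := fun n => √(A n / (n * L n))) (fun n => (hh n).const_mul _) ?_ ?_ ?_ ?_ ?_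
  · simpa only [hel] using key
  · filter_upwards [hev, hA] with n ⟨hn, hLn, hle, hne⟩ hAn z
    refine Real.abs_le_sqrt ?_
    rw [mul_pow, hcs n hne, ← div_eq_inv_mul]
    have := mul_pos hn hLn
    gcongr
    · exact (sq_nonneg _).trans (hAn z)
    · exact hAn z
  · simpa using hAL.sqrt
  · refine squeeze_zero_norm' (a := fun n : ℕ => √(n * (∫ ω, h n (V ω) ∂P) ^ 2 / L n)) ?_
      (by simpa using hm.sqrt)
    filter_upwards [hev] with n ⟨hn, hLn, hle, hne⟩
    rw [Real.norm_eq_abs]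
    refine Real.abs_le_sqrt ?_
    rw [integral_const_mul, mul_pow, mul_pow, hcs n hne, ← div_eq_inv_mul, ← mul_div_assoc,
      div_le_div_iff₀ ((hs0 n).lt_of_ne' hne) hLn]
    calc (n : ℝ) ^ 2 * (∫ ω, h n (V ω) ∂P) ^ 2 * L n
        = n * (∫ ω, h n (V ω) ∂P) ^ 2 * (n * L n) := by ring
      _ ≤ n * (∫ ω, h n (V ω) ∂P) ^ 2 * s n := by gcongr
  · refine tendsto_const_nhds.congr' ?_
    filter_upwards [hev] with n ⟨hn, hLn, hle, hne⟩
    simp_rw [mul_pow]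
    rw [integral_const_mul, hcs n hne]
    rw [mul_left_comm]
    exact (inv_mul_cancel₀ hne).symm
  · simpa only [hel] using hpos

variable {T : ℕ → ℝ} {D c C : ℝ}

lemma tendsto_atTop_of_rpow_le (hD : 0 < D) (hc : 0 < c)
    (hT : ∀ n : ℕ, 1 ≤ n → c * (n : ℝ) ^ (1 / D) ≤ T n) : Tendsto T atTop atTop := by
  refine tendsto_atTop_mono' atTop ?_
    (((tendsto_rpow_atTop (one_div_pos.2 hD)).comp tendsto_natCast_atTop_atTop).const_mul_atTop hc)
  filter_upwards [eventually_ge_atTop 1] with n hn using hT n hn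

lemma natCast_le_of_rpow_le (hD : 0 < D) (hc : 0 < c) {n : ℕ} {t : ℝ}
    (hT : c * (n : ℝ) ^ (1 / D) ≤ t) : (n : ℝ) ≤ (c ^ D)⁻¹ * t ^ D := by
  have h := Real.rpow_le_rpow (by positivity) hT hD.le
  rw [Real.mul_rpow hc.le (by positivity), ← Real.rpow_mul n.cast_nonneg,
    one_div_mul_cancel hD.ne', Real.rpow_one] at h
  rw [← div_eq_inv_mul, le_div_iff₀ (by positivity), mul_comm]
  exact h

lemma tendsto_rpow_div_natCast {e : ℝ} (he : 0 ≤ e) (heD : e < D) (hC : 0 < C)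
    (hT0 : ∀ n : ℕ, 1 ≤ n → 0 < T n) (hT : ∀ n : ℕ, 1 ≤ n → T n ≤ C * (n : ℝ) ^ (1 / D)) :
    Tendsto (fun n : ℕ => T n ^ e / n) atTop (𝓝 0) := by
  have hD : 0 < D := he.trans_lt heD
  have hlim : Tendsto (fun n : ℕ => C ^ e * (n : ℝ) ^ (-(1 - e / D))) atTop (𝓝 0) := by
    have hp : 0 < 1 - e / D := by rw [sub_pos, div_lt_one hD]; exact heD
    simpa using ((tendsto_rpow_neg_atTop hp).comp tendsto_natCast_atTop_atTop).const_mul (C ^ e)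
  refine squeeze_zero' ?_ ?_ hlim
  · filter_upwards [eventually_ge_atTop 1] with n hn
    have := hT0 n hn
    positivity
  · filter_upwards [eventually_ge_atTop 1] with n hn
    have hn0 : (0 : ℝ) < n := by exact_mod_cast hn
    have h := Real.rpow_le_rpow (hT0 n hn).le (hT n hn) he
    rw [Real.mul_rpow hC.le (by positivity), ← Real.rpow_mul hn0.le] at h
    rw [div_le_iff₀ hn0]
    refine h.trans_eq ?_
    rw [mul_assoc, ← Real.rpow_add_one hn0.ne']
    congr 2
    ring

end Rates

/-! ### The empirical likelihood ratio of the density -/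

section Density

/-- The limit distribution of the empirical likelihood ratio at the true value of the density. The
second moment of the kernel is at least of order `T ^ (2β + d)`, its square is bounded by a multiple
of `T ^ (2β + 2d)` with `T ^ d = o(n)`, and its bias is `o(T ^ (-2k))`, which is negligible since
`n` is of order `T ^ (4k + 2β + d)`. -/
theorem tendstoInDistribution_negTwoLog_elDensity {d : ℕ} (hd : 1 ≤ d)
    {B : (l : ℕ) → Fin (harmDim d l) → Sph d → ℂ} (hB : IsHarmonicBasis d B)
    {Ω : Type*} [MeasurableSpace Ω] {P : Measure Ω} [IsProbabilityMeasure P]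
    {X : Ω → Sph d} (hX : Measurable X) {U : Ω → SO d} (hU : Measurable U)
    (hXU : IndepFun U X P) {Z : ℕ → Ω → Sph d} (hZ_indep : iIndepFun Z P)
    (hZ_law : ∀ i, IdentDistrib (Z i) (fun ω => rot (U ω) (X ω)) P P)
    {fX : Sph d → ℝ} (hfX_nonneg : ∀ x, 0 ≤ fX x)
    (hfX : P.map X = (surf d).withDensity fun x => ENNReal.ofReal (fX x))
    {fU : SO d → ℝ} (hfU_nonneg : ∀ u, 0 ≤ fU u) (hfU_int : Integrable fU (haarSO d))
    (hfU : P.map U = (haarSO d).withDensity fun u => ENNReal.ofReal (fU u))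
    (hfU_inv : ∀ l, IsUnit (rotFourier B fU l))
    {β : ℝ} (hβ : 0 ≤ β)
    (hS1 : ∃ c₁ : ℝ, 0 < c₁ ∧ ∀ l : ℕ, 1 ≤ l → opNorm (rotFourier B fU l)⁻¹ ≤ c₁ * (l : ℝ) ^ β)
    {k : ℕ} (hk : d + 1 ≤ 4 * k) (hsm : SphSmooth ((2 * k : ℕ) : WithTop ℕ∞) fX)
    {T : ℕ → ℝ} (hT_pos : ∀ n, 1 ≤ n → 0 < T n)
    (hT : ∃ c C : ℝ, 0 < c ∧ 0 < C ∧ ∀ n : ℕ, 1 ≤ n →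
      c * (n : ℝ) ^ (1 / (4 * k + 2 * β + d)) ≤ T n ∧
      T n ≤ C * (n : ℝ) ^ (1 / (4 * k + 2 * β + d)))
    (hAbs : AbsConvFourierLaplace B (laplaceBeltrami^[k] fX)) (x : Sph d)
    (hE1 : Tendsto (fun n : ℕ =>
      P.real {ω | 0 < elDensity B fU (T n) n (fun i => Z i ω) (fX x) x}) atTop (𝓝 1))
    (hB1 : ∃ c : ℝ, 0 < c ∧ ∀ n : ℕ, 1 ≤ n →
      c * T n ^ (2 * β + d) ≤ ∫ ω, (kern B fU (T n) x (rot (U ω) (X ω))).re ^ 2 ∂P) :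
    TendstoInDistribution
      (fun (n : ℕ) ω => negTwoLog (elDensity B fU (T n) n (fun i => Z i ω) (fX x) x))
      atTop (fun t : ℝ => (t : EReal)) (fun _ => P) chiSqOne := by
  obtain ⟨c, C, hc, hC, hTn⟩ := hT
  obtain ⟨b, hb, hmom⟩ := hB1
  obtain ⟨K, hK, hKb⟩ := exists_norm_kern_le (fU := fU) hd hB hβ hS1
  obtain ⟨r, hr, hr0, hbias⟩ := exists_norm_sum_harmProj_sub_le hd hB hk hsm hAbs x
  set θ := fX x with hθ
  set D : ℝ := 4 * k + 2 * β + d with hDdef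
  have hd0 : (1 : ℝ) ≤ d := by exact_mod_cast hd
  have hk0 : (0 : ℝ) < k := by exact_mod_cast (by omega : 0 < k)
  have hD : 0 < D := by positivity
  have hTtop : Tendsto T atTop atTop := tendsto_atTop_of_rpow_le hD hc fun n hn => (hTn n hn).1
  have hTd : Tendsto (fun n : ℕ => T n ^ (d : ℝ) / n) atTop (𝓝 0) :=
    tendsto_rpow_div_natCast (by positivity) (by rw [hDdef]; linarith) hC hT_pos
      fun n hn => (hTn n hn).2
  have hρ : Tendsto (fun n => r (⌊T n⌋₊ + 1)) atTop (𝓝 0) :=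
    hr.comp ((tendsto_add_atTop_nat 1).comp (tendsto_nat_floor_atTop.comp hTtop))
  set V : Ω → Sph d := fun ω => rot (U ω) (X ω) with hVdef
  have hV : Measurable V := (continuous_rot d).measurable.comp (hU.prodMk hX)
  set κ : ℕ → Sph d → ℝ := fun n z => (kern B fU (T n) x z).re with hκ
  have hκc : ∀ n, Continuous (κ n) := fun n =>
    Complex.continuous_re.comp (continuous_kern hB fU (T n) x)
  have hint : ∀ {F : Sph d → ℝ}, Continuous F → Integrable (fun ω => F (V ω)) P := fun {F} hF => by
    obtain ⟨M, hM⟩ := (isCompact_univ (X := Sph d)).exists_bound_of_continuousOn hF.continuousOn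
    exact integrable_comp_of_bounded hV.aemeasurable hF.measurable fun z => hM z (Set.mem_univ z)
  set m : ℕ → ℝ := fun n => ∫ ω, κ n (V ω) ∂P with hmdef
  -- the bias of the truncated series
  have hmbias : ∀ n : ℕ, 1 ≤ n → |m n - θ| ≤ (T n ^ (2 * k))⁻¹ * r (⌊T n⌋₊ + 1) := fun n hn => by
    have hkint : Integrable (fun ω => kern B fU (T n) x (V ω)) P := by
      have hkc := continuous_kern hB fU (T n) x
      obtain ⟨M, hM⟩ := (isCompact_univ (X := Sph d)).exists_bound_of_continuousOn hkc.continuousOn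
      exact Integrable.of_bound (hkc.measurable.comp hV).aestronglyMeasurable M
        (Eventually.of_forall fun ω => hM _ (Set.mem_univ _))
    have hre : m n = (∫ ω, kern B fU (T n) x (V ω) ∂P).re :=
      Complex.reCLM.integral_comp_comm hkint
    have hfl : T n ≤ ((⌊T n⌋₊ + 1 : ℕ) : ℝ) := by
      push_cast
      exact (Nat.lt_floor_add_one _).le
    have h1 := hbias (⌊T n⌋₊ + 1) (by omega)
    rw [← integral_kern_rot hB hX hU hXU hsm.continuous hfX_nonneg hfX hfU_int hfU_nonneg hfU
      hfU_inv] at h1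
    have hTp := hT_pos n hn
    calc |m n - θ| = |(∫ ω, kern B fU (T n) x (V ω) ∂P - (θ : ℂ)).re| := by
          rw [hre, Complex.sub_re, Complex.ofReal_re]
      _ ≤ _ := (Complex.abs_re_le_norm _).trans h1
      _ ≤ _ := by
        refine mul_le_mul_of_nonneg_right ?_ (hr0 _)
        gcongr
  have hmlim : Tendsto m atTop (𝓝 θ) := by
    rw [tendsto_iff_norm_sub_tendsto_zero]
    refine squeeze_zero' (Eventually.of_forall fun n => norm_nonneg _) ?_ hρ
    filter_upwards [eventually_ge_atTop 1, hTtop.eventually_ge_atTop 1] with n hn hT1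
    refine (hmbias n hn).trans (mul_le_of_le_one_left (hr0 _) ?_)
    exact inv_le_one_of_one_le₀ (one_le_pow₀ hT1)
  have hvar : ∀ n, ∫ ω, (κ n (V ω) - θ) ^ 2 ∂P =
      ∫ ω, κ n (V ω) ^ 2 ∂P + (m n - θ) ^ 2 - m n ^ 2 := fun n => by
    have e : ∀ ω, (κ n (V ω) - θ) ^ 2 = κ n (V ω) ^ 2 - 2 * θ * κ n (V ω) + θ ^ 2 :=
      fun ω => by ring
    have i1 : Integrable (fun ω => κ n (V ω) ^ 2) P := hint ((hκc n).pow 2)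
    have i2 : Integrable (fun ω => 2 * θ * κ n (V ω)) P := (hint (hκc n)).const_mul _
    have i3 : Integrable (fun ω => κ n (V ω) ^ 2 - 2 * θ * κ n (V ω)) P := i1.sub i2
    simp_rw [e]
    rw [integral_add i3 (integrable_const _), integral_sub i1 i2, integral_const_mul,
      integral_const, probReal_univ, one_smul]
    simp only [hmdef]
    ring
  refine tendstoInDistribution_negTwoLog_elRatio_of_bounds hZ_indep hZ_law
    (h := fun n z => κ n z - θ) (A := fun n => ((K + |θ|) * T n ^ (β + d)) ^ 2)
    (L := fun n => b / 2 * T n ^ (2 * β + d)) (fun n => ((hκc n).sub continuous_const).measurable)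
    ?_ ?_ ?_ ?_ hE1
  · -- the second moment dominates the squared mean, which stays bounded
    have hbig : ∀ᶠ n in atTop, θ ^ 2 + 1 ≤ b / 2 * T n ^ (2 * β + d) :=
      (((tendsto_rpow_atTop (by positivity)).comp hTtop).const_mul_atTop
        (half_pos hb)).eventually_ge_atTop _
    have hmsq : ∀ᶠ n in atTop, m n ^ 2 < θ ^ 2 + 1 :=
      (hmlim.pow 2).eventually_lt_const (lt_add_one _)
    filter_upwards [hbig, hmsq, eventually_ge_atTop 1] with n h1 h2 hn
    have hTp := hT_pos n hn
    refine ⟨by positivity, ?_⟩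
    rw [hvar n]
    have h3 := hmom n hn
    have h4 := sq_nonneg (m n - θ)
    simp only [hκ]
    linarith
  · filter_upwards [hTtop.eventually_ge_atTop 1] with n hT1 z
    rw [← sq_abs]
    have h1 : (1 : ℝ) ≤ T n ^ (β + d) := Real.one_le_rpow hT1 (by positivity)
    have h2 : |κ n z| ≤ K * T n ^ (β + d) := (Complex.abs_re_le_norm _).trans (hKb _ hT1 x z)
    have h3 : |κ n z - θ| ≤ |κ n z| + |θ| := abs_sub _ _
    refine pow_le_pow_left₀ (abs_nonneg _) ?_ 2
    nlinarith [abs_nonneg θ]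
  · have hlim := hTd.const_mul ((K + |θ|) ^ 2 / (b / 2))
    rw [mul_zero] at hlim
    refine hlim.congr' ?_
    filter_upwards [eventually_ge_atTop 1] with n hn
    have hTp := hT_pos n hn
    have hn0 : (0 : ℝ) < n := by exact_mod_cast hn
    have e : (T n ^ (β + d)) ^ 2 = T n ^ (d : ℝ) * T n ^ (2 * β + d) := by
      rw [← Real.rpow_add hTp, ← Real.rpow_natCast, ← Real.rpow_mul hTp.le]
      congr 1
      push_cast
      ring
    have hp : 0 < T n ^ (2 * β + d) := by positivity
    rw [mul_pow, e]
    field_simp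
  · have hlim := (hρ.pow 2).const_mul ((c ^ D)⁻¹ / (b / 2))
    rw [zero_pow two_ne_zero, mul_zero] at hlim
    refine squeeze_zero' ?_ ?_ hlim
    · filter_upwards [eventually_ge_atTop 1] with n hn
      have hTp := hT_pos n hn
      positivity
    · filter_upwards [eventually_ge_atTop 1] with n hn
      have hTp := hT_pos n hn
      have hmean : ∫ ω, (κ n (V ω) - θ) ∂P = m n - θ := by
        rw [integral_sub (hint (hκc n)) (integrable_const _), integral_const, probReal_univ,
          one_smul]
      rw [hmean, ← sq_abs]
      have hp : 0 < T n ^ (2 * β + d) := by positivity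
      have hTD : T n ^ D = (T n ^ (2 * k)) ^ 2 * T n ^ (2 * β + d) := by
        rw [← pow_mul, ← Real.rpow_natCast, ← Real.rpow_add hTp, hDdef]
        congr 1
        push_cast
        ring
      have hn1 := natCast_le_of_rpow_le hD hc (hTn n hn).1
      rw [hTD] at hn1
      have hsq := pow_le_pow_left₀ (abs_nonneg _) (hmbias n hn) 2
      calc n * |m n - θ| ^ 2 / (b / 2 * T n ^ (2 * β + d))
          ≤ ((c ^ D)⁻¹ * ((T n ^ (2 * k)) ^ 2 * T n ^ (2 * β + d))) *
            ((T n ^ (2 * k))⁻¹ * r (⌊T n⌋₊ + 1)) ^ 2 / (b / 2 * T n ^ (2 * β + d)) := by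
              gcongr
        _ = _ := by field_simp

end Density

end SphDeconv

end

theorem mainTheorem6
    (d : ℕ) (hd : 1 ≤ d)
    -- an orthonormal basis of every space of spherical harmonics
    (B : (l : ℕ) → Fin (harmDim d l) → Sph d → ℂ) (hB : IsHarmonicBasis d B)
    -- the random variables: true value, rotation error, and i.i.d. copies of the rotated value
    {Ω : Type*} [MeasurableSpace Ω] (P : Measure Ω) [IsProbabilityMeasure P]
    (X : Ω → Sph d) (hX : Measurable X) (U : Ω → SO d) (hU : Measurable U)
    (hXU : IndepFun U X P)
    (Z : ℕ → Ω → Sph d) (hZ_indep : iIndepFun Z P)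
    (hZ_law : ∀ i, IdentDistrib (Z i) (fun ω => rot (U ω) (X ω)) P P)
    -- their densities
    (fX : Sph d → ℝ) (hfX_nonneg : ∀ x, 0 ≤ fX x)
    (hfX : P.map X = (surf d).withDensity fun x => ENNReal.ofReal (fX x))
    (fU : SO d → ℝ) (hfU_nonneg : ∀ u, 0 ≤ fU u) (hfU_sq : MemLp fU 2 (haarSO d))
    (hfU : P.map U = (haarSO d).withDensity fun u => ENNReal.ofReal (fU u))
    (hfU_inv : ∀ l, IsUnit (rotFourier B fU l))
    -- ordinary smoothness of order `β`, upper bound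
    (β : ℝ) (hβ : 0 ≤ β)
    (hS1 : ∃ c₁ : ℝ, 0 < c₁ ∧ ∀ l : ℕ, 1 ≤ l → opNorm (rotFourier B fU l)⁻¹ ≤ c₁ * (l : ℝ) ^ β)
    -- smoothness of the density
    (k : ℕ) (hk : (d : ℝ) / 4 < k)
    (hA1 : ContMDiff (𝓡 d) 𝓘(ℝ, ℝ) ((2 * k : ℕ) : WithTop ℕ∞) fX)
    -- speed of the truncation level
    (T : ℕ → ℝ) (hT_pos : ∀ n, 1 ≤ n → 0 < T n)
    (hT : ∃ c C : ℝ, 0 < c ∧ 0 < C ∧ ∀ n : ℕ, 1 ≤ n →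
      c * (n : ℝ) ^ (1 / (4 * k + 2 * β + d)) ≤ T n ∧
      T n ≤ C * (n : ℝ) ^ (1 / (4 * k + 2 * β + d)))
    -- the empirical likelihood ratio is positive with probability tending to one
    (hE1 : ∀ x, Tendsto (fun n : ℕ =>
      P.real {ω | 0 < elDensity B fU (T n) n (fun i => Z i ω) (fX x) x}) atTop (𝓝 1))
    -- lower bound on the second moment of the kernel
    (hB1 : ∀ x, ∃ c : ℝ, 0 < c ∧ ∀ n : ℕ, 1 ≤ n →
      c * T n ^ (2 * β + d) ≤ ∫ ω, (kern B fU (T n) x (rot (U ω) (X ω))).re ^ 2 ∂P)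
    -- absolute convergence of the Fourier-Laplace series of the iterated Laplacian of the density
    (hAbs : AbsConvFourierLaplace B (laplaceBeltrami^[k] fX)) :
    ∀ x : Sph d,
      TendstoInDistribution
        (fun (n : ℕ) ω => negTwoLog (elDensity B fU (T n) n (fun i => Z i ω) (fX x) x))
        atTop (fun t : ℝ => (t : EReal)) (fun _ => P) chiSqOne ∧
      ∀ α : ℝ, 0 < α → α < 1 →
        (∀ (n : ℕ) (ω : Ω),
          {θ : ℝ | negTwoLog (elDensity B fU (T n) n (fun i => Z i ω) θ x) ≤
              ((chiSqQuantile α : ℝ) : EReal)} =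
            {θ : ℝ | Real.exp (-chiSqQuantile α / 2) ≤
              elDensity B fU (T n) n (fun i => Z i ω) θ x} ∧
          {θ : ℝ | negTwoLog (elDensity B fU (T n) n (fun i => Z i ω) θ x) ≤
              ((chiSqQuantile α : ℝ) : EReal)}.OrdConnected) ∧
        Tendsto (fun n : ℕ => P.real {ω | fX x ∈
          {θ : ℝ | negTwoLog (elDensity B fU (T n) n (fun i => Z i ω) θ x) ≤
              ((chiSqQuantile α : ℝ) : EReal)}}) atTop (𝓝 (1 - α)) := by
  intro x
  have hk' : d + 1 ≤ 4 * k := by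
    have h : (d : ℝ) < ((4 * k : ℕ) : ℝ) := by
      push_cast
      linarith
    exact_mod_cast h
  have hdist := tendstoInDistribution_negTwoLog_elDensity hd hB hX hU hXU hZ_indep hZ_law
    hfX_nonneg hfX hfU_nonneg (hfU_sq.integrable one_le_two) hfU hfU_inv hβ hS1 hk'
    (sphSmooth_of_contMDiff hA1) hT_pos hT hAbs x (hE1 x) (hB1 x)
  refine ⟨hdist, fun α h0 h1 => ⟨fun n ω => ?_, tendsto_measureReal_le_quantile hdist h0 h1⟩⟩
  have hset : {θ : ℝ | negTwoLog (elDensity B fU (T n) n (fun i => Z i ω) θ x) ≤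
      ((chiSqQuantile α : ℝ) : EReal)} = {θ : ℝ | Real.exp (-chiSqQuantile α / 2) ≤
        elDensity B fU (T n) n (fun i => Z i ω) θ x} :=
    Set.ext fun θ => negTwoLog_le_coe_iff (elRatio_nonneg _ _)
  refine ⟨hset, ?_⟩
  rw [hset]
  exact ordConnected_elRatio_sub _ (Real.exp_pos _)
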